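/- Let $R>0$, $\Omega=(-R,R)$, $a,b,c\in L^\infty(\Omega)$, $f\in L^2(\Omega)$, let $g_1,g_2,g$ be real functions on $\partial\Omega=\{-R,R\}$ and let $\gamma\ge 0$. Let $u$ be a strong ($H^2(\Omega)$) real solution of $$Lu:=au''+bu'+cu=f\ \text{ in }\Omega,\qquad Bu:=g_1u'+g_2u=g\ \text{ on }\partial\Omega .$$ Fix an integer $N_p>4$. For an integer $P\ge1$ put $r=R/P$, $x_p=-R+2rp$ and $l_p(x)=(x-x_p)/r$ for $0\le p\le P$, and $$\phi(t)=\mathbf 1_{[-\frac54,-\frac34)}(t)\tfrac{1+\sin 2\pi t}{2}+\mathbf 1_{[-\frac34,\frac34)}(t)+\mathbf 1_{[\frac34,\frac54)}(t)\tfrac{1-\sin 2\pi t}{2}.$$ For weights $k=(k_{p,i})$ and coefficients $\alpha=(\alpha_{p,i})$ let $$u_N(x)=\sum_{p=0}^{P}\phi(l_p(x))\sum_{i=1}^{N_p}\Bigl(\alpha_{p,i}\cos(k_{p,i}l_p(x))+\alpha_{p,N_p+i}\sin(k_{p,i}l_p(x))\Bigr),$$ $$\mathcal L(\alpha;k)=\|Lu_N-f\|_{L^2(\Omega)}^2+\gamma\sum_{x\in\{-R,R\}}|Bu_N(x)-g(x)|^2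 ,$$ and let the $k_{p,i}$ ($0\le p\le P$, $1\le i\le N_p$) be independent and uniformly distributed on $(0,S)$. Then $\min_\alpha\mathcal L(\alpha;k)$ is attained for every $k$ and is integrable for every $S>0$. Write $E(r,S)=\mathbb E\min_\alpha\mathcal L(\alpha;k)$. (i) Assume that one of the following holds for some $\rho>0$: - (analytic class; put $s=1$) $u$ extends from $\Omega$ to a function $F$ analytic in the strip $|\operatorname{Im}z|<\rho$, with $\|F(\cdot+iy)\|_{L^2(\mathbb R)}$ bounded uniformly in $y\in(-\rho,\rho)$; - (Gevrey class, $s>1$) $u$ extends from $\Omega$ to a function $v$ in $G^s(-R-\rho,R+\rho)$, i.e. $v$ is $C^\infty$ there and for every compact $K\subset(-R-\rho,R+\rho)$ there are $M,C_0>0$ with $\max_K|v^{(n)}|\le MC_0^n(n!)^s$ for all $n\ge0$. Then for every $t\in(0,1)$ there are $\kappa>0$ and $C$, both independent of $r$, such that for all $r=R/P$, $P\ge1$, $$E(r,r^t)\le C\Bigl(r^{4t(N_p-1)/3-4}+\exp\bigl(-\kappa r^{(t-1)/s}\bigr)\Bigr),$$ and the first term dominates as $r\to0$: $\exp(-\kappa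 r^{(t-1)/s})=o\bigl(r^{4t(N_p-1)/3-4}\bigr)$ as $r\to0^+$. (ii) Assume $u\in H^s(\Omega)$ with real $s\ge2$. Then for every $t\in(0,1)$ there is $C$ independent of $r$ such that for all $r=R/P$, $P\ge1$, $$E(r,r^t)\le C\Bigl(r^{4t(N_p-1)/3-4}+r^{2(1-t)(s-2)}\Bigr).$$ Moreover $t_*=3s/(2N_p+3s-8)$ lies in $(0,1)$, and there is $C$ independent of $r$ such that for all $r=R/P$, $P\ge1$, $$E(r,r^{t_*})\le C\,r^{\frac{4(N_p-4)(s-2)}{2N_p+3s-8}} .$$ -/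

import Mathlib

open MeasureTheory Set Filter Topology
open scoped ENNReal SchwartzMap

noncomputable section

namespace RFM

/-- The data of the two-point boundary value problem
`a u'' + b u' + c u = f` on `Ω = (-R, R)`, `g₁ u' + g₂ u = g` on `∂Ω = {-R, R}`,
with `a, b, c ∈ L^∞(Ω)` and `f ∈ L²(Ω)`.  Only the values of `g₁, g₂, g` at `±R` are used. -/
structure EllipticBVP where
  R : ℝ
  a : ℝ → ℝ
  b : ℝ → ℝ
  c : ℝ → ℝ
  f : ℝ → ℝ
  g₁ : ℝ → ℝ
  g₂ : ℝ → ℝ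
  g : ℝ → ℝ
  R_pos : 0 < R
  a_mem : MemLp a ∞ (volume.restrict (Ioo (-R) R))
  b_mem : MemLp b ∞ (volume.restrict (Ioo (-R) R))
  c_mem : MemLp c ∞ (volume.restrict (Ioo (-R) R))
  f_mem : MemLp f 2 (volume.restrict (Ioo (-R) R))

namespace EllipticBVP

/-- `u` is a (strong) solution: `u` is (the continuous representative of) an element of `H²(Ω)`,
i.e. `u` and its derivative `u₁` are absolutely continuous on `[-R, R]` and `u₁` has derivative
`u₂ ∈ L²(Ω)`; the equation holds almost everywhere and the boundary condition at both ends. -/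
def IsSolution (D : EllipticBVP) (u : ℝ → ℝ) : Prop :=
  ∃ u₁ u₂ : ℝ → ℝ,
    MemLp u₂ 2 (volume.restrict (Ioo (-D.R) D.R)) ∧
    (∀ x ∈ Icc (-D.R) D.R, u x = u (-D.R) + ∫ y in (-D.R)..x, u₁ y) ∧
    (∀ x ∈ Icc (-D.R) D.R, u₁ x = u₁ (-D.R) + ∫ y in (-D.R)..x, u₂ y) ∧
    (∀ᵐ x ∂(volume.restrict (Ioo (-D.R) D.R)),
      D.a x * u₂ x + D.b x * u₁ x + D.c x * u x = D.f x) ∧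
    (∀ x ∈ ({-D.R, D.R} : Set ℝ), D.g₁ x * u₁ x + D.g₂ x * u x = D.g x)

/-- The operator `L w = a w'' + b w' + c w`, applied to functions that are twice differentiable
almost everywhere in `Ω`. -/
def opL (D : EllipticBVP) (w : ℝ → ℝ) (x : ℝ) : ℝ :=
  D.a x * deriv (deriv w) x + D.b x * deriv w x + D.c x * w x

/-- The boundary operator `B w = g₁ w' + g₂ w`, applied to functions differentiable at `±R`. -/
def opB (D : EllipticBVP) (w : ℝ → ℝ) (x : ℝ) : ℝ :=
  D.g₁ x * deriv w x + D.g₂ x * w x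

/-- The loss `‖L w - f‖²_{L²(Ω)} + γ ‖B w - g‖²_{L²(∂Ω)}` of a trial function `w`. -/
def lossOf (D : EllipticBVP) (γ : ℝ) (w : ℝ → ℝ) : ℝ :=
  (∫ x in Ioo (-D.R) D.R, (D.opL w x - D.f x) ^ 2) +
    γ * ((D.opB w (-D.R) - D.g (-D.R)) ^ 2 + (D.opB w D.R - D.g D.R) ^ 2)

end EllipticBVP

/-- The partition of unity profile (a `C¹`, piecewise smooth function). -/
def pouProfile (t : ℝ) : ℝ :=
  (Ico (-5 / 4 : ℝ) (-3 / 4)).indicator (fun t => (1 + Real.sin (2 * Real.pi * t)) / 2) t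
    + (Ico (-3 / 4 : ℝ) (3 / 4)).indicator (fun _ => 1) t
    + (Ico (3 / 4 : ℝ) (5 / 4)).indicator (fun t => (1 - Real.sin (2 * Real.pi * t)) / 2) t

/-- The patch size `r = R / P`. -/
def patchSize (R : ℝ) (P : ℕ) : ℝ := R / P

/-- The normalized coordinate `l_p(x) = (x - x_p) / r`, with `x_p = -R + 2 r p`. -/
def localCoord (R : ℝ) (P : ℕ) (p : Fin (P + 1)) (x : ℝ) : ℝ :=
  (x - (-R + 2 * patchSize R P * (p : ℕ))) / patchSize R P

/-- The random feature trial function with partition of unity,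
`u_N(x) = ∑_{p=0}^{P} φ(l_p(x)) v_p(x)`, where
`v_p(x) = ∑_i (α_{p,i} cos(k_{p,i} l_p(x)) + α_{p,N_p+i} sin(k_{p,i} l_p(x)))`.
The coefficient of a cosine is indexed by `Sum.inl i`, that of a sine by `Sum.inr i`. -/
def pumTrial (R : ℝ) (P Np : ℕ) (k : Fin (P + 1) × Fin Np → ℝ)
    (α : Fin (P + 1) × (Fin Np ⊕ Fin Np) → ℝ) (x : ℝ) : ℝ :=
  ∑ p : Fin (P + 1), pouProfile (localCoord R P p x) *
    ∑ i : Fin Np, (α (p, Sum.inl i) * Real.cos (k (p, i) * localCoord R P p x)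
      + α (p, Sum.inr i) * Real.sin (k (p, i) * localCoord R P p x))

/-- The loss `ℒ(α; k)`. -/
def loss (D : EllipticBVP) (γ : ℝ) (P Np : ℕ) (k : Fin (P + 1) × Fin Np → ℝ)
    (α : Fin (P + 1) × (Fin Np ⊕ Fin Np) → ℝ) : ℝ :=
  D.lossOf γ (pumTrial D.R P Np k α)

/-- The minimal loss `min_α ℒ(α; k)` (that the minimum is attained is part of the theorem). -/
def minLoss (D : EllipticBVP) (γ : ℝ) (P Np : ℕ) (k : Fin (P + 1) × Fin Np → ℝ) : ℝ :=
  ⨅ α : Fin (P + 1) × (Fin Np ⊕ Fin Np) → ℝ, loss D γ P Np k α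

/-- The joint law of the hidden weights `k_{p,i}`, independent and uniform on `(0, S)`. -/
def weightLaw (P Np : ℕ) (S : ℝ) : Measure (Fin (P + 1) × Fin Np → ℝ) :=
  Measure.pi fun _ => ProbabilityTheory.cond (volume : Measure ℝ) (Ioo 0 S)

/-- The expected minimal loss `𝔼 min_α ℒ(α; k)` for weights sampled from `(0, S)`. -/
def expMinLoss (D : EllipticBVP) (γ : ℝ) (P Np : ℕ) (S : ℝ) : ℝ :=
  ∫ k, minLoss D γ P Np k ∂(weightLaw P Np S)

/-- On `(-R, R)`, `u` is the restriction of a function that is analytic in the strip `|Im z| < ρ`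
and whose `L²` norms along the horizontal lines of the strip are uniformly bounded. -/
def HasStripExtension (R ρ : ℝ) (u : ℝ → ℝ) : Prop :=
  ∃ F : ℂ → ℂ,
    AnalyticOnNhd ℂ F {z : ℂ | |z.im| < ρ} ∧
    (∃ M : ℝ≥0∞, M ≠ ∞ ∧ ∀ y ∈ Ioo (-ρ) ρ,
      eLpNorm (fun x : ℝ => F (x + y * Complex.I)) 2 volume ≤ M) ∧
    ∀ x ∈ Ioo (-R) R, F x = u x

/-- The Gevrey class `G^s(U)` of an open set `U ⊆ ℝ`. -/
def MemGevrey (s : ℝ) (U : Set ℝ) (v : ℝ → ℝ) : Prop :=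
  ContDiffOn ℝ (⊤ : ℕ∞) v U ∧
  ∀ K ⊆ U, IsCompact K → ∃ M > 0, ∃ C > 0, ∀ x ∈ K, ∀ n : ℕ,
    |iteratedDeriv n v x| ≤ M * C ^ n * (n.factorial : ℝ) ^ s

/-- On `(-R, R)`, `u` is the restriction of a function in `G^s(-R-ρ, R+ρ)`. -/
def HasGevreyExtension (s R ρ : ℝ) (u : ℝ → ℝ) : Prop :=
  ∃ v : ℝ → ℝ, MemGevrey s (Ioo (-R - ρ) (R + ρ)) v ∧ ∀ x ∈ Ioo (-R) R, v x = u x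

/-- `u ∈ H^s(-R, R)` for a real exponent `s ≥ 0`: `u` is, almost everywhere on `(-R, R)`, the
restriction of an element of `H^s(ℝ)`, the space of all `U ∈ L²(ℝ)` with
`(1 + |ξ|²)^{s/2} 𝓕U ∈ L²(ℝ)`. -/
def MemHs (s R : ℝ) (u : ℝ → ℝ) : Prop :=
  ∃ U : Lp ℂ 2 (volume : Measure ℝ),
    TemperedDistribution.MemSobolev s 2 (U : 𝓢'(ℝ, ℂ)) ∧
    ∀ᵐ x ∂(volume.restrict (Ioo (-R) R)), U x = (u x : ℂ)

end RFM

end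

noncomputable section

/-! ### Trigonometric approximation with prescribed frequencies -/

namespace RFM

/-! The estimate is deterministic. It holds for every choice of pairwise distinct weights in `(0,
S)`, and such choices have full probability, so the expectation only averages a uniform bound
(`ae_weightLaw`, `expMinLoss_le`).

The heart is `exists_trigSum_approx`. Let the derivatives of `w` satisfy `|w⁽ʲ⁾| ≤ M S ^ j`, and let
`κ₀` be one of the frequencies. Applying `d²/dx² + κ₀²` to `w` replaces `M` by at most `2 S² M`.
Approximate the result by a sum over the other frequencies, divide each coefficient by `κ₀² - κ²`,
and add the multiple of `cos (κ₀ x)` and `sin (κ₀ x)` that matches the data at `0`. The remainder is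
a forced oscillator with zero initial data, hence bounded by the previous error
(`oscillator_bound`). Thus `n` frequencies give a `C²` error of order `M S ^ (2n)`. The coefficients
may be huge when frequencies are close, but the error bound sees neither the gaps nor the
coefficients.

On patches of size `r` two derivatives cost `r⁻²`, and at most two patches overlap
(`exists_coefficients`). Together with the stability estimate `lossOf_le` this yields
`expMinLoss_le_of_approx`: if `q` is smooth with `|q⁽ʲ⁾| ≤ M (S/r) ^ j` for `j ≤ 2 Np` and
approximates the solution with squared error `δ`, then the expected loss is at most `C (M² S ^ (4
Np) / r⁴ + δ)`.

For `S = r ^ t` the first term is `M² r ^ (4 t Np - 4)`, which is stronger than the claimed power of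
`r` because `r ≤ R` (`rpow_pow_div_le`). In (i), `q` is a smooth extension of `u` times a cutoff, so
`δ = 0`, and `M` is uniform in `r` because `S / r = r ^ (t - 1)` is bounded below. In (ii), `q` is
`u` with the frequencies above `S / (2πr)` removed, and `δ` is the high-frequency tail, of order `r
^ (2 (1 - t) (s - 2))` (`exists_bandlimited_approx`). The exponent `t_*` makes the two powers equal.

The minimum is attained because the loss is the squared distance from a target to a point of a
finite-dimensional subspace (`loss_eq_norm_sq`). -/

/-- The trigonometric sum `∑_{κ ∈ K} (α_κ cos (κ x) + β_κ sin (κ x))`. -/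
def trigSum (K : Finset ℝ) (α β : ℝ → ℝ) (x : ℝ) : ℝ :=
  ∑ κ ∈ K, (α κ * Real.cos (κ * x) + β κ * Real.sin (κ * x))

lemma hasDerivAt_trigSum (K : Finset ℝ) (α β : ℝ → ℝ) (x : ℝ) :
    HasDerivAt (trigSum K α β) (trigSum K (fun κ => κ * β κ) (fun κ => -κ * α κ) x) x := by
  unfold trigSum
  refine HasDerivAt.fun_sum fun κ _ => ?_
  have h0 : HasDerivAt (fun x : ℝ => κ * x) κ x := by simpa using (hasDerivAt_id x).const_mul κ
  have h1 := (h0.cos.const_mul (α κ)).add (h0.sin.const_mul (β κ))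
  refine h1.congr_deriv ?_
  ring

/-- A priori bounds for the harmonic oscillator with vanishing initial data. -/
lemma oscillator_bound {κ A B : ℝ} {e e' g : ℝ → ℝ} (hA : 0 ≤ A)
    (h1 : ∀ x, HasDerivAt e (e' x) x) (h2 : ∀ x, HasDerivAt e' (g x - κ ^ 2 * e x) x)
    (h0 : e 0 = 0) (h0' : e' 0 = 0) (hg : ∀ x, |x| ≤ A → |g x| ≤ B) {x : ℝ} (hx : |x| ≤ A) :
    |e' x| ≤ A * B ∧ |e x| ≤ A ^ 2 * B := by
  have hB : 0 ≤ B := (abs_nonneg _).trans (hg 0 (by simpa using hA))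
  have hconv : Convex ℝ {y : ℝ | |y| ≤ A} := by
    have : {y : ℝ | |y| ≤ A} = Icc (-A) A := by ext y; simp [abs_le]
    rw [this]; exact convex_Icc _ _
  have h0mem : (0 : ℝ) ∈ {y : ℝ | |y| ≤ A} := by simpa using hA
  have key : ∀ x, |x| ≤ A → |e' x| ≤ A * B := by
    intro x hx
    -- Variation of parameters: this expression equals `e' x` at `y = x`, vanishes at `y = 0`, and
    -- its derivative retains only the forcing term. The bound is therefore independent of `κ`.
    have hd : ∀ y, HasDerivAt
        (fun y => e' y * Real.cos (κ * (x - y)) - κ * (e y * Real.sin (κ * (x - y))))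
        (g y * Real.cos (κ * (x - y))) y := by
      intro y
      have hl : HasDerivAt (fun y : ℝ => κ * (x - y)) (-κ) y := by
        simpa using ((hasDerivAt_id y).const_sub x).const_mul κ
      have := ((h2 y).mul hl.cos).sub (((h1 y).mul hl.sin).const_mul κ)
      refine this.congr_deriv ?_
      ring
    have := hconv.norm_image_sub_le_of_norm_hasDerivWithin_le (C := B)
      (fun y _ => (hd y).hasDerivWithinAt) (fun y hy => by
        rw [Real.norm_eq_abs, abs_mul]
        calc |g y| * |Real.cos (κ * (x - y))| ≤ B * 1 := by
              gcongr
              · exact hg y hy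
              · exact Real.abs_cos_le_one _
          _ = B := mul_one B) h0mem hx
    simp only [sub_self, mul_zero, Real.cos_zero, mul_one, Real.sin_zero, sub_zero, h0, h0',
      zero_mul, Real.norm_eq_abs] at this
    nlinarith [abs_nonneg x]
  refine ⟨key x hx, ?_⟩
  have := hconv.norm_image_sub_le_of_norm_hasDerivWithin_le (C := A * B)
    (fun y _ => (h1 y).hasDerivWithinAt) (fun y hy => key y hy) h0mem hx
  rw [h0, sub_zero, sub_zero, Real.norm_eq_abs, Real.norm_eq_abs] at this
  nlinarith [mul_nonneg hA hB]

/-- On frequency `κ` the operator `d²/dx² + κ₀²` acts as multiplication by `κ₀² - κ²`. This factor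
is nonzero since all frequencies are positive and `κ₀` is not among them. -/
lemma trigSum_oscillator {K : Finset ℝ} {κ₀ : ℝ} (hκ₀ : 0 < κ₀) (hK : ∀ κ ∈ K, 0 < κ)
    (h : κ₀ ∉ K) (α β : ℝ → ℝ) (x : ℝ) :
    trigSum K (fun κ => α κ / (κ₀ ^ 2 - κ ^ 2)) (fun κ => β κ / (κ₀ ^ 2 - κ ^ 2)) x * κ₀ ^ 2 +
      trigSum K (fun κ => κ * (-κ * (α κ / (κ₀ ^ 2 - κ ^ 2))))
        (fun κ => -κ * (κ * (β κ / (κ₀ ^ 2 - κ ^ 2)))) x = trigSum K α β x := by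
  unfold trigSum
  rw [Finset.sum_mul, ← Finset.sum_add_distrib]
  refine Finset.sum_congr rfl fun κ hκ => ?_
  have hne : κ₀ ^ 2 - κ ^ 2 ≠ 0 := by
    have h1 : κ₀ - κ ≠ 0 := sub_ne_zero.2 fun h' => h (h' ▸ hκ)
    have h2 : κ₀ + κ ≠ 0 := (add_pos hκ₀ (hK κ hκ)).ne'
    have : κ₀ ^ 2 - κ ^ 2 = (κ₀ - κ) * (κ₀ + κ) := by ring
    rw [this]; exact mul_ne_zero h1 h2
  field_simp
  ring

/-- Local approximation by trigonometric sums: if the derivatives of `w` of order at most `2 |K|`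
grow like those of a function with frequencies in `[-S, S]`, then `w` is approximated in `C²` on
`[-A, A]` by trigonometric sums with the frequencies `K ⊆ (0, S)`, to the order `S ^ (2 |K|)`. -/
theorem exists_trigSum_approx {A S : ℝ} (hA : 1 ≤ A) (hS : 0 ≤ S) (K : Finset ℝ) :
    (∀ κ ∈ K, 0 < κ ∧ κ < S) → ∀ (w : ℝ → ℝ) (M : ℝ), ContDiff ℝ (⊤ : ℕ∞) w →
    (∀ j ≤ 2 * K.card, ∀ x, |iteratedDeriv j w x| ≤ M * S ^ j) →
    ∃ α β : ℝ → ℝ, ∀ x, |x| ≤ A →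
      |w x - trigSum K α β x| ≤ (2 * A ^ 2) ^ K.card * M * S ^ (2 * K.card) ∧
      (K.Nonempty →
        |deriv w x - deriv (trigSum K α β) x| ≤
          (1 + S ^ 2) * ((2 * A ^ 2) ^ K.card * M * S ^ (2 * K.card)) ∧
        |deriv (deriv w) x - deriv (deriv (trigSum K α β)) x| ≤
          (1 + S ^ 2) * ((2 * A ^ 2) ^ K.card * M * S ^ (2 * K.card))) := by
  induction K using Finset.induction_on with
  | empty =>
    intro _ w M _ hw
    -- With no frequencies only the order-zero bound on `w` is available, hence the restriction of
    -- the derivative estimates to nonempty `K`.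
    refine ⟨0, 0, fun x _ => ⟨?_, fun h => by simp at h⟩⟩
    simpa [trigSum] using hw 0 (by simp) x
  | insert κ₀ K hκ₀ ih =>
    intro hK w M hw hb
    have hpos : 0 < κ₀ := (hK κ₀ (by simp)).1
    have hltS : κ₀ < S := (hK κ₀ (by simp)).2
    have hKpos : ∀ κ ∈ K, 0 < κ ∧ κ < S := fun κ h => hK κ (by simp [h])
    rw [Finset.card_insert_of_notMem hκ₀] at hb ⊢
    have hM : 0 ≤ M := by simpa using (abs_nonneg _).trans (hb 0 (by omega) 0)
    have hw1 : ContDiff ℝ (⊤ : ℕ∞) (deriv w) := by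
      rw [contDiff_infty_iff_deriv] at hw; exact hw.2
    have hw2 : ContDiff ℝ (⊤ : ℕ∞) (deriv (deriv w)) := by
      rw [contDiff_infty_iff_deriv] at hw1; exact hw1.2
    have hw1' : ContDiff ℝ (⊤ : ℕ∞) (fun x => deriv (deriv w) x + κ₀ ^ 2 * w x) := by fun_prop
    -- Both `w⁽ʲ⁺²⁾` and `κ₀² w⁽ʲ⁾` are at most `S² M S ^ j`, which gives the new constant `2 S² M`.
    -- Two orders of derivatives are spent per frequency.
    obtain ⟨α, β, hαβ⟩ := ih hKpos (fun x => deriv (deriv w) x + κ₀ ^ 2 * w x) (2 * S ^ 2 * M)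
      hw1' (by
        intro j hj x
        have e1 : iteratedDeriv j (fun x => deriv (deriv w) x + κ₀ ^ 2 * w x) x =
            iteratedDeriv (j + 2) w x + κ₀ ^ 2 * iteratedDeriv j w x := by
          have hd1 : ContDiffAt ℝ j (deriv (deriv w)) x := hw2.contDiffAt.of_le (by exact_mod_cast le_top)
          have hd2 : ContDiffAt ℝ j w x := hw.contDiffAt.of_le (by exact_mod_cast le_top)
          rw [iteratedDeriv_fun_add hd1 (contDiffAt_const.mul hd2),
            iteratedDeriv_const_mul_field, iteratedDeriv_succ', iteratedDeriv_succ']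
        rw [e1]
        have b1 := hb (j + 2) (by omega) x
        have b2 := hb j (by omega) x
        have hk2 : κ₀ ^ 2 ≤ S ^ 2 := by gcongr
        calc _ ≤ |iteratedDeriv (j + 2) w x| + |κ₀ ^ 2 * iteratedDeriv j w x| := abs_add_le _ _
          _ = |iteratedDeriv (j + 2) w x| + κ₀ ^ 2 * |iteratedDeriv j w x| := by
              rw [abs_mul, abs_of_nonneg (sq_nonneg κ₀)]
          _ ≤ M * S ^ (j + 2) + S ^ 2 * (M * S ^ j) := by gcongr
          _ = 2 * S ^ 2 * M * S ^ j := by ring)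
    set a' : ℝ → ℝ := fun κ => α κ / (κ₀ ^ 2 - κ ^ 2) with ha'
    set b' : ℝ → ℝ := fun κ => β κ / (κ₀ ^ 2 - κ ^ 2) with hb'
    set z : ℝ → ℝ := fun x => w x - trigSum K a' b' x with hz
    set z' : ℝ → ℝ := fun x => deriv w x -
      trigSum K (fun κ => κ * b' κ) (fun κ => -κ * a' κ) x with hz'
    have hT : ∀ x, trigSum (insert κ₀ K) (Function.update a' κ₀ (z 0))
        (Function.update b' κ₀ (z' 0 / κ₀)) x =
        trigSum K a' b' x + (z 0 * Real.cos (κ₀ * x) + z' 0 / κ₀ * Real.sin (κ₀ * x)) := by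
      intro x
      unfold trigSum
      rw [Finset.sum_insert hκ₀, add_comm]
      congr 1
      · refine Finset.sum_congr rfl fun κ hκ => ?_
        have : κ ≠ κ₀ := fun h => hκ₀ (h ▸ hκ)
        simp [Function.update_of_ne this]
      · simp
    -- The coefficients at `κ₀` are chosen so that `w - T` and its derivative vanish at `0`.
    refine ⟨Function.update a' κ₀ (z 0), Function.update b' κ₀ (z' 0 / κ₀), ?_⟩
    set T := trigSum (insert κ₀ K) (Function.update a' κ₀ (z 0))
        (Function.update b' κ₀ (z' 0 / κ₀)) with hTdef
    have hT1 : ∀ x, HasDerivAt T (trigSum K (fun κ => κ * b' κ) (fun κ => -κ * a' κ) x +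
        (z' 0 * Real.cos (κ₀ * x) - κ₀ * (z 0 * Real.sin (κ₀ * x)))) x := by
      intro x
      have h0 : HasDerivAt (fun x : ℝ => κ₀ * x) κ₀ x := by
        simpa using (hasDerivAt_id x).const_mul κ₀
      have := (hasDerivAt_trigSum K a' b' x).add
        ((h0.cos.const_mul (z 0)).add (h0.sin.const_mul (z' 0 / κ₀)))
      have heq : T = (trigSum K a' b' + ((fun x => z 0 * Real.cos (κ₀ * x)) +
          fun x => z' 0 / κ₀ * Real.sin (κ₀ * x))) := by
        funext x; simp [hT]
      rw [heq]
      refine this.congr_deriv ?_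
      field_simp
      ring
    have hT1' : deriv T = fun x => trigSum K (fun κ => κ * b' κ) (fun κ => -κ * a' κ) x +
        (z' 0 * Real.cos (κ₀ * x) - κ₀ * (z 0 * Real.sin (κ₀ * x))) :=
      funext fun x => (hT1 x).deriv
    have hT2 : ∀ x, HasDerivAt (deriv T)
        (trigSum K α β x - κ₀ ^ 2 * T x) x := by
      intro x
      have h0 : HasDerivAt (fun x : ℝ => κ₀ * x) κ₀ x := by
        simpa using (hasDerivAt_id x).const_mul κ₀
      have := (hasDerivAt_trigSum K (fun κ => κ * b' κ) (fun κ => -κ * a' κ) x).add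
        ((h0.cos.const_mul (z' 0)).sub ((h0.sin.const_mul (z 0)).const_mul κ₀))
      rw [hT1']
      refine this.congr_deriv ?_
      have h3 := trigSum_oscillator hpos (fun κ h => (hKpos κ h).1) hκ₀ α β x
      change trigSum K a' b' x * κ₀ ^ 2 + trigSum K (fun κ => κ * (-κ * a' κ))
        (fun κ => -κ * (κ * b' κ)) x = _ at h3
      have hc : z' 0 / κ₀ * κ₀ = z' 0 := div_mul_cancel₀ _ hpos.ne'
      rw [hT]
      linear_combination h3 + κ₀ * Real.sin (κ₀ * x) * hc
    have hwd : ∀ x, HasDerivAt w (deriv w x) x := fun x =>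
      (hw.differentiable (by simp) x).hasDerivAt
    have hwd2 : ∀ x, HasDerivAt (deriv w) (deriv (deriv w) x) x := fun x =>
      (hw1.differentiable (by simp) x).hasDerivAt
    set n := K.card
    set B : ℝ := (2 * A ^ 2) ^ n * (2 * S ^ 2 * M) * S ^ (2 * n) with hBdef
    have hB : 0 ≤ B := by positivity
    set g : ℝ → ℝ := fun x => deriv (deriv w) x + κ₀ ^ 2 * w x - trigSum K α β x with hgdef
    have hg : ∀ x, |x| ≤ A → |g x| ≤ B := fun x hx => (hαβ x hx).1
    have hmain : ∀ x, |x| ≤ A →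
        |deriv w x - deriv T x| ≤ A * B ∧ |w x - T x| ≤ A ^ 2 * B := by
      intro x hx
      refine oscillator_bound (κ := κ₀) (e := fun x => w x - T x)
        (e' := fun x => deriv w x - deriv T x) (g := g) (by linarith)
        (fun x => (hwd x).sub (hT1 x).differentiableAt.hasDerivAt) ?_ ?_ ?_ hg hx
      · intro x
        refine ((hwd2 x).sub (hT2 x)).congr_deriv ?_
        simp only [hgdef]; ring
      · simp [hT, hz]
      · simp [hT1', hz']
    have hAB : (2 * A ^ 2) ^ (n + 1) * M * S ^ (2 * (n + 1)) = A ^ 2 * B := by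
      rw [hBdef]; ring
    have hA2 : A ≤ A ^ 2 := by nlinarith
    have hA1 : 1 ≤ A ^ 2 := by nlinarith
    intro x hx
    obtain ⟨m1, m2⟩ := hmain x hx
    rw [hAB]
    refine ⟨m2, fun _ => ⟨?_, ?_⟩⟩
    · calc _ ≤ A * B := m1
        _ ≤ A ^ 2 * B := by gcongr
        _ ≤ (1 + S ^ 2) * (A ^ 2 * B) := by
          have : 0 ≤ S ^ 2 * (A ^ 2 * B) := by positivity
          linarith
    -- The oscillator equation converts bounds on the forcing and on the error itself into a bound
    -- on the second derivative, so no further derivative of `w` is needed.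
    · have e2 : deriv (deriv w) x - deriv (deriv T) x = g x - κ₀ ^ 2 * (w x - T x) := by
        rw [(hT2 x).deriv]; simp only [hgdef]; ring
      rw [e2]
      have hk2 : κ₀ ^ 2 ≤ S ^ 2 := by gcongr
      calc _ ≤ |g x| + |κ₀ ^ 2 * (w x - T x)| := abs_sub _ _
        _ = |g x| + κ₀ ^ 2 * |w x - T x| := by rw [abs_mul, abs_of_nonneg (sq_nonneg κ₀)]
        _ ≤ B + S ^ 2 * (A ^ 2 * B) := by
          gcongr
          exact hg x hx
        _ ≤ A ^ 2 * B + S ^ 2 * (A ^ 2 * B) := by nlinarith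
        _ = _ := by ring

end RFM

/-! ### The partition of unity profile -/

namespace RFM

/-- The smooth step from `0` to `1` on `[-5/4, -3/4]` from which the profile is built. -/
def stepProfile (t : ℝ) : ℝ :=
  if t < -5 / 4 then 0 else if t < -3 / 4 then (1 + Real.sin (2 * Real.pi * t)) / 2 else 1

/-- The derivative of `stepProfile`. -/
def stepProfileDeriv (t : ℝ) : ℝ :=
  if t < -5 / 4 then 0 else if t < -3 / 4 then Real.pi * Real.cos (2 * Real.pi * t) else 0

/-- The second derivative of `stepProfile` away from the two gluing points. -/
def stepProfileDeriv2 (t : ℝ) : ℝ :=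
  if t < -5 / 4 then 0 else
    if t < -3 / 4 then -(2 * Real.pi ^ 2) * Real.sin (2 * Real.pi * t) else 0

lemma sin_two_pi_gluing_left : Real.sin (2 * Real.pi * (-5 / 4)) = -1 := by
  rw [show 2 * Real.pi * (-5 / 4) = -(Real.pi / 2) - 2 * Real.pi by ring, Real.sin_sub_two_pi,
    Real.sin_neg, Real.sin_pi_div_two]

lemma sin_two_pi_gluing_right : Real.sin (2 * Real.pi * (-3 / 4)) = 1 := by
  rw [show 2 * Real.pi * (-3 / 4) = Real.pi / 2 - 2 * Real.pi by ring, Real.sin_sub_two_pi,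
    Real.sin_pi_div_two]

lemma cos_two_pi_gluing_left : Real.cos (2 * Real.pi * (-5 / 4)) = 0 := by
  rw [show 2 * Real.pi * (-5 / 4) = -(Real.pi / 2) - 2 * Real.pi by ring, Real.cos_sub_two_pi,
    Real.cos_neg, Real.cos_pi_div_two]

lemma cos_two_pi_gluing_right : Real.cos (2 * Real.pi * (-3 / 4)) = 0 := by
  rw [show 2 * Real.pi * (-3 / 4) = Real.pi / 2 - 2 * Real.pi by ring, Real.cos_sub_two_pi,
    Real.cos_pi_div_two]

lemma hasDerivAt_two_pi_mul (t : ℝ) :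
    HasDerivAt (fun t : ℝ => 2 * Real.pi * t) (2 * Real.pi) t := by
  simpa using (hasDerivAt_id t).const_mul (2 * Real.pi)

lemma hasDerivAt_sin_step (t : ℝ) :
    HasDerivAt (fun t : ℝ => (1 + Real.sin (2 * Real.pi * t)) / 2)
      (Real.pi * Real.cos (2 * Real.pi * t)) t :=
  (((hasDerivAt_two_pi_mul t).sin.const_add 1).div_const 2).congr_deriv (by ring)

lemma hasDerivAt_of_glue {f g h : ℝ → ℝ} {d a : ℝ} (hg : HasDerivAt g d a) (hh : HasDerivAt h d a)
    (h1 : f =ᶠ[𝓝[<] a] g) (h2 : f =ᶠ[𝓝[>] a] h) (e1 : f a = g a) (e2 : f a = h a) :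
    HasDerivAt f d a := by
  have A : HasDerivWithinAt f d (Iio a) a := hg.hasDerivWithinAt.congr_of_eventuallyEq h1 e1
  have B : HasDerivWithinAt f d (Ioi a) a := hh.hasDerivWithinAt.congr_of_eventuallyEq h2 e2
  have := (A.Iic_of_Iio).union (B.Ici_of_Ioi)
  rwa [Iic_union_Ici, hasDerivWithinAt_univ] at this

/-- At the gluing points `-5/4` and `-3/4` the sine equals `-1` and `1` while the cosine vanishes,
so values and one-sided derivatives agree. The second derivative does jump there. -/
lemma stepProfile_hasDerivAt (t : ℝ) : HasDerivAt stepProfile (stepProfileDeriv t) t := by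
  rcases lt_trichotomy t (-5 / 4) with h | h | h
  · rw [stepProfileDeriv, if_pos h]
    refine (hasDerivAt_const t (0 : ℝ)).congr_of_eventuallyEq ?_
    filter_upwards [eventually_lt_nhds h] with y hy
    simp [stepProfile, hy]
  · subst h
    rw [stepProfileDeriv, if_neg (by norm_num), if_pos (by norm_num), cos_two_pi_gluing_left,
      mul_zero]
    refine hasDerivAt_of_glue (hasDerivAt_const _ (0 : ℝ))
      ((hasDerivAt_sin_step (-5 / 4)).congr_deriv (by rw [cos_two_pi_gluing_left, mul_zero]))
      ?_ ?_ ?_ ?_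
    · filter_upwards [self_mem_nhdsWithin] with y hy
      rw [stepProfile, if_pos (mem_Iio.1 hy)]
    · filter_upwards [Ioo_mem_nhdsGT (show (-5 / 4 : ℝ) < -3 / 4 by norm_num)] with y hy
      rw [stepProfile, if_neg hy.1.le.not_gt, if_pos hy.2]
    · rw [stepProfile, if_neg (by norm_num), if_pos (by norm_num), sin_two_pi_gluing_left]
      norm_num
    · rw [stepProfile, if_neg (by norm_num), if_pos (by norm_num)]
  · rcases lt_trichotomy t (-3 / 4) with h' | h' | h'
    · rw [stepProfileDeriv, if_neg h.le.not_gt, if_pos h']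
      refine (hasDerivAt_sin_step t).congr_of_eventuallyEq ?_
      filter_upwards [eventually_gt_nhds h, eventually_lt_nhds h'] with y hy hy'
      rw [stepProfile, if_neg hy.le.not_gt, if_pos hy']
    · subst h'
      rw [stepProfileDeriv, if_neg (by norm_num), if_neg (by norm_num)]
      refine hasDerivAt_of_glue
        ((hasDerivAt_sin_step (-3 / 4)).congr_deriv (by rw [cos_two_pi_gluing_right, mul_zero]))
        (hasDerivAt_const _ (1 : ℝ)) ?_ ?_ ?_ ?_
      · filter_upwards [Ioo_mem_nhdsLT (show (-5 / 4 : ℝ) < -3 / 4 by norm_num)] with y hy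
        rw [stepProfile, if_neg hy.1.le.not_gt, if_pos hy.2]
      · filter_upwards [self_mem_nhdsWithin] with y hy
        have hy : -3 / 4 < y := hy
        rw [stepProfile, if_neg (by linarith), if_neg (by linarith)]
      · rw [stepProfile, if_neg (by norm_num), if_neg (by norm_num), sin_two_pi_gluing_right]
        norm_num
      · rw [stepProfile, if_neg (by norm_num), if_neg (by norm_num)]
    · rw [stepProfileDeriv, if_neg (by linarith), if_neg (by linarith)]
      refine (hasDerivAt_const t (1 : ℝ)).congr_of_eventuallyEq ?_
      filter_upwards [eventually_gt_nhds h'] with y hy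
      rw [stepProfile, if_neg (by linarith), if_neg (by linarith)]

lemma stepProfileDeriv_hasDerivAt {t : ℝ} (h1 : t ≠ -5 / 4) (h2 : t ≠ -3 / 4) :
    HasDerivAt stepProfileDeriv (stepProfileDeriv2 t) t := by
  rcases lt_or_gt_of_ne h1 with h | h
  · rw [stepProfileDeriv2, if_pos h]
    refine (hasDerivAt_const t (0 : ℝ)).congr_of_eventuallyEq ?_
    filter_upwards [eventually_lt_nhds h] with y hy
    simp [stepProfileDeriv, hy]
  · rcases lt_or_gt_of_ne h2 with h' | h'
    · rw [stepProfileDeriv2, if_neg h.le.not_gt, if_pos h']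
      refine HasDerivAt.congr_of_eventuallyEq
        (((hasDerivAt_two_pi_mul t).cos.const_mul Real.pi).congr_deriv (by ring)) ?_
      filter_upwards [eventually_gt_nhds h, eventually_lt_nhds h'] with y hy hy'
      rw [stepProfileDeriv, if_neg hy.le.not_gt, if_pos hy']
    · rw [stepProfileDeriv2, if_neg (by linarith), if_neg (by linarith)]
      refine (hasDerivAt_const t (0 : ℝ)).congr_of_eventuallyEq ?_
      filter_upwards [eventually_gt_nhds h'] with y hy
      rw [stepProfileDeriv, if_neg (by linarith), if_neg (by linarith)]

lemma abs_stepProfile_le (t : ℝ) : |stepProfile t| ≤ 1 := by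
  unfold stepProfile
  split_ifs
  · simp
  · rw [abs_le]
    constructor <;> linarith [Real.neg_one_le_sin (2 * Real.pi * t), Real.sin_le_one (2 * Real.pi * t)]
  · simp

lemma abs_stepProfileDeriv_le (t : ℝ) : |stepProfileDeriv t| ≤ 4 := by
  unfold stepProfileDeriv
  split_ifs
  · simp
  · rw [abs_mul, abs_of_pos Real.pi_pos]
    have h1 := Real.pi_le_four
    have h2 := Real.abs_cos_le_one (2 * Real.pi * t)
    calc Real.pi * |Real.cos (2 * Real.pi * t)| ≤ 4 * 1 := by gcongr
      _ = 4 := by norm_num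
  · simp

lemma abs_stepProfileDeriv2_le (t : ℝ) : |stepProfileDeriv2 t| ≤ 32 := by
  unfold stepProfileDeriv2
  split_ifs
  · simp
  · rw [abs_mul, abs_neg, abs_of_pos (by positivity)]
    have h1 := Real.pi_le_four
    have h2 := Real.abs_sin_le_one (2 * Real.pi * t)
    calc 2 * Real.pi ^ 2 * |Real.sin (2 * Real.pi * t)| ≤ 2 * 4 ^ 2 * 1 := by gcongr
      _ = 32 := by norm_num
  · simp

lemma measurable_stepProfileDeriv2 : Measurable stepProfileDeriv2 := by
  unfold stepProfileDeriv2
  refine Measurable.ite measurableSet_Iio measurable_const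
    (Measurable.ite measurableSet_Iio ?_ measurable_const)
  fun_prop

/-- The derivative of the partition of unity profile. -/
def pouDeriv (t : ℝ) : ℝ := stepProfileDeriv t - stepProfileDeriv (t - 2)

/-- The second derivative of the partition of unity profile, away from the gluing points. -/
def pouDeriv2 (t : ℝ) : ℝ := stepProfileDeriv2 t - stepProfileDeriv2 (t - 2)

/-- The points at which the profile is not twice differentiable. -/
def pouKinks : Set ℝ := {-5 / 4, -3 / 4, 3 / 4, 5 / 4}

/-- Neighbouring patches differ by `2` in the local coordinate. Writing the profile as a step minus
its translate by `2` makes the sum over all patches telescope. -/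
lemma pouProfile_eq (t : ℝ) : pouProfile t = stepProfile t - stepProfile (t - 2) := by
  have hs : Real.sin (2 * Real.pi * (t - 2)) = Real.sin (2 * Real.pi * t) := by
    rw [show 2 * Real.pi * (t - 2) = 2 * Real.pi * t - 2 * Real.pi - 2 * Real.pi by ring,
      Real.sin_sub_two_pi, Real.sin_sub_two_pi]
  unfold pouProfile stepProfile
  simp only [indicator_apply, mem_Ico, hs]
  split_ifs <;> first | (exfalso; grind) | ring

lemma pouProfile_hasDerivAt (t : ℝ) : HasDerivAt pouProfile (pouDeriv t) t := by
  rw [show pouProfile = fun t => stepProfile t - stepProfile (t - 2) from funext pouProfile_eq]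
  exact (stepProfile_hasDerivAt t).sub
    (HasDerivAt.comp_sub_const t 2 (stepProfile_hasDerivAt (t - 2)))

lemma pouDeriv_hasDerivAt {t : ℝ} (h : t ∉ pouKinks) : HasDerivAt pouDeriv (pouDeriv2 t) t := by
  simp only [pouKinks, mem_insert_iff, mem_singleton_iff, not_or] at h
  refine (stepProfileDeriv_hasDerivAt h.1 h.2.1).sub
    (HasDerivAt.comp_sub_const t 2 (stepProfileDeriv_hasDerivAt ?_ ?_))
  · intro h'; exact h.2.2.1 (by linarith)
  · intro h'; exact h.2.2.2 (by linarith)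

lemma abs_pouProfile_le (t : ℝ) : |pouProfile t| ≤ 2 := by
  rw [pouProfile_eq]
  linarith [abs_sub (stepProfile t) (stepProfile (t - 2)), abs_stepProfile_le t,
    abs_stepProfile_le (t - 2)]

lemma abs_pouDeriv_le (t : ℝ) : |pouDeriv t| ≤ 8 := by
  unfold pouDeriv
  linarith [abs_sub (stepProfileDeriv t) (stepProfileDeriv (t - 2)), abs_stepProfileDeriv_le t,
    abs_stepProfileDeriv_le (t - 2)]

lemma abs_pouDeriv2_le (t : ℝ) : |pouDeriv2 t| ≤ 64 := by
  unfold pouDeriv2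
  linarith [abs_sub (stepProfileDeriv2 t) (stepProfileDeriv2 (t - 2)), abs_stepProfileDeriv2_le t,
    abs_stepProfileDeriv2_le (t - 2)]

lemma pou_eq_zero {t : ℝ} (h : 5 / 4 < |t|) :
    pouProfile t = 0 ∧ pouDeriv t = 0 ∧ pouDeriv2 t = 0 := by
  rw [pouProfile_eq]
  rcases lt_abs.1 h with h | h
  · simp only [pouDeriv, pouDeriv2, stepProfile, stepProfileDeriv, stepProfileDeriv2,
      if_neg (show ¬ t < -5 / 4 by linarith), if_neg (show ¬ t < -3 / 4 by linarith),
      if_neg (show ¬ t - 2 < -5 / 4 by linarith), if_neg (show ¬ t - 2 < -3 / 4 by linarith)]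
    simp
  · simp only [pouDeriv, pouDeriv2, stepProfile, stepProfileDeriv, stepProfileDeriv2,
      if_pos (show t < -5 / 4 by linarith), if_pos (show t - 2 < -5 / 4 by linarith)]
    simp

lemma continuous_pouProfile : Continuous pouProfile :=
  continuous_iff_continuousAt.2 fun t => (pouProfile_hasDerivAt t).continuousAt

lemma measurable_pouDeriv : Measurable pouDeriv := by
  have : pouDeriv = deriv pouProfile := funext fun t => (pouProfile_hasDerivAt t).deriv.symm
  rw [this]
  exact measurable_deriv _

lemma measurable_pouDeriv2 : Measurable pouDeriv2 :=
  measurable_stepProfileDeriv2.sub (measurable_stepProfileDeriv2.comp (measurable_id.sub_const 2))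

/-! ### Sums over overlapping patches -/

section Patches

variable {R : ℝ} {P : ℕ}

lemma patchSize_pos (hR : 0 < R) (hP : 1 ≤ P) : 0 < patchSize R P := by
  unfold patchSize
  have : (0 : ℝ) < P := by exact_mod_cast hP
  positivity

lemma patchSize_le (hR : 0 < R) (hP : 1 ≤ P) : patchSize R P ≤ R := by
  unfold patchSize
  have : (1 : ℝ) ≤ P := by exact_mod_cast hP
  exact div_le_self hR.le this

lemma localCoord_hasDerivAt (p : Fin (P + 1)) (x : ℝ) :
    HasDerivAt (localCoord R P p) (1 / patchSize R P) x := by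
  unfold localCoord
  exact ((hasDerivAt_id x).sub_const _).div_const _

/-- The function `∑ₚ φ(lₚ) eₚ(lₚ)` assembled from local functions. -/
def patchSum (R : ℝ) (P : ℕ) (e : Fin (P + 1) → ℝ → ℝ) (x : ℝ) : ℝ :=
  ∑ p, pouProfile (localCoord R P p x) * e p (localCoord R P p x)

/-- The derivative of `patchSum`. -/
def patchSumDeriv (R : ℝ) (P : ℕ) (e e' : Fin (P + 1) → ℝ → ℝ) (x : ℝ) : ℝ :=
  ∑ p, (pouDeriv (localCoord R P p x) * e p (localCoord R P p x) +
    pouProfile (localCoord R P p x) * e' p (localCoord R P p x)) / patchSize R P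

/-- The second derivative of `patchSum` away from finitely many points. -/
def patchSumDeriv2 (R : ℝ) (P : ℕ) (e e' e'' : Fin (P + 1) → ℝ → ℝ) (x : ℝ) : ℝ :=
  ∑ p, (pouDeriv2 (localCoord R P p x) * e p (localCoord R P p x) +
    2 * (pouDeriv (localCoord R P p x) * e' p (localCoord R P p x)) +
    pouProfile (localCoord R P p x) * e'' p (localCoord R P p x)) / patchSize R P ^ 2

/-- The points at which some local profile is not twice differentiable. -/
def kinks (R : ℝ) (P : ℕ) : Set ℝ := ⋃ p : Fin (P + 1), localCoord R P p ⁻¹' pouKinks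

lemma finite_kinks (hR : 0 < R) (hP : 1 ≤ P) : (kinks R P).Finite := by
  refine finite_iUnion fun p => ?_
  refine Finite.preimage (fun x _ y _ hxy => ?_) ?_
  · have := (patchSize_pos hR hP).ne'
    unfold localCoord at hxy
    field_simp at hxy
    linarith
  · simp [pouKinks]

lemma hasDerivAt_comp_localCoord {p : Fin (P + 1)} {f : ℝ → ℝ} {f' x : ℝ}
    (h : HasDerivAt f f' (localCoord R P p x)) :
    HasDerivAt (fun x => f (localCoord R P p x)) (f' / patchSize R P) x :=
  (h.comp x (localCoord_hasDerivAt p x)).congr_deriv (by ring)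

lemma patchSum_hasDerivAt {e e' : Fin (P + 1) → ℝ → ℝ}
    (h : ∀ p x, HasDerivAt (e p) (e' p x) x) (x : ℝ) :
    HasDerivAt (patchSum R P e) (patchSumDeriv R P e e' x) x := by
  unfold patchSum patchSumDeriv
  refine HasDerivAt.fun_sum fun p _ => ?_
  exact ((hasDerivAt_comp_localCoord (pouProfile_hasDerivAt _)).mul
    (hasDerivAt_comp_localCoord (h p _))).congr_deriv (by ring)

lemma patchSumDeriv_hasDerivAt {e e' e'' : Fin (P + 1) → ℝ → ℝ}
    (h : ∀ p x, HasDerivAt (e p) (e' p x) x) (h' : ∀ p x, HasDerivAt (e' p) (e'' p x) x)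
    {x : ℝ} (hx : x ∉ kinks R P) :
    HasDerivAt (patchSumDeriv R P e e') (patchSumDeriv2 R P e e' e'' x) x := by
  unfold patchSumDeriv patchSumDeriv2
  refine HasDerivAt.fun_sum fun p _ => ?_
  have hxp : localCoord R P p x ∉ pouKinks := fun hmem => hx (mem_iUnion.2 ⟨p, hmem⟩)
  exact ((((hasDerivAt_comp_localCoord (pouDeriv_hasDerivAt hxp)).mul
    (hasDerivAt_comp_localCoord (h p _))).add
    ((hasDerivAt_comp_localCoord (pouProfile_hasDerivAt _)).mul
    (hasDerivAt_comp_localCoord (h' p _)))).div_const (patchSize R P)).congr_deriv (by ring)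

lemma localCoord_sub (hR : 0 < R) (hP : 1 ≤ P) (p q : Fin (P + 1)) (x : ℝ) :
    localCoord R P p x - localCoord R P q x = 2 * ((q : ℕ) - (p : ℕ) : ℝ) := by
  have := (patchSize_pos hR hP).ne'
  unfold localCoord
  field_simp
  ring

/-- At most two patches overlap at any point. -/
lemma card_active_le (hR : 0 < R) (hP : 1 ≤ P) (x : ℝ) :
    (Finset.univ.filter fun p : Fin (P + 1) => |localCoord R P p x| ≤ 5 / 4).card ≤ 2 := by
  classical
  set s := Finset.univ.filter fun p : Fin (P + 1) => |localCoord R P p x| ≤ 5 / 4 with hs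
  rcases s.eq_empty_or_nonempty with h | h
  · simp [h]
  set m := s.min' h
  have hm : m ∈ s := s.min'_mem h
  have hsub : s.image (fun p : Fin (P + 1) => (p : ℕ)) ⊆ Finset.Icc (m : ℕ) (m + 1) := by
    intro n hn
    obtain ⟨p, hp, rfl⟩ := Finset.mem_image.1 hn
    have hle : m ≤ p := s.min'_le p hp
    have h1 := localCoord_sub hR hP m p x
    simp only [hs, Finset.mem_filter, Finset.mem_univ, true_and, abs_le] at hp hm
    rw [Finset.mem_Icc]
    refine ⟨hle, ?_⟩
    have : ((p : ℕ) : ℝ) < ((m : ℕ) : ℝ) + 2 := by linarith [hp.1, hp.2, hm.1, hm.2]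
    have : (p : ℕ) < (m : ℕ) + 2 := by exact_mod_cast this
    omega
  have := Finset.card_le_card hsub
  rw [Finset.card_image_of_injective _ Fin.val_injective] at this
  rw [Nat.card_Icc] at this
  omega

/-- The factor `2` is the overlap number; it keeps all patch estimates independent of `P`. -/
lemma abs_sum_le_of_active (hR : 0 < R) (hP : 1 ≤ P) (x : ℝ) (F : Fin (P + 1) → ℝ) {B : ℝ}
    (hB : 0 ≤ B) (h0 : ∀ p, 5 / 4 < |localCoord R P p x| → F p = 0)
    (h1 : ∀ p, |localCoord R P p x| ≤ 5 / 4 → |F p| ≤ B) : |∑ p, F p| ≤ 2 * B := by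
  have : ∑ p, F p =
      ∑ p ∈ Finset.univ.filter fun p : Fin (P + 1) => |localCoord R P p x| ≤ 5 / 4, F p := by
    rw [Finset.sum_filter]
    refine Finset.sum_congr rfl fun p _ => ?_
    split_ifs with h
    · rfl
    · exact h0 p (not_le.1 h)
  rw [this]
  calc _ ≤ ∑ p ∈ Finset.univ.filter fun p : Fin (P + 1) => |localCoord R P p x| ≤ 5 / 4, |F p| :=
        Finset.abs_sum_le_sum_abs _ _
    _ ≤ ∑ p ∈ Finset.univ.filter fun p : Fin (P + 1) => |localCoord R P p x| ≤ 5 / 4, B :=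
        Finset.sum_le_sum fun p hp => h1 p (Finset.mem_filter.1 hp).2
    _ = _ * B := by rw [Finset.sum_const, nsmul_eq_mul]
    _ ≤ 2 * B := by
        gcongr
        exact_mod_cast card_active_le hR hP x

/-- The constants combine the overlap factor `2` with the bounds `2`, `8`, `64` on the profile and
its derivatives through the product rule: `4 = 2·2`, `20 = 2·(8 + 2)`, `164 = 2·(64 + 2·8 + 2)`. -/
lemma patchSum_bounds (hR : 0 < R) (hP : 1 ≤ P) {e e' e'' : Fin (P + 1) → ℝ → ℝ} {B : ℝ}
    (hB : 0 ≤ B) (h : ∀ p l, |l| ≤ 5 / 4 → |e p l| ≤ B ∧ |e' p l| ≤ B ∧ |e'' p l| ≤ B) (x : ℝ) :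
    |patchSum R P e x| ≤ 4 * B ∧ |patchSumDeriv R P e e' x| ≤ 20 * B / patchSize R P ∧
      |patchSumDeriv2 R P e e' e'' x| ≤ 164 * B / patchSize R P ^ 2 := by
  have hr := patchSize_pos hR hP
  refine ⟨?_, ?_, ?_⟩
  · have := abs_sum_le_of_active hR hP x
      (fun p => pouProfile (localCoord R P p x) * e p (localCoord R P p x)) (B := 2 * B)
      (by positivity) (fun p hp => by simp [(pou_eq_zero hp).1]) (fun p hp => by
        rw [abs_mul]
        have := abs_pouProfile_le (localCoord R P p x)
        have := (h p _ hp).1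
        gcongr)
    unfold patchSum
    linarith
  · have := abs_sum_le_of_active hR hP x
      (fun p => (pouDeriv (localCoord R P p x) * e p (localCoord R P p x) +
        pouProfile (localCoord R P p x) * e' p (localCoord R P p x)) / patchSize R P)
      (B := (8 * B + 2 * B) / patchSize R P)
      (by positivity) (fun p hp => by simp [(pou_eq_zero hp).1, (pou_eq_zero hp).2.1])
      (fun p hp => by
        rw [abs_div, abs_of_pos hr]
        have := abs_pouProfile_le (localCoord R P p x)
        have := abs_pouDeriv_le (localCoord R P p x)
        have h1 := (h p _ hp).1
        have h2 := (h p _ hp).2.1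
        gcongr
        refine (abs_add_le _ _).trans ?_
        rw [abs_mul, abs_mul]
        gcongr)
    unfold patchSumDeriv
    refine this.trans (le_of_eq ?_)
    ring
  · have := abs_sum_le_of_active hR hP x
      (fun p => (pouDeriv2 (localCoord R P p x) * e p (localCoord R P p x) +
        2 * (pouDeriv (localCoord R P p x) * e' p (localCoord R P p x)) +
        pouProfile (localCoord R P p x) * e'' p (localCoord R P p x)) / patchSize R P ^ 2)
      (B := (64 * B + 2 * (8 * B) + 2 * B) / patchSize R P ^ 2)
      (by positivity)
      (fun p hp => by simp [(pou_eq_zero hp).1, (pou_eq_zero hp).2.1, (pou_eq_zero hp).2.2])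
      (fun p hp => by
        rw [abs_div, abs_of_pos (pow_pos hr 2)]
        have := abs_pouProfile_le (localCoord R P p x)
        have := abs_pouDeriv_le (localCoord R P p x)
        have := abs_pouDeriv2_le (localCoord R P p x)
        have h1 := (h p _ hp).1
        have h2 := (h p _ hp).2.1
        have h3 := (h p _ hp).2.2
        gcongr
        refine (abs_add_le _ _).trans (add_le_add ((abs_add_le _ _).trans (add_le_add ?_ ?_)) ?_)
        · rw [abs_mul]; gcongr
        · rw [abs_mul, abs_mul, abs_two]; gcongr
        · rw [abs_mul]; gcongr)
    unfold patchSumDeriv2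
    refine this.trans (le_of_eq ?_)
    ring

/-- The profiles form a partition of unity in a neighbourhood of `[-R, R]`. -/
lemma sum_pouProfile (hR : 0 < R) (hP : 1 ≤ P) {x : ℝ}
    (hx : x ∈ Ioo (-R - 3 / 4 * patchSize R P) (R + 3 / 4 * patchSize R P)) :
    ∑ p : Fin (P + 1), pouProfile (localCoord R P p x) = 1 := by
  have hr := patchSize_pos hR hP
  have hPR : patchSize R P * P = R := by
    unfold patchSize
    have : (P : ℝ) ≠ 0 := by positivity
    field_simp
  set L : ℕ → ℝ := fun n => (x - (-R + 2 * patchSize R P * n)) / patchSize R P with hL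
  have h1 : ∀ n, L n - 2 = L (n + 1) := by
    intro n
    simp only [hL]
    field_simp
    push_cast
    ring
  have h2 : ∑ p : Fin (P + 1), pouProfile (localCoord R P p x) =
      ∑ n ∈ Finset.range (P + 1), (stepProfile (L n) - stepProfile (L (n + 1))) := by
    rw [Finset.sum_range]
    refine Finset.sum_congr rfl fun p _ => ?_
    rw [pouProfile_eq, ← h1]
    rfl
  rw [h2, Finset.sum_range_sub']
  -- Only the two ends of the telescoping sum remain: the step is already `1` at `L 0` and still `0`
  -- at `L (P + 1)`.
  have h3 : -3 / 4 < L 0 := by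
    simp only [hL]
    rw [lt_div_iff₀ hr]
    push_cast
    linarith [hx.1]
  have h4 : L (P + 1) < -5 / 4 := by
    simp only [hL]
    rw [div_lt_iff₀ hr]
    push_cast
    linarith [hx.2]
  rw [stepProfile, if_neg (by linarith), if_neg (by linarith), stepProfile, if_pos h4, sub_zero]

end Patches

end RFM

/-! ### Least squares: attainment and integrability of the minimal loss -/

namespace RFM

section LeastSquares

variable {V H : Type*} [NormedAddCommGroup V] [NormedSpace ℝ V] [FiniteDimensional ℝ V]
  [NormedAddCommGroup H] [InnerProductSpace ℝ H]

/-- Linear least squares problems with finitely many unknowns have a solution. -/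
lemma exists_isMinOn_norm_sub_sq (T : V →ₗ[ℝ] H) (y : H) :
    ∃ α₀, ∀ α, ‖T α₀ - y‖ ^ 2 ≤ ‖T α - y‖ ^ 2 := by
  obtain ⟨v, ⟨α₀, rfl⟩, hv⟩ := Submodule.exists_norm_eq_iInf_of_complete_subspace (LinearMap.range T)
    (Submodule.complete_of_finiteDimensional _) y
  refine ⟨α₀, fun α => ?_⟩
  have : ‖y - T α₀‖ ≤ ‖y - T α‖ := by
    rw [hv]
    exact ciInf_le (f := fun w : LinearMap.range T => ‖y - w‖)
      ⟨0, by rintro _ ⟨w, rfl⟩; exact norm_nonneg _⟩ ⟨T α, α, rfl⟩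
  rw [norm_sub_rev (T α₀), norm_sub_rev (T α)]
  gcongr

lemma continuous_norm_sub_sq (T : V →ₗ[ℝ] H) (y : H) : Continuous fun α => ‖T α - y‖ ^ 2 := by
  have := T.continuous_of_finiteDimensional
  fun_prop

end LeastSquares

variable {R : ℝ} {P Np : ℕ}

/-- The local trial function `v_p` as a function of the normalized coordinate. -/
def localTrial (k : Fin (P + 1) × Fin Np → ℝ) (α : Fin (P + 1) × (Fin Np ⊕ Fin Np) → ℝ)
    (p : Fin (P + 1)) (l : ℝ) : ℝ :=
  ∑ i : Fin Np, (α (p, Sum.inl i) * Real.cos (k (p, i) * l)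
      + α (p, Sum.inr i) * Real.sin (k (p, i) * l))

/-- The derivative of `localTrial`. -/
def localTrialDeriv (k : Fin (P + 1) × Fin Np → ℝ) (α : Fin (P + 1) × (Fin Np ⊕ Fin Np) → ℝ)
    (p : Fin (P + 1)) (l : ℝ) : ℝ :=
  ∑ i : Fin Np, k (p, i) * (α (p, Sum.inr i) * Real.cos (k (p, i) * l)
      - α (p, Sum.inl i) * Real.sin (k (p, i) * l))

/-- The second derivative of `localTrial`. -/
def localTrialDeriv2 (k : Fin (P + 1) × Fin Np → ℝ) (α : Fin (P + 1) × (Fin Np ⊕ Fin Np) → ℝ)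
    (p : Fin (P + 1)) (l : ℝ) : ℝ :=
  ∑ i : Fin Np, k (p, i) ^ 2 * (-(α (p, Sum.inl i) * Real.cos (k (p, i) * l))
      - α (p, Sum.inr i) * Real.sin (k (p, i) * l))

lemma localTrial_hasDerivAt (k : Fin (P + 1) × Fin Np → ℝ)
    (α : Fin (P + 1) × (Fin Np ⊕ Fin Np) → ℝ) (p : Fin (P + 1)) (l : ℝ) :
    HasDerivAt (localTrial k α p) (localTrialDeriv k α p l) l := by
  unfold localTrial localTrialDeriv
  refine HasDerivAt.fun_sum fun i _ => ?_
  have h0 : HasDerivAt (fun x : ℝ => k (p, i) * x) (k (p, i)) l := by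
    simpa using (hasDerivAt_id l).const_mul (k (p, i))
  exact ((h0.cos.const_mul _).add (h0.sin.const_mul _)).congr_deriv (by ring)

lemma localTrialDeriv_hasDerivAt (k : Fin (P + 1) × Fin Np → ℝ)
    (α : Fin (P + 1) × (Fin Np ⊕ Fin Np) → ℝ) (p : Fin (P + 1)) (l : ℝ) :
    HasDerivAt (localTrialDeriv k α p) (localTrialDeriv2 k α p l) l := by
  unfold localTrialDeriv localTrialDeriv2
  refine HasDerivAt.fun_sum fun i _ => ?_
  have h0 : HasDerivAt (fun x : ℝ => k (p, i) * x) (k (p, i)) l := by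
    simpa using (hasDerivAt_id l).const_mul (k (p, i))
  exact (((h0.cos.const_mul _).sub (h0.sin.const_mul _)).const_mul (k (p, i))).congr_deriv (by ring)

lemma pumTrial_eq (R : ℝ) (k : Fin (P + 1) × Fin Np → ℝ)
    (α : Fin (P + 1) × (Fin Np ⊕ Fin Np) → ℝ) :
    pumTrial R P Np k α = patchSum R P (localTrial k α) := rfl

lemma deriv_pumTrial (R : ℝ) (k : Fin (P + 1) × Fin Np → ℝ)
    (α : Fin (P + 1) × (Fin Np ⊕ Fin Np) → ℝ) :
    deriv (pumTrial R P Np k α) = patchSumDeriv R P (localTrial k α) (localTrialDeriv k α) :=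
  funext fun x => (patchSum_hasDerivAt (localTrial_hasDerivAt k α) x).deriv

lemma deriv_deriv_pumTrial (k : Fin (P + 1) × Fin Np → ℝ)
    (α : Fin (P + 1) × (Fin Np ⊕ Fin Np) → ℝ) {x : ℝ} (hx : x ∉ kinks R P) :
    deriv (deriv (pumTrial R P Np k α)) x =
      patchSumDeriv2 R P (localTrial k α) (localTrialDeriv k α) (localTrialDeriv2 k α) x := by
  rw [deriv_pumTrial]
  exact (patchSumDeriv_hasDerivAt (localTrial_hasDerivAt k α) (localTrialDeriv_hasDerivAt k α)
    hx).deriv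

/-- An everywhere explicit version of `L u_N`. -/
def trialL (D : EllipticBVP) (P Np : ℕ) (k : Fin (P + 1) × Fin Np → ℝ)
    (α : Fin (P + 1) × (Fin Np ⊕ Fin Np) → ℝ) (x : ℝ) : ℝ :=
  D.a x * patchSumDeriv2 D.R P (localTrial k α) (localTrialDeriv k α) (localTrialDeriv2 k α) x +
    D.b x * patchSumDeriv D.R P (localTrial k α) (localTrialDeriv k α) x +
    D.c x * patchSum D.R P (localTrial k α) x

lemma ae_notMem_kinks (hR : 0 < R) (hP : 1 ≤ P) (s : Set ℝ) :
    ∀ᵐ x ∂(volume.restrict s), x ∉ kinks R P :=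
  ae_restrict_of_ae (measure_eq_zero_iff_ae_notMem.1 ((finite_kinks hR hP).measure_zero _))

/-- A trial function may fail to be twice differentiable at finitely many kinks, which the integral
ignores. The explicit expression on the right is linear in the coefficients everywhere. -/
lemma opL_pumTrial_ae (D : EllipticBVP) (hP : 1 ≤ P) (k : Fin (P + 1) × Fin Np → ℝ)
    (α : Fin (P + 1) × (Fin Np ⊕ Fin Np) → ℝ) :
    ∀ᵐ x ∂(volume.restrict (Ioo (-D.R) D.R)),
      D.opL (pumTrial D.R P Np k α) x = trialL D P Np k α x := by
  filter_upwards [ae_notMem_kinks D.R_pos hP _] with x hx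
  rw [EllipticBVP.opL, deriv_deriv_pumTrial k α hx, deriv_pumTrial, pumTrial_eq, trialL]

lemma opB_pumTrial (D : EllipticBVP) (k : Fin (P + 1) × Fin Np → ℝ)
    (α : Fin (P + 1) × (Fin Np ⊕ Fin Np) → ℝ) (x : ℝ) :
    D.opB (pumTrial D.R P Np k α) x =
      D.g₁ x * patchSumDeriv D.R P (localTrial k α) (localTrialDeriv k α) x +
        D.g₂ x * patchSum D.R P (localTrial k α) x := by
  rw [EllipticBVP.opB, deriv_pumTrial, pumTrial_eq]

section Linearity

variable (k : Fin (P + 1) × Fin Np → ℝ) (α β : Fin (P + 1) × (Fin Np ⊕ Fin Np) → ℝ) (c : ℝ)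

lemma localTrial_add (p : Fin (P + 1)) (l : ℝ) :
    localTrial k (α + β) p l = localTrial k α p l + localTrial k β p l := by
  simp only [localTrial, Pi.add_apply, ← Finset.sum_add_distrib]
  exact Finset.sum_congr rfl fun i _ => by ring

lemma localTrialDeriv_add (p : Fin (P + 1)) (l : ℝ) :
    localTrialDeriv k (α + β) p l = localTrialDeriv k α p l + localTrialDeriv k β p l := by
  simp only [localTrialDeriv, Pi.add_apply, ← Finset.sum_add_distrib]
  exact Finset.sum_congr rfl fun i _ => by ring

lemma localTrialDeriv2_add (p : Fin (P + 1)) (l : ℝ) :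
    localTrialDeriv2 k (α + β) p l = localTrialDeriv2 k α p l + localTrialDeriv2 k β p l := by
  simp only [localTrialDeriv2, Pi.add_apply, ← Finset.sum_add_distrib]
  exact Finset.sum_congr rfl fun i _ => by ring

lemma localTrial_smul (p : Fin (P + 1)) (l : ℝ) :
    localTrial k (c • α) p l = c * localTrial k α p l := by
  simp only [localTrial, Pi.smul_apply, smul_eq_mul, Finset.mul_sum]
  exact Finset.sum_congr rfl fun i _ => by ring

lemma localTrialDeriv_smul (p : Fin (P + 1)) (l : ℝ) :
    localTrialDeriv k (c • α) p l = c * localTrialDeriv k α p l := by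
  simp only [localTrialDeriv, Pi.smul_apply, smul_eq_mul, Finset.mul_sum]
  exact Finset.sum_congr rfl fun i _ => by ring

lemma localTrialDeriv2_smul (p : Fin (P + 1)) (l : ℝ) :
    localTrialDeriv2 k (c • α) p l = c * localTrialDeriv2 k α p l := by
  simp only [localTrialDeriv2, Pi.smul_apply, smul_eq_mul, Finset.mul_sum]
  exact Finset.sum_congr rfl fun i _ => by ring

lemma trialL_add (D : EllipticBVP) (x : ℝ) :
    trialL D P Np k (α + β) x = trialL D P Np k α x + trialL D P Np k β x := by
  simp only [trialL, patchSum, patchSumDeriv, patchSumDeriv2, localTrial_add, localTrialDeriv_add,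
    localTrialDeriv2_add, Finset.mul_sum, ← Finset.sum_add_distrib]
  exact Finset.sum_congr rfl fun i _ => by ring

lemma trialL_smul (D : EllipticBVP) (x : ℝ) :
    trialL D P Np k (c • α) x = c * trialL D P Np k α x := by
  simp only [trialL, patchSum, patchSumDeriv, patchSumDeriv2, localTrial_smul, localTrialDeriv_smul,
    localTrialDeriv2_smul, Finset.mul_sum, ← Finset.sum_add_distrib]
  exact Finset.sum_congr rfl fun i _ => by ring

lemma opB_pumTrial_add (D : EllipticBVP) (x : ℝ) :
    D.opB (pumTrial D.R P Np k (α + β)) x =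
      D.opB (pumTrial D.R P Np k α) x + D.opB (pumTrial D.R P Np k β) x := by
  simp only [opB_pumTrial, patchSum, patchSumDeriv, localTrial_add, localTrialDeriv_add,
    Finset.mul_sum, ← Finset.sum_add_distrib]
  exact Finset.sum_congr rfl fun i _ => by ring

lemma opB_pumTrial_smul (D : EllipticBVP) (x : ℝ) :
    D.opB (pumTrial D.R P Np k (c • α)) x = c * D.opB (pumTrial D.R P Np k α) x := by
  simp only [opB_pumTrial, patchSum, patchSumDeriv, localTrial_smul, localTrialDeriv_smul,
    Finset.mul_sum, ← Finset.sum_add_distrib]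
  exact Finset.sum_congr rfl fun i _ => by ring

end Linearity

section Measurability

variable (R) (α : Fin (P + 1) × (Fin Np ⊕ Fin Np) → ℝ)

/-- Measurability is joint in the weights and the point, so that integrating over the point leaves a
measurable function of the weights. -/
lemma measurable_patchSum :
    Measurable fun z : (Fin (P + 1) × Fin Np → ℝ) × ℝ => patchSum R P (localTrial z.1 α) z.2 := by
  refine Continuous.measurable ?_
  unfold patchSum localTrial localCoord
  have := continuous_pouProfile
  fun_prop

lemma measurable_patchSumDeriv :
    Measurable fun z : (Fin (P + 1) × Fin Np → ℝ) × ℝ =>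
      patchSumDeriv R P (localTrial z.1 α) (localTrialDeriv z.1 α) z.2 := by
  unfold patchSumDeriv localTrial localTrialDeriv localCoord
  have := continuous_pouProfile.measurable
  have := measurable_pouDeriv
  fun_prop

lemma measurable_patchSumDeriv2 :
    Measurable fun z : (Fin (P + 1) × Fin Np → ℝ) × ℝ =>
      patchSumDeriv2 R P (localTrial z.1 α) (localTrialDeriv z.1 α) (localTrialDeriv2 z.1 α) z.2 := by
  unfold patchSumDeriv2 localTrial localTrialDeriv localTrialDeriv2 localCoord
  have := continuous_pouProfile.measurable
  have := measurable_pouDeriv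
  have := measurable_pouDeriv2
  fun_prop

end Measurability

lemma exists_localTrial_bound (k : Fin (P + 1) × Fin Np → ℝ)
    (α : Fin (P + 1) × (Fin Np ⊕ Fin Np) → ℝ) :
    ∃ B, 0 ≤ B ∧ ∀ p l, |l| ≤ 5 / 4 → |localTrial k α p l| ≤ B ∧ |localTrialDeriv k α p l| ≤ B ∧
      |localTrialDeriv2 k α p l| ≤ B := by
  have hc : IsCompact (Icc (-5 / 4 : ℝ) (5 / 4)) := isCompact_Icc
  have key : ∀ f : Fin (P + 1) → ℝ → ℝ, (∀ p, Continuous (f p)) →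
      ∃ B, 0 ≤ B ∧ ∀ p l, |l| ≤ 5 / 4 → |f p l| ≤ B := by
    intro f hf
    choose B hB using fun p => hc.exists_bound_of_continuousOn (hf p).continuousOn
    refine ⟨∑ p, |B p|, Finset.sum_nonneg fun p _ => abs_nonneg _, fun p l hl => ?_⟩
    calc |f p l| ≤ B p := hB p l (by rw [abs_le] at hl; exact ⟨by linarith [hl.1], hl.2⟩)
      _ ≤ |B p| := le_abs_self _
      _ ≤ ∑ p, |B p| := Finset.single_le_sum (f := fun p => |B p|) (fun p _ => abs_nonneg _)
          (Finset.mem_univ p)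
  obtain ⟨B0, h0, hB0⟩ := key (localTrial k α) fun p => by unfold localTrial; fun_prop
  obtain ⟨B1, h1, hB1⟩ := key (localTrialDeriv k α) fun p => by unfold localTrialDeriv; fun_prop
  obtain ⟨B2, h2, hB2⟩ := key (localTrialDeriv2 k α) fun p => by unfold localTrialDeriv2; fun_prop
  refine ⟨B0 + B1 + B2, by positivity, fun p l hl => ⟨?_, ?_, ?_⟩⟩
  · linarith [hB0 p l hl]
  · linarith [hB1 p l hl]
  · linarith [hB2 p l hl]

lemma memLp_mul_of_bounded {μ : Measure ℝ} [IsFiniteMeasure μ] {a g : ℝ → ℝ} (ha : MemLp a ∞ μ)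
    (hg : Measurable g) {B : ℝ} (hB : ∀ x, |g x| ≤ B) : MemLp (fun x => a x * g x) 2 μ := by
  have hg' : MemLp g ∞ μ := memLp_top_of_bound hg.aestronglyMeasurable B (ae_of_all _ hB)
  have : MemLp (fun x => a x * g x) ∞ μ := MemLp.mul' (p := ∞) (q := ∞) hg' ha
  exact this.mono_exponent le_top

lemma memLp_trialL (D : EllipticBVP) (hP : 1 ≤ P) (k : Fin (P + 1) × Fin Np → ℝ)
    (α : Fin (P + 1) × (Fin Np ⊕ Fin Np) → ℝ) :
    MemLp (trialL D P Np k α) 2 (volume.restrict (Ioo (-D.R) D.R)) := by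
  obtain ⟨B, hB, hb⟩ := exists_localTrial_bound k α
  have hm : Measurable fun x : ℝ => (k, x) := by fun_prop
  have hbd := patchSum_bounds D.R_pos hP hB hb
  have h2 := memLp_mul_of_bounded D.a_mem ((measurable_patchSumDeriv2 D.R α).comp hm)
    fun x => (hbd x).2.2
  have h1 := memLp_mul_of_bounded D.b_mem ((measurable_patchSumDeriv D.R α).comp hm)
    fun x => (hbd x).2.1
  have h0 := memLp_mul_of_bounded D.c_mem ((measurable_patchSum D.R α).comp hm)
    fun x => (hbd x).1
  exact (h2.add h1).add h0

/-- The interior and boundary values of a trial function as a linear map into a Hilbert space. -/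
def lossMap (D : EllipticBVP) (γ : ℝ) (hP : 1 ≤ P) (k : Fin (P + 1) × Fin Np → ℝ) :
    (Fin (P + 1) × (Fin Np ⊕ Fin Np) → ℝ) →ₗ[ℝ]
      WithLp 2 (Lp ℝ 2 (volume.restrict (Ioo (-D.R) D.R)) × EuclideanSpace ℝ (Fin 2)) where
  toFun α := WithLp.toLp 2 ((memLp_trialL D hP k α).toLp _,
    !₂[√γ * D.opB (pumTrial D.R P Np k α) (-D.R), √γ * D.opB (pumTrial D.R P Np k α) D.R])
  map_add' α β := by
    rw [← WithLp.toLp_add, Prod.mk_add_mk, ← MemLp.toLp_add]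
    congr 2
    · exact MemLp.toLp_congr _ _ (ae_of_all _ fun x => trialL_add k α β D x)
    · ext i
      fin_cases i <;> simp [opB_pumTrial_add, mul_add]
  map_smul' c α := by
    rw [RingHom.id_apply, ← WithLp.toLp_smul, Prod.smul_mk, ← MemLp.toLp_const_smul]
    congr 2
    · exact MemLp.toLp_congr _ _ (ae_of_all _ fun x => trialL_smul k α c D x)
    · ext i
      fin_cases i <;> simp [opB_pumTrial_smul, mul_left_comm]

/-- The right-hand sides of the boundary value problem in the Hilbert space of `lossMap`. -/
def lossTarget (D : EllipticBVP) (γ : ℝ) :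
    WithLp 2 (Lp ℝ 2 (volume.restrict (Ioo (-D.R) D.R)) × EuclideanSpace ℝ (Fin 2)) :=
  WithLp.toLp 2 (D.f_mem.toLp _, !₂[√γ * D.g (-D.R), √γ * D.g D.R])

lemma loss_eq_integral (D : EllipticBVP) (γ : ℝ) (hP : 1 ≤ P) (k : Fin (P + 1) × Fin Np → ℝ)
    (α : Fin (P + 1) × (Fin Np ⊕ Fin Np) → ℝ) :
    loss D γ P Np k α = (∫ x in Ioo (-D.R) D.R, (trialL D P Np k α x - D.f x) ^ 2) +
      γ * ((D.opB (pumTrial D.R P Np k α) (-D.R) - D.g (-D.R)) ^ 2 +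
        (D.opB (pumTrial D.R P Np k α) D.R - D.g D.R) ^ 2) := by
  unfold loss EllipticBVP.lossOf
  congr 1
  refine integral_congr_ae ?_
  filter_upwards [opL_pumTrial_ae D hP k α] with x hx
  rw [hx]

lemma norm_toLp_sq {μ : Measure ℝ} {h : ℝ → ℝ} (hh : MemLp h 2 μ) :
    ‖hh.toLp h‖ ^ 2 = ∫ x, h x ^ 2 ∂μ := by
  rw [← real_inner_self_eq_norm_sq, L2.inner_def]
  refine integral_congr_ae ?_
  filter_upwards [hh.coeFn_toLp] with x hx
  rw [hx]
  simp [sq]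

/-- The factors `√γ` put the penalty weight into the Euclidean component, so that interior and
boundary residuals form one vector in a Hilbert space, affine in the coefficients. -/
lemma loss_eq_norm_sq (D : EllipticBVP) {γ : ℝ} (hγ : 0 ≤ γ) (hP : 1 ≤ P)
    (k : Fin (P + 1) × Fin Np → ℝ) (α : Fin (P + 1) × (Fin Np ⊕ Fin Np) → ℝ) :
    loss D γ P Np k α = ‖lossMap D γ hP k α - lossTarget D γ‖ ^ 2 := by
  rw [loss_eq_integral D γ hP, WithLp.prod_norm_sq_eq_of_L2]
  simp only [lossMap, lossTarget, LinearMap.coe_mk, AddHom.coe_mk, WithLp.sub_fst, WithLp.sub_snd]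
  congr 1
  · change _ = ‖(memLp_trialL D hP k α).toLp _ - D.f_mem.toLp _‖ ^ 2
    rw [← MemLp.toLp_sub, norm_toLp_sq]
    rfl
  · rw [EuclideanSpace.norm_sq_eq, Fin.sum_univ_two]
    change _ = ‖√γ * _ - √γ * _‖ ^ 2 + ‖√γ * _ - √γ * _‖ ^ 2
    simp only [Real.norm_eq_abs, sq_abs, ← mul_sub, mul_pow, Real.sq_sqrt hγ]
    ring

lemma loss_nonneg (D : EllipticBVP) {γ : ℝ} (hγ : 0 ≤ γ)
    (k : Fin (P + 1) × Fin Np → ℝ) (α : Fin (P + 1) × (Fin Np ⊕ Fin Np) → ℝ) :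
    0 ≤ loss D γ P Np k α := by
  unfold loss EllipticBVP.lossOf
  have : 0 ≤ ∫ x in Ioo (-D.R) D.R, (D.opL (pumTrial D.R P Np k α) x - D.f x) ^ 2 :=
    integral_nonneg fun x => sq_nonneg _
  positivity

lemma bddBelow_loss (D : EllipticBVP) {γ : ℝ} (hγ : 0 ≤ γ) (k : Fin (P + 1) × Fin Np → ℝ) :
    BddBelow (range (loss D γ P Np k)) :=
  ⟨0, by rintro _ ⟨α, rfl⟩; exact loss_nonneg D hγ k α⟩

lemma minLoss_le (D : EllipticBVP) {γ : ℝ} (hγ : 0 ≤ γ) (k : Fin (P + 1) × Fin Np → ℝ)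
    (α : Fin (P + 1) × (Fin Np ⊕ Fin Np) → ℝ) : minLoss D γ P Np k ≤ loss D γ P Np k α :=
  ciInf_le (bddBelow_loss D hγ k) α

lemma minLoss_nonneg (D : EllipticBVP) {γ : ℝ} (hγ : 0 ≤ γ) (k : Fin (P + 1) × Fin Np → ℝ) :
    0 ≤ minLoss D γ P Np k :=
  le_ciInf fun α => loss_nonneg D hγ k α

theorem isLeast_minLoss (D : EllipticBVP) {γ : ℝ} (hγ : 0 ≤ γ) (hP : 1 ≤ P)
    (k : Fin (P + 1) × Fin Np → ℝ) :
    IsLeast (range (loss D γ P Np k)) (minLoss D γ P Np k) := by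
  refine ⟨?_, by rintro _ ⟨α, rfl⟩; exact minLoss_le D hγ k α⟩
  obtain ⟨α₀, h⟩ := exists_isMinOn_norm_sub_sq (lossMap D γ hP k) (lossTarget D γ)
  refine ⟨α₀, le_antisymm (le_ciInf fun α => ?_) (minLoss_le D hγ k α₀)⟩
  rw [loss_eq_norm_sq D hγ hP, loss_eq_norm_sq D hγ hP]
  exact h α

lemma continuous_loss (D : EllipticBVP) {γ : ℝ} (hγ : 0 ≤ γ) (hP : 1 ≤ P)
    (k : Fin (P + 1) × Fin Np → ℝ) : Continuous (loss D γ P Np k) := by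
  rw [funext (loss_eq_norm_sq D hγ hP k)]
  exact continuous_norm_sub_sq _ _

/-- Continuity in the coefficients reduces the infimum to a countable one, which preserves
measurability in the weights. -/
lemma minLoss_eq_iInf_denseSeq (D : EllipticBVP) {γ : ℝ} (hγ : 0 ≤ γ) (hP : 1 ≤ P)
    (k : Fin (P + 1) × Fin Np → ℝ) :
    minLoss D γ P Np k = ⨅ n, loss D γ P Np k (TopologicalSpace.denseSeq _ n) := by
  have hb : BddBelow (range fun n => loss D γ P Np k (TopologicalSpace.denseSeq _ n)) :=
    ⟨0, by rintro _ ⟨n, rfl⟩; exact loss_nonneg D hγ k _⟩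
  refine le_antisymm (le_ciInf fun n => minLoss_le D hγ k _) (le_ciInf fun α => ?_)
  refine DenseRange.induction_on
    (p := fun α => ⨅ n, loss D γ P Np k (TopologicalSpace.denseSeq _ n) ≤ loss D γ P Np k α)
    (TopologicalSpace.denseRange_denseSeq _) α ?_ fun n => ciInf_le hb n
  exact isClosed_le continuous_const (continuous_loss D hγ hP k)

lemma isProbabilityMeasure_uniform {S : ℝ} (hS : 0 < S) :
    IsProbabilityMeasure (ProbabilityTheory.cond (volume : Measure ℝ) (Ioo 0 S)) :=
  ProbabilityTheory.cond_isProbabilityMeasure_of_finite (by simp [hS]) (by simp)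

lemma isProbabilityMeasure_weightLaw (P Np : ℕ) {S : ℝ} (hS : 0 < S) :
    IsProbabilityMeasure (weightLaw P Np S) := by
  have := isProbabilityMeasure_uniform hS
  unfold weightLaw
  infer_instance

/-- The data `a, b, c, f` are measurable only up to null sets, so the integrand is handled modulo
null sets of the product measure. -/
lemma aemeasurable_loss (D : EllipticBVP) (γ : ℝ) (hP : 1 ≤ P)
    (α : Fin (P + 1) × (Fin Np ⊕ Fin Np) → ℝ) (ν : Measure (Fin (P + 1) × Fin Np → ℝ))
    [SFinite ν] : AEMeasurable (fun k => loss D γ P Np k α) ν := by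
  rw [funext fun k => loss_eq_integral D γ hP k α]
  have hx : ∀ x : ℝ, Measurable fun k : Fin (P + 1) × Fin Np → ℝ => (k, x) := fun x => by fun_prop
  have hB : ∀ x, Measurable fun k => D.opB (pumTrial D.R P Np k α) x := by
    intro x
    simp only [opB_pumTrial]
    exact (((measurable_patchSumDeriv D.R α).comp (hx x)).const_mul _).add
      (((measurable_patchSum D.R α).comp (hx x)).const_mul _)
  have hI : AEStronglyMeasurable (fun z : (Fin (P + 1) × Fin Np → ℝ) × ℝ =>
      (trialL D P Np z.1 α z.2 - D.f z.2) ^ 2) (ν.prod (volume.restrict (Ioo (-D.R) D.R))) := by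
    unfold trialL
    refine AEStronglyMeasurable.pow ((((?_ : AEStronglyMeasurable _ _).add ?_).add ?_).sub
      D.f_mem.1.comp_snd) 2
    · exact D.a_mem.1.comp_snd.mul (measurable_patchSumDeriv2 D.R α).aestronglyMeasurable
    · exact D.b_mem.1.comp_snd.mul (measurable_patchSumDeriv D.R α).aestronglyMeasurable
    · exact D.c_mem.1.comp_snd.mul (measurable_patchSum D.R α).aestronglyMeasurable
  refine hI.integral_prod_right'.aemeasurable.add (Measurable.aemeasurable ?_)
  exact ((((hB _).sub_const _).pow_const 2).add (((hB _).sub_const _).pow_const 2)).const_mul γ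

lemma pumTrial_zero (R : ℝ) (k : Fin (P + 1) × Fin Np → ℝ) : pumTrial R P Np k 0 = 0 := by
  funext x
  simp [pumTrial]

/-- Zero coefficients give the zero trial function whatever the weights, so the minimal loss is
bounded by a constant. -/
theorem integrable_minLoss (D : EllipticBVP) {γ : ℝ} (hγ : 0 ≤ γ) (hP : 1 ≤ P)
    (ν : Measure (Fin (P + 1) × Fin Np → ℝ)) [IsFiniteMeasure ν] :
    Integrable (minLoss D γ P Np) ν := by
  refine Integrable.of_bound (C := D.lossOf γ 0) ?_ (ae_of_all _ fun k => ?_)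
  · rw [funext fun k => minLoss_eq_iInf_denseSeq D hγ hP k]
    exact (AEMeasurable.iInf fun n => aemeasurable_loss D γ hP _ ν).aestronglyMeasurable
  · rw [Real.norm_eq_abs, abs_of_nonneg (minLoss_nonneg D hγ k)]
    have := minLoss_le D hγ k 0
    rwa [loss, pumTrial_zero] at this

end RFM

/-! ### From distinct weights to a bound on the expected loss -/

namespace RFM

variable {R : ℝ} {P Np : ℕ}

section Weights

/-- Almost surely, the sampled weights lie in `(0, S)` and are pairwise distinct. -/
lemma ae_weightLaw (P Np : ℕ) {S : ℝ} (hS : 0 < S) :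
    ∀ᵐ k ∂(weightLaw P Np S), (∀ i, 0 < k i ∧ k i < S) ∧ Function.Injective k := by
  have := isProbabilityMeasure_uniform hS
  set μ := ProbabilityTheory.cond (volume : Measure ℝ) (Ioo 0 S) with hμ
  have hatom : ∀ x, μ {x} = 0 := fun x =>
    ProbabilityTheory.cond_absolutelyContinuous (Real.volume_singleton)
  have hmem : ∀ᵐ x ∂μ, x ∈ Ioo 0 S := ProbabilityTheory.ae_cond_mem measurableSet_Ioo
  have hdiag : (μ.prod μ) {z | z.1 = z.2} = 0 := by
    rw [Measure.prod_apply (measurableSet_eq_fun measurable_fst measurable_snd)]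
    simp only [preimage_ofPred_eq]
    simp [show ∀ x : ℝ, {a : ℝ | x = a} = {x} from fun x => by ext; simp [eq_comm], hatom]
  have hne : ∀ i j : Fin (P + 1) × Fin Np, i ≠ j → ∀ᵐ k ∂(weightLaw P Np S), k i ≠ k j := by
    intro i j hij
    -- By independence a pair of weights has law `μ × μ`, and an atomless product measure does not
    -- charge the diagonal.
    have hind := (ProbabilityTheory.iIndepFun_pi (μ := fun _ : Fin (P + 1) × Fin Np => μ)
      (X := fun _ => id) (fun _ => aemeasurable_id)).indepFun hij
    simp only [id_eq] at hind
    rw [ProbabilityTheory.indepFun_iff_map_prod_eq_prod_map_map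
      (measurable_pi_apply i).aemeasurable (measurable_pi_apply j).aemeasurable] at hind
    have h1 : ∀ i, (Measure.pi fun _ : Fin (P + 1) × Fin Np => μ).map (fun ω => ω i) = μ :=
      fun i => (measurePreserving_eval (μ := fun _ : Fin (P + 1) × Fin Np => μ) i).map_eq
    rw [h1, h1] at hind
    rw [← hind, Measure.map_apply (by fun_prop)
      (measurableSet_eq_fun measurable_fst measurable_snd)] at hdiag
    exact measure_eq_zero_iff_ae_notMem.1 hdiag
  have hpos : ∀ i : Fin (P + 1) × Fin Np, ∀ᵐ k ∂(weightLaw P Np S), k i ∈ Ioo 0 S := fun i =>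
    (Measure.tendsto_eval_ae_ae (μ := fun _ : Fin (P + 1) × Fin Np => μ) (i := i)).eventually hmem
  have hne' : ∀ᵐ k ∂(weightLaw P Np S), ∀ i j, i ≠ j → k i ≠ k j := by
    simp only [ae_all_iff]
    exact hne
  filter_upwards [ae_all_iff.2 hpos, hne'] with k h1 h2
  exact ⟨h1, fun i j hij => by_contra fun h => h2 i j h hij⟩

/-- This is where probability leaves the argument: the expectation of a quantity bounded almost
surely is bounded by the same constant. -/
lemma expMinLoss_le (D : EllipticBVP) {γ : ℝ} (hγ : 0 ≤ γ) (hP : 1 ≤ P) {S : ℝ} (hS : 0 < S) {B : ℝ}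
    (h : ∀ k : Fin (P + 1) × Fin Np → ℝ, (∀ i, 0 < k i ∧ k i < S) → Function.Injective k →
      minLoss D γ P Np k ≤ B) : expMinLoss D γ P Np S ≤ B := by
  have := isProbabilityMeasure_weightLaw P Np hS
  have h1 : ∫ k, minLoss D γ P Np k ∂(weightLaw P Np S) ≤ ∫ _, B ∂(weightLaw P Np S) := by
    refine integral_mono_ae (integrable_minLoss D hγ hP _) (integrable_const _) ?_
    filter_upwards [ae_weightLaw P Np hS] with k hk
    exact h k hk.1 hk.2
  simpa [expMinLoss] using h1

end Weights

/-! ### Local approximation and gluing -/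

section Local

/-- Injectivity lets the sum over the set of frequencies be reindexed by the weights themselves,
with no collisions. -/
lemma trigSum_eq_localTrial (k : Fin (P + 1) × Fin Np → ℝ) (hk : Function.Injective k)
    (α β : Fin (P + 1) → ℝ → ℝ) (p : Fin (P + 1)) :
    trigSum (Finset.univ.image fun i => k (p, i)) (α p) (β p) =
      localTrial k (fun z => Sum.elim (fun i => α z.1 (k (z.1, i))) (fun i => β z.1 (k (z.1, i))) z.2)
        p := by
  funext l
  unfold trigSum localTrial
  rw [Finset.sum_image fun i _ j _ hij => by simpa using hk hij]
  rfl

lemma iteratedDeriv_comp_affine {q : ℝ → ℝ} (hq : ContDiff ℝ (⊤ : ℕ∞) q) (x₀ r : ℝ) (j : ℕ) (l : ℝ) :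
    iteratedDeriv j (fun l => q (x₀ + r * l)) l = r ^ j * iteratedDeriv j q (x₀ + r * l) := by
  have h1 : ContDiff ℝ j fun y => q (x₀ + y) := by
    have : ContDiff ℝ j q := hq.of_le (by exact_mod_cast le_top)
    fun_prop
  have := iteratedDeriv_comp_const_mul h1 r
  rw [show (fun l => q (x₀ + r * l)) = fun l => (fun y => q (x₀ + y)) (r * l) from rfl, this]
  simp only
  rw [iteratedDeriv_comp_const_add]

/-- Simultaneous approximation on all patches. -/
lemma exists_local_coefficients {S r M : ℝ} (hS : 0 < S) (hr : 0 < r) (hNp : 0 < Np)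
    (k : Fin (P + 1) × Fin Np → ℝ)
    (hk : ∀ i, 0 < k i ∧ k i < S) (hinj : Function.Injective k) (x₀ : Fin (P + 1) → ℝ)
    {q : ℝ → ℝ} (hq : ContDiff ℝ (⊤ : ℕ∞) q)
    (hb : ∀ j ≤ 2 * Np, ∀ x, |iteratedDeriv j q x| ≤ M * (S / r) ^ j) :
    ∃ α : Fin (P + 1) × (Fin Np ⊕ Fin Np) → ℝ, ∀ p l, |l| ≤ 5 / 4 →
      |localTrial k α p l - q (x₀ p + r * l)| ≤ (1 + S ^ 2) * (4 ^ Np * M * S ^ (2 * Np)) ∧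
      |localTrialDeriv k α p l - r * deriv q (x₀ p + r * l)| ≤
        (1 + S ^ 2) * (4 ^ Np * M * S ^ (2 * Np)) ∧
      |localTrialDeriv2 k α p l - r ^ 2 * deriv (deriv q) (x₀ p + r * l)| ≤
        (1 + S ^ 2) * (4 ^ Np * M * S ^ (2 * Np)) := by
  have hM : 0 ≤ M := by simpa using (abs_nonneg _).trans (hb 0 (by omega) 0)
  have hcard : ∀ p, (Finset.univ.image fun i : Fin Np => k (p, i)).card = Np := by
    intro p
    rw [Finset.card_image_of_injective _ fun i j hij => by simpa using hinj hij]
    simp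
  have hne : ∀ p, (Finset.univ.image fun i : Fin Np => k (p, i)).Nonempty := fun p =>
    Finset.card_pos.1 (by rw [hcard]; exact hNp)
  -- The radius `5/4` is the half-width of the support of the profile in local coordinates;
  -- rescaling by `r` turns the growth rate `S / r` into `S`.
  have key := fun p => exists_trigSum_approx (A := 5 / 4) (S := S) (by norm_num) hS.le
    (Finset.univ.image fun i => k (p, i)) (by
      intro κ hκ
      obtain ⟨i, -, rfl⟩ := Finset.mem_image.1 hκ
      exact hk (p, i)) (fun l => q (x₀ p + r * l)) M (by fun_prop) (by
      intro j hj l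
      rw [hcard] at hj
      rw [iteratedDeriv_comp_affine hq, abs_mul, abs_of_pos (pow_pos hr j)]
      calc _ ≤ r ^ j * (M * (S / r) ^ j) := by
            gcongr
            exact hb j hj _
        _ = M * S ^ j := by
            rw [div_pow]
            field_simp)
  choose α β h using key
  have hd1 : ∀ p, deriv (fun l => q (x₀ p + r * l)) = fun l => r * deriv q (x₀ p + r * l) := by
    intro p
    funext l
    simpa [iteratedDeriv_one] using iteratedDeriv_comp_affine hq (x₀ p) r 1 l
  have hd2 : ∀ p, deriv (deriv (fun l => q (x₀ p + r * l))) =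
      fun l => r ^ 2 * deriv (deriv q) (x₀ p + r * l) := by
    intro p
    funext l
    have := iteratedDeriv_comp_affine hq (x₀ p) r 2 l
    rwa [iteratedDeriv_succ, iteratedDeriv_one, iteratedDeriv_succ, iteratedDeriv_one] at this
  refine ⟨fun z => Sum.elim (fun i => α z.1 (k (z.1, i))) (fun i => β z.1 (k (z.1, i))) z.2,
    fun p l hl => ?_⟩
  obtain ⟨b0, b12⟩ := h p l hl
  obtain ⟨b1, b2⟩ := b12 (hne p)
  have hB : (2 * (5 / 4 : ℝ) ^ 2) ^ Np * M * S ^ (2 * Np) ≤ 4 ^ Np * M * S ^ (2 * Np) := by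
    gcongr; norm_num
  have hB' : 0 ≤ 4 ^ Np * M * S ^ (2 * Np) := by positivity
  rw [hd1, trigSum_eq_localTrial k hinj, hcard, abs_sub_comm,
    (localTrial_hasDerivAt k _ p l).deriv] at b1
  rw [hd2, trigSum_eq_localTrial k hinj, hcard, abs_sub_comm,
    show deriv (localTrial k _ p) = localTrialDeriv k _ p from
      funext fun l => (localTrial_hasDerivAt k _ p l).deriv,
    (localTrialDeriv_hasDerivAt k _ p l).deriv] at b2
  rw [trigSum_eq_localTrial k hinj, hcard, abs_sub_comm] at b0
  refine ⟨?_, ?_, ?_⟩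
  · nlinarith [mul_nonneg (sq_nonneg S) hB']
  · refine b1.trans ?_
    gcongr
  · refine b2.trans ?_
    gcongr

/-- The patchwise approximation, on `[-R, R]`. -/
lemma exists_coefficients (hR : 0 < R) (hP : 1 ≤ P) {S M : ℝ} (hS : 0 < S) (hNp : 0 < Np)
    (k : Fin (P + 1) × Fin Np → ℝ)
    (hk : ∀ i, 0 < k i ∧ k i < S) (hinj : Function.Injective k)
    {q : ℝ → ℝ} (hq : ContDiff ℝ (⊤ : ℕ∞) q)
    (hb : ∀ j ≤ 2 * Np, ∀ x, |iteratedDeriv j q x| ≤ M * (S / patchSize R P) ^ j) {B : ℝ}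
    (hB : B = (1 + S ^ 2) * (4 ^ Np * M * S ^ (2 * Np))) :
    ∃ α : Fin (P + 1) × (Fin Np ⊕ Fin Np) → ℝ, ∀ x ∈ Icc (-R) R,
      |pumTrial R P Np k α x - q x| ≤ 4 * B ∧
      |deriv (pumTrial R P Np k α) x - deriv q x| ≤ 20 * B / patchSize R P ∧
      (x ∉ kinks R P → |deriv (deriv (pumTrial R P Np k α)) x - deriv (deriv q) x| ≤
        164 * B / patchSize R P ^ 2) := by
  have hM : 0 ≤ M := by simpa using (abs_nonneg _).trans (hb 0 (by omega) 0)
  have hr := patchSize_pos hR hP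
  set r := patchSize R P with hrdef
  set x₀ : Fin (P + 1) → ℝ := fun p => -R + 2 * r * (p : ℕ) with hx₀
  obtain ⟨α, hα⟩ := exists_local_coefficients hS hr hNp k hk hinj x₀ hq hb
  rw [← hB] at hα
  have hB0 : 0 ≤ B := by rw [hB]; positivity
  have hq1 : ContDiff ℝ (⊤ : ℕ∞) (deriv q) := by
    rw [contDiff_infty_iff_deriv] at hq; exact hq.2
  have hqd : ∀ x, HasDerivAt q (deriv q x) x := fun x =>
    (hq.differentiable (by simp) x).hasDerivAt
  have hqd2 : ∀ x, HasDerivAt (deriv q) (deriv (deriv q) x) x := fun x =>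
    (hq1.differentiable (by simp) x).hasDerivAt
  have haff : ∀ p l, HasDerivAt (fun l : ℝ => x₀ p + r * l) r l := fun p l => by
    simpa using ((hasDerivAt_id l).const_mul r).const_add (x₀ p)
  set e : Fin (P + 1) → ℝ → ℝ := fun p l => localTrial k α p l - q (x₀ p + r * l) with he
  set e' : Fin (P + 1) → ℝ → ℝ := fun p l =>
    localTrialDeriv k α p l - r * deriv q (x₀ p + r * l) with he'
  set e'' : Fin (P + 1) → ℝ → ℝ := fun p l =>
    localTrialDeriv2 k α p l - r ^ 2 * deriv (deriv q) (x₀ p + r * l) with he''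
  have hde : ∀ p l, HasDerivAt (e p) (e' p l) l := fun p l =>
    ((localTrial_hasDerivAt k α p l).sub ((hqd _).comp l (haff p l))).congr_deriv (by
      simp only [he']; ring)
  have hde' : ∀ p l, HasDerivAt (e' p) (e'' p l) l := fun p l =>
    ((localTrialDeriv_hasDerivAt k α p l).sub
      (((hqd2 _).comp l (haff p l)).const_mul r)).congr_deriv (by simp only [he'']; ring)
  have hbd := patchSum_bounds hR hP hB0 (e := e) (e' := e') (e'' := e'') hα
  -- An open neighbourhood of `[-R, R]` is used so that the identity between the global error and
  -- the glued local errors can be differentiated at the endpoints too.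
  set N : Set ℝ := Ioo (-R - 3 / 4 * r) (R + 3 / 4 * r) with hN
  have h0 : ∀ x ∈ N, pumTrial R P Np k α x - q x = patchSum R P e x := by
    intro x hx
    have h1 := sum_pouProfile hR hP hx
    have h2 : ∀ p : Fin (P + 1), x₀ p + r * localCoord R P p x = x := by
      intro p
      unfold localCoord
      rw [← hrdef]
      field_simp
      simp only [hx₀]
      ring
    rw [pumTrial_eq, patchSum, patchSum]
    simp only [he, h2, mul_sub, Finset.sum_sub_distrib, ← Finset.sum_mul, h1, one_mul]
  have hsum : ∀ x, HasDerivAt (pumTrial R P Np k α) (deriv (pumTrial R P Np k α) x) x := fun x =>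
    (patchSum_hasDerivAt (localTrial_hasDerivAt k α) x).differentiableAt.hasDerivAt
  have h1 : ∀ x ∈ N, deriv (pumTrial R P Np k α) x - deriv q x = patchSumDeriv R P e e' x := by
    intro x hx
    have hA := (hsum x).sub (hqd x)
    have hE : HasDerivAt (fun x => pumTrial R P Np k α x - q x) (patchSumDeriv R P e e' x) x := by
      refine (patchSum_hasDerivAt hde x).congr_of_eventuallyEq ?_
      filter_upwards [isOpen_Ioo.mem_nhds hx] with y hy using h0 y hy
    exact hA.unique hE
  have h2 : ∀ x ∈ N, x ∉ kinks R P →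
      deriv (deriv (pumTrial R P Np k α)) x - deriv (deriv q) x = patchSumDeriv2 R P e e' e'' x := by
    intro x hx hxk
    have hA : HasDerivAt (deriv (pumTrial R P Np k α))
        (deriv (deriv (pumTrial R P Np k α)) x) x := by
      rw [deriv_deriv_pumTrial k α hxk, deriv_pumTrial]
      exact patchSumDeriv_hasDerivAt (localTrial_hasDerivAt k α) (localTrialDeriv_hasDerivAt k α) hxk
    have hE : HasDerivAt (fun x => deriv (pumTrial R P Np k α) x - deriv q x)
        (patchSumDeriv2 R P e e' e'' x) x := by
      refine (patchSumDeriv_hasDerivAt hde hde' hxk).congr_of_eventuallyEq ?_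
      filter_upwards [isOpen_Ioo.mem_nhds hx] with y hy using h1 y hy
    exact (hA.sub (hqd2 x)).unique hE
  have hsub : Icc (-R) R ⊆ N := fun x hx => ⟨by linarith [hx.1], by linarith [hx.2]⟩
  refine ⟨α, fun x hx => ⟨?_, ?_, fun hxk => ?_⟩⟩
  · rw [h0 x (hsub hx)]; exact (hbd x).1
  · rw [h1 x (hsub hx)]; exact (hbd x).2.1
  · rw [h2 x (hsub hx) hxk]; exact (hbd x).2.2

end Local

/-! ### Stability of the loss and the general error bound -/

section Loss

lemma sq_add_le_of_abs {x y a : ℝ} (h : |x| ≤ a) : (x + y) ^ 2 ≤ 2 * a ^ 2 + 2 * y ^ 2 := by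
  have : x ^ 2 ≤ a ^ 2 := sq_le_sq' (abs_le.1 h).1 (abs_le.1 h).2
  nlinarith [sq_nonneg (x - y)]

lemma sq_three_terms_le {a b c X Y Z A B C Λ : ℝ} (ha : a ^ 2 ≤ Λ) (hb : b ^ 2 ≤ Λ) (hc : c ^ 2 ≤ Λ)
    (hX : X ^ 2 ≤ A) (hY : Y ^ 2 ≤ B) (hZ : Z ^ 2 ≤ C) :
    (a * X + b * Y + c * Z) ^ 2 ≤ 3 * Λ * (A + B + C) := by
  have hΛ : 0 ≤ Λ := (sq_nonneg a).trans ha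
  have h1 : (a * X) ^ 2 ≤ Λ * A := by rw [mul_pow]; gcongr
  have h2 : (b * Y) ^ 2 ≤ Λ * B := by rw [mul_pow]; gcongr
  have h3 : (c * Z) ^ 2 ≤ Λ * C := by rw [mul_pow]; gcongr
  nlinarith [sq_nonneg (a * X - b * Y), sq_nonneg (b * Y - c * Z), sq_nonneg (a * X - c * Z)]

/-- Stability of the loss: it is controlled by the `W^{2,∞}`-distance of the trial function to
`q` and by the `H²`-distance of `q` to the solution. -/
lemma lossOf_le (D : EllipticBVP) {γ : ℝ} (hγ : 0 ≤ γ) {u u₁ u₂ : ℝ → ℝ}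
    (hu₂ : MemLp u₂ 2 (volume.restrict (Ioo (-D.R) D.R)))
    (heq : ∀ᵐ x ∂(volume.restrict (Ioo (-D.R) D.R)),
      D.a x * u₂ x + D.b x * u₁ x + D.c x * u x = D.f x)
    (hbc : ∀ x ∈ ({-D.R, D.R} : Set ℝ), D.g₁ x * u₁ x + D.g₂ x * u x = D.g x) :
    ∃ C, 0 ≤ C ∧ ∀ (w q : ℝ → ℝ) (τ δ : ℝ), ContDiff ℝ (⊤ : ℕ∞) q →
      (∀ x ∈ Icc (-D.R) D.R, |w x - q x| ≤ τ ∧ |deriv w x - deriv q x| ≤ τ) →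
      (∀ᵐ x ∂(volume.restrict (Ioo (-D.R) D.R)), |deriv (deriv w) x - deriv (deriv q) x| ≤ τ) →
      (∀ x ∈ Icc (-D.R) D.R, (q x - u x) ^ 2 ≤ δ ∧ (deriv q x - u₁ x) ^ 2 ≤ δ) →
      (∫ x in Ioo (-D.R) D.R, (deriv (deriv q) x - u₂ x) ^ 2) ≤ δ →
      D.lossOf γ w ≤ C * (τ ^ 2 + δ) := by
  have hR := D.R_pos
  set μ := volume.restrict (Ioo (-D.R) D.R) with hμ
  have hbound : ∀ {h : ℝ → ℝ}, MemLp h ∞ μ → ∃ Λ, 0 ≤ Λ ∧ ∀ᵐ x ∂μ, h x ^ 2 ≤ Λ := by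
    intro h hh
    refine ⟨(eLpNormEssSup h μ).toReal ^ 2, by positivity, ?_⟩
    have htop : eLpNormEssSup h μ ≠ ∞ := by
      have := hh.2; rw [eLpNorm_exponent_top] at this; exact this.ne
    filter_upwards [enorm_ae_le_eLpNormEssSup h μ] with x hx
    have : ‖h x‖ ≤ (eLpNormEssSup h μ).toReal := by
      rw [← toReal_enorm]
      exact ENNReal.toReal_mono htop hx
    rw [← sq_abs]
    rw [Real.norm_eq_abs] at this
    gcongr
  obtain ⟨Λa, hΛa, ha⟩ := hbound D.a_mem
  obtain ⟨Λb, hΛb, hb⟩ := hbound D.b_mem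
  obtain ⟨Λc, hΛc, hc⟩ := hbound D.c_mem
  set Λ := Λa + Λb + Λc with hΛ
  set G := D.g₁ (-D.R) ^ 2 + D.g₂ (-D.R) ^ 2 + D.g₁ D.R ^ 2 + D.g₂ D.R ^ 2 with hG
  -- The three-term square inequality costs `3 Λ` and each splitting of a difference through `q`
  -- costs `2`. Hence `18 = 3·3·2` for `τ²`, `12 = 3·2·2` for the two pointwise terms in `δ`, and `6
  -- = 3·2` for the integrated one.
  refine ⟨Λ * (2 * D.R * 18 + 2 * D.R * 12 + 6) + γ * (8 * G), by positivity, ?_⟩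
  intro w q τ δ hq hw hw2 hqu hqu2
  have hδ : 0 ≤ δ := (sq_nonneg _).trans (hqu D.R ⟨by linarith, le_rfl⟩).1
  have hq2 : MemLp (deriv (deriv q)) 2 μ := by
    have hc2 : Continuous (deriv (deriv q)) := by
      rw [contDiff_infty_iff_deriv, contDiff_infty_iff_deriv, contDiff_infty_iff_deriv] at hq
      exact hq.2.2.1.continuous
    obtain ⟨B, hB⟩ := isCompact_Icc.exists_bound_of_continuousOn (s := Icc (-D.R) D.R)
      hc2.continuousOn
    refine MemLp.of_bound hc2.aestronglyMeasurable B ?_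
    filter_upwards [ae_restrict_mem measurableSet_Ioo] with x hx
    exact hB x (Ioo_subset_Icc_self hx)
  have hint : Integrable (fun x => (deriv (deriv q) x - u₂ x) ^ 2) μ := (hq2.sub hu₂).integrable_sq
  have hpt : ∀ᵐ x ∂μ, (D.opL w x - D.f x) ^ 2 ≤
      Λ * (18 * τ ^ 2 + 12 * δ) + Λ * 6 * (deriv (deriv q) x - u₂ x) ^ 2 := by
    filter_upwards [heq, hw2, ha, hb, hc, ae_restrict_mem measurableSet_Ioo]
      with x hx hx2 hax hbx hcx hxm
    have hxI := Ioo_subset_Icc_self hxm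
    obtain ⟨w0, w1⟩ := hw x hxI
    obtain ⟨q0, q1⟩ := hqu x hxI
    have s0 := sq_add_le_of_abs (y := q x - u x) w0
    have s1 := sq_add_le_of_abs (y := deriv q x - u₁ x) w1
    have s2 := sq_add_le_of_abs (y := deriv (deriv q) x - u₂ x) hx2
    rw [sub_add_sub_cancel] at s0 s1 s2
    have e1 : D.opL w x - D.f x = D.a x * (deriv (deriv w) x - u₂ x) +
        D.b x * (deriv w x - u₁ x) + D.c x * (w x - u x) := by
      rw [← hx, EllipticBVP.opL]; ring
    rw [e1]
    refine (sq_three_terms_le (by linarith : D.a x ^ 2 ≤ Λ) (by linarith : D.b x ^ 2 ≤ Λ)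
      (by linarith : D.c x ^ 2 ≤ Λ) s2 (s1.trans (add_le_add_right (mul_le_mul_of_nonneg_left q1
        zero_le_two) _)) (s0.trans (add_le_add_right (mul_le_mul_of_nonneg_left q0
        zero_le_two) _))).trans (le_of_eq ?_)
    ring
  have hI : ∫ x in Ioo (-D.R) D.R, (D.opL w x - D.f x) ^ 2 ≤
      2 * D.R * (Λ * (18 * τ ^ 2 + 12 * δ)) + Λ * 6 * δ := by
    calc _ ≤ ∫ x in Ioo (-D.R) D.R, (Λ * (18 * τ ^ 2 + 12 * δ) +
          Λ * 6 * (deriv (deriv q) x - u₂ x) ^ 2) :=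
          integral_mono_of_nonneg (ae_of_all _ fun x => sq_nonneg _)
            ((integrable_const _).add (hint.const_mul _)) hpt
      _ = 2 * D.R * (Λ * (18 * τ ^ 2 + 12 * δ)) +
          Λ * 6 * ∫ x in Ioo (-D.R) D.R, (deriv (deriv q) x - u₂ x) ^ 2 := by
          rw [integral_add (integrable_const _) (hint.const_mul _), integral_const_mul (Λ * 6),
            setIntegral_const, smul_eq_mul, measureReal_def, Real.volume_Ioo,
            ENNReal.toReal_ofReal (by linarith)]
          ring
      _ ≤ _ := by gcongr
  have hBd : ∀ x ∈ ({-D.R, D.R} : Set ℝ), x ∈ Icc (-D.R) D.R → D.g₁ x ^ 2 + D.g₂ x ^ 2 ≤ G →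
      (D.opB w x - D.g x) ^ 2 ≤ 4 * G * (τ ^ 2 + δ) := by
    intro x hx hxI hxG
    obtain ⟨w0, w1⟩ := hw x hxI
    obtain ⟨q0, q1⟩ := hqu x hxI
    have s0 := sq_add_le_of_abs (y := q x - u x) w0
    have s1 := sq_add_le_of_abs (y := deriv q x - u₁ x) w1
    rw [sub_add_sub_cancel] at s0 s1
    have e1 : D.opB w x - D.g x = D.g₁ x * (deriv w x - u₁ x) + D.g₂ x * (w x - u x) := by
      rw [← hbc x hx, EllipticBVP.opB]; ring
    rw [e1]
    set Y := deriv w x - u₁ x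
    set Z := w x - u x
    calc (D.g₁ x * Y + D.g₂ x * Z) ^ 2 ≤ (D.g₁ x ^ 2 + D.g₂ x ^ 2) * (Y ^ 2 + Z ^ 2) := by
          nlinarith [sq_nonneg (D.g₁ x * Z - D.g₂ x * Y)]
      _ ≤ G * (4 * (τ ^ 2 + δ)) := by
          have : Y ^ 2 + Z ^ 2 ≤ 4 * (τ ^ 2 + δ) := by linarith
          gcongr
      _ = _ := by ring
  have hl := hBd (-D.R) (by simp) ⟨le_rfl, by linarith⟩ (by
    linarith [sq_nonneg (D.g₁ D.R), sq_nonneg (D.g₂ D.R)])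
  have hr := hBd D.R (by simp) ⟨by linarith, le_rfl⟩ (by
    linarith [sq_nonneg (D.g₁ (-D.R)), sq_nonneg (D.g₂ (-D.R))])
  have hΛ0 : 0 ≤ Λ := by positivity
  have hRτ : 0 ≤ D.R * Λ * τ ^ 2 := by positivity
  have hRδ : 0 ≤ D.R * Λ * δ := by positivity
  have hΛτ : 0 ≤ Λ * τ ^ 2 := by positivity
  unfold EllipticBVP.lossOf
  have hbdry : γ * ((D.opB w (-D.R) - D.g (-D.R)) ^ 2 + (D.opB w D.R - D.g D.R) ^ 2) ≤
      γ * (8 * G * (τ ^ 2 + δ)) := by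
    gcongr
    linarith
  linarith

/-- The expected minimal loss for a solution which has approximations `q` whose derivatives
grow like those of a function with frequencies below `S / r`. -/
theorem expMinLoss_le_of_approx (D : EllipticBVP) {γ : ℝ} (hγ : 0 ≤ γ) {u u₁ u₂ : ℝ → ℝ}
    (hu₂ : MemLp u₂ 2 (volume.restrict (Ioo (-D.R) D.R)))
    (heq : ∀ᵐ x ∂(volume.restrict (Ioo (-D.R) D.R)),
      D.a x * u₂ x + D.b x * u₁ x + D.c x * u x = D.f x)
    (hbc : ∀ x ∈ ({-D.R, D.R} : Set ℝ), D.g₁ x * u₁ x + D.g₂ x * u x = D.g x) (hNp : 0 < Np)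
    (S₀ : ℝ) :
    ∃ C, 0 ≤ C ∧ ∀ P : ℕ, 1 ≤ P → ∀ (S M δ : ℝ) (q : ℝ → ℝ), 0 < S → S ≤ S₀ →
      ContDiff ℝ (⊤ : ℕ∞) q →
      (∀ j ≤ 2 * Np, ∀ x, |iteratedDeriv j q x| ≤ M * (S / patchSize D.R P) ^ j) →
      (∀ x ∈ Icc (-D.R) D.R, (q x - u x) ^ 2 ≤ δ ∧ (deriv q x - u₁ x) ^ 2 ≤ δ) →
      (∫ x in Ioo (-D.R) D.R, (deriv (deriv q) x - u₂ x) ^ 2) ≤ δ →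
      expMinLoss D γ P Np S ≤ C * (M ^ 2 * (S ^ (4 * Np) / patchSize D.R P ^ 4) + δ) := by
  obtain ⟨C, hC, h⟩ := lossOf_le D hγ hu₂ heq hbc
  have hR := D.R_pos
  -- Since `r ≤ R`, both `r` and `r²` are at most `(1 + R)²`. This lets the errors of orders `0`,
  -- `1` and `2` share the worst scaling `r⁻²`.
  set c : ℝ := 164 * (1 + D.R) ^ 2 * ((1 + S₀ ^ 2) * 4 ^ Np) with hc
  refine ⟨C * (c ^ 2 + 1), by positivity, ?_⟩
  intro P hP S M δ q hS hS₀ hq hb hqu hqu2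
  have hr := patchSize_pos hR hP
  have hrR := patchSize_le hR hP
  set r := patchSize D.R P with hrdef
  have hM : 0 ≤ M := by simpa using (abs_nonneg _).trans (hb 0 (by omega) 0)
  have hδ : 0 ≤ δ := (sq_nonneg _).trans (hqu D.R ⟨by linarith, le_rfl⟩).1
  refine expMinLoss_le D hγ hP hS fun k hk hinj => ?_
  obtain ⟨α, hα⟩ := exists_coefficients hR hP hS hNp k hk hinj hq hb rfl
  set B := (1 + S ^ 2) * (4 ^ Np * M * S ^ (2 * Np)) with hB
  have hB0 : 0 ≤ B := by positivity
  set τ := c * (M * S ^ (2 * Np) / r ^ 2) with hτ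
  have hBτ : 164 * (1 + D.R) ^ 2 * B / r ^ 2 ≤ τ := by
    have h1 : S ^ 2 ≤ S₀ ^ 2 := by gcongr
    calc 164 * (1 + D.R) ^ 2 * B / r ^ 2
        = 164 * (1 + D.R) ^ 2 * ((1 + S ^ 2) * 4 ^ Np) * (M * S ^ (2 * Np) / r ^ 2) := by
          rw [hB]; ring
      _ ≤ τ := by rw [hτ, hc]; gcongr
  have hr2 : r ^ 2 ≤ (1 + D.R) ^ 2 := by
    gcongr
    linarith
  have hr1 : r ≤ (1 + D.R) ^ 2 := by nlinarith
  have t0 : 4 * B ≤ τ := by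
    refine le_trans ?_ hBτ
    rw [le_div_iff₀ (by positivity)]
    nlinarith [mul_nonneg hB0 (sub_nonneg.2 hr2), mul_nonneg hB0 (sq_nonneg (1 + D.R))]
  have t1 : 20 * B / r ≤ τ := by
    refine le_trans ?_ hBτ
    rw [div_le_div_iff₀ hr (by positivity)]
    have : B * r * r ≤ B * r * (1 + D.R) ^ 2 := by gcongr
    nlinarith [mul_nonneg (mul_nonneg hB0 hr.le) (sq_nonneg (1 + D.R))]
  have t2 : 164 * B / r ^ 2 ≤ τ := by
    refine le_trans ?_ hBτ
    have : (1 : ℝ) ≤ (1 + D.R) ^ 2 := by nlinarith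
    gcongr
    nlinarith
  have := h (pumTrial D.R P Np k α) q τ δ hq
    (fun x hx => ⟨(hα x hx).1.trans t0, (hα x hx).2.1.trans t1⟩) (by
      filter_upwards [ae_notMem_kinks hR hP _, ae_restrict_mem measurableSet_Ioo] with x hx hxm
      exact ((hα x (Ioo_subset_Icc_self hxm)).2.2 hx).trans t2) hqu hqu2
  refine (minLoss_le D hγ k α).trans (this.trans ?_)
  have e : τ ^ 2 = c ^ 2 * (M ^ 2 * (S ^ (4 * Np) / r ^ 4)) := by
    rw [hτ, mul_pow, div_pow, mul_pow M, ← pow_mul, ← pow_mul]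
    ring_nf
  rw [e]
  have hX : 0 ≤ M ^ 2 * (S ^ (4 * Np) / r ^ 4) := by positivity
  rw [mul_assoc]
  gcongr
  nlinarith [mul_nonneg (sq_nonneg c) hδ]

end Loss

end RFM

/-! ### Uniqueness of weak derivatives on the interval -/

namespace RFM

section Uniqueness

variable {R : ℝ}

lemma intervalIntegrable_of_Ioo (hR : 0 < R) {h : ℝ → ℝ} (hh : IntegrableOn h (Ioo (-R) R)) :
    IntervalIntegrable h volume (-R) R := by
  rw [intervalIntegrable_iff_integrableOn_Ioo_of_le (by linarith)]
  exact hh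

/-- By Lebesgue differentiation an indefinite integral has derivative `h` almost everywhere, while
here it is identically zero. -/
lemma ae_eq_zero_of_primitive_eq_zero (hR : 0 < R) {h : ℝ → ℝ}
    (hh : IntervalIntegrable h volume (-R) R) (h0 : ∀ x ∈ Icc (-R) R, ∫ y in (-R)..x, h y = 0) :
    ∀ᵐ x ∂(volume.restrict (Ioo (-R) R)), h x = 0 := by
  filter_upwards [ae_restrict_of_ae hh.ae_hasDerivAt_integral, ae_restrict_mem measurableSet_Ioo]
    with x hx hxm
  have hI : x ∈ uIcc (-R) R := by
    rw [uIcc_of_le (by linarith)]; exact Ioo_subset_Icc_self hxm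
  have h1 := hx hI (-R) left_mem_uIcc
  have h2 : HasDerivAt (fun x => ∫ y in (-R)..x, h y) 0 x := by
    refine (hasDerivAt_const x (0 : ℝ)).congr_of_eventuallyEq ?_
    filter_upwards [isOpen_Ioo.mem_nhds hxm] with y hy using h0 y (Ioo_subset_Icc_self hy)
  exact h1.unique h2

lemma continuousOn_of_primitive (hR : 0 < R) {g h : ℝ → ℝ}
    (hh : IntervalIntegrable h volume (-R) R)
    (hg : ∀ x ∈ Icc (-R) R, g x = g (-R) + ∫ y in (-R)..x, h y) : ContinuousOn g (Icc (-R) R) := by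
  have := intervalIntegral.continuousOn_primitive_interval' hh (left_mem_uIcc)
  rw [uIcc_of_le (by linarith)] at this
  exact (continuousOn_const.add this).congr hg

lemma eqOn_zero_of_ae (hR : 0 < R) {g : ℝ → ℝ} (hg : ContinuousOn g (Icc (-R) R))
    (h0 : ∀ᵐ x ∂(volume.restrict (Ioo (-R) R)), g x = 0) : ∀ x ∈ Icc (-R) R, g x = 0 := by
  rw [restrict_Ioo_eq_restrict_Icc] at h0
  exact Measure.eqOn_Icc_of_ae_eq volume (by linarith) h0 hg continuousOn_const

/-- The derivatives of an `H²` function on `(-R, R)` are determined by the function. -/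
lemma derivatives_unique (hR : 0 < R) {u u₁ u₂ v v₁ v₂ : ℝ → ℝ}
    (hu₂ : IntegrableOn u₂ (Ioo (-R) R)) (hv₂ : IntegrableOn v₂ (Ioo (-R) R))
    (hu : ∀ x ∈ Icc (-R) R, u x = u (-R) + ∫ y in (-R)..x, u₁ y)
    (hu₁ : ∀ x ∈ Icc (-R) R, u₁ x = u₁ (-R) + ∫ y in (-R)..x, u₂ y)
    (hv : ∀ x ∈ Icc (-R) R, v x = v (-R) + ∫ y in (-R)..x, v₁ y)
    (hv₁ : ∀ x ∈ Icc (-R) R, v₁ x = v₁ (-R) + ∫ y in (-R)..x, v₂ y)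
    (huv : ∀ᵐ x ∂(volume.restrict (Ioo (-R) R)), v x = u x) :
    (∀ x ∈ Icc (-R) R, v x = u x ∧ v₁ x = u₁ x) ∧
      ∀ᵐ x ∂(volume.restrict (Ioo (-R) R)), v₂ x = u₂ x := by
  have hsub : ∀ x ∈ Icc (-R) R, uIcc (-R) x ⊆ uIcc (-R) R := fun x hx => by
    rw [uIcc_of_le hx.1, uIcc_of_le (by linarith)]; exact Icc_subset_Icc_right hx.2
  -- One differentiation step, used twice: almost everywhere equality becomes equality by
  -- continuity, and passes to the integrands. The first use supplies the hypothesis of the second.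
  have key : ∀ {f g f' g' : ℝ → ℝ}, IntervalIntegrable f' volume (-R) R →
      IntervalIntegrable g' volume (-R) R →
      (∀ x ∈ Icc (-R) R, f x = f (-R) + ∫ y in (-R)..x, f' y) →
      (∀ x ∈ Icc (-R) R, g x = g (-R) + ∫ y in (-R)..x, g' y) →
      (∀ᵐ x ∂(volume.restrict (Ioo (-R) R)), f x = g x) →
      (∀ x ∈ Icc (-R) R, f x = g x) ∧ ∀ᵐ x ∂(volume.restrict (Ioo (-R) R)), f' x = g' x := by
    intro f g f' g' hf' hg' hf hg hfg
    have e1 : ∀ x ∈ Icc (-R) R, f x - g x = 0 := by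
      refine eqOn_zero_of_ae hR ((continuousOn_of_primitive hR hf' hf).sub
        (continuousOn_of_primitive hR hg' hg)) ?_
      filter_upwards [hfg] with x hx using sub_eq_zero.2 hx
    refine ⟨fun x hx => sub_eq_zero.1 (e1 x hx), ?_⟩
    have e2 := ae_eq_zero_of_primitive_eq_zero hR (hf'.sub hg') fun x hx => by
      have h1 := e1 x hx
      have h2 := e1 (-R) ⟨le_rfl, by linarith⟩
      rw [hf x hx, hg x hx] at h1
      have := intervalIntegral.integral_sub (hf'.mono_set (hsub x hx)) (hg'.mono_set (hsub x hx))
      linarith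
    filter_upwards [e2] with x hx using sub_eq_zero.1 hx
  have hIu := intervalIntegrable_of_Ioo hR hu₂
  have hIv := intervalIntegrable_of_Ioo hR hv₂
  have hII : ∀ {g : ℝ → ℝ}, ContinuousOn g (Icc (-R) R) → IntervalIntegrable g volume (-R) R :=
    fun hg => ContinuousOn.intervalIntegrable (by rwa [uIcc_of_le (by linarith)])
  have hIu₁ := hII (continuousOn_of_primitive hR hIu hu₁)
  have hIv₁ := hII (continuousOn_of_primitive hR hIv hv₁)
  obtain ⟨h1, h2⟩ := key hIv₁ hIu₁ hv hu huv
  obtain ⟨h3, h4⟩ := key hIv hIu hv₁ hu₁ h2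
  exact ⟨fun x hx => ⟨h1 x hx, h3 x hx⟩, h4⟩

end Uniqueness

/-! ### Fourier inversion for integrable and square-integrable functions -/

section Fourier

open FourierTransform

lemma continuous_fourier_of_integrable {f : ℝ → ℂ} (hf : Integrable f) : Continuous (𝓕 f) :=
  VectorFourier.fourierIntegral_continuous Real.continuous_fourierChar (by fun_prop) hf

lemma continuous_fourierInv_of_integrable {f : ℝ → ℂ} (hf : Integrable f) : Continuous (𝓕⁻ f) := by
  rw [Real.fourierInv_eq_fourier_comp_neg]
  exact continuous_fourier_of_integrable hf.comp_neg

/-- Moving the transform onto the test function is what identifies the distributional `L²` transform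
with the Fourier integral. -/
lemma integral_fourier_smul_eq_of_integrable {f g : ℝ → ℂ} (hf : Integrable f) (hg : Integrable g) :
    ∫ ξ, 𝓕 f ξ • g ξ = ∫ x, f x • 𝓕 g x := by
  have := VectorFourier.integral_fourierIntegral_smul_eq_flip (L := innerₗ ℝ)
    Real.continuous_fourierChar (by fun_prop) hf hg
  rwa [flip_innerₗ] at this

lemma integral_fourierInv_smul_eq_of_integrable {f g : ℝ → ℂ} (hf : Integrable f)
    (hg : Integrable g) : ∫ ξ, 𝓕⁻ f ξ • g ξ = ∫ x, f x • 𝓕⁻ g x := by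
  have h1 : 𝓕⁻ f = fun ξ => 𝓕 f (-ξ) := funext fun ξ => Real.fourierInv_eq_fourier_neg f ξ
  rw [h1, Real.fourierInv_eq_fourier_comp_neg g,
    ← integral_fourier_smul_eq_of_integrable hf hg.comp_neg,
    ← integral_neg_eq_self (fun ξ => 𝓕 f ξ • g (-ξ))]
  simp

/-- Smooth compactly supported functions are Schwartz functions and already separate locally
integrable functions up to null sets. -/
lemma lp_ae_eq_of_integral_schwartz {V : Lp ℂ 2 (volume : Measure ℝ)} {G : ℝ → ℂ}
    (hG : Continuous G)
    (h : ∀ φ : 𝓢(ℝ, ℂ), (V : 𝓢'(ℝ, ℂ)) φ = ∫ x, φ x • G x) : ∀ᵐ x, V x = G x := by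
  refine ae_eq_of_integral_contDiff_smul_eq ((Lp.memLp V).locallyIntegrable one_le_two)
    hG.locallyIntegrable fun g hg hgc => ?_
  have hg₁ : HasCompactSupport (Complex.ofRealCLM ∘ g) := hgc.comp_left rfl
  have hg₂ : ContDiff ℝ (⊤ : ℕ∞) (Complex.ofRealCLM ∘ g) := by fun_prop
  simpa using h (hg₁.toSchwartzMap hg₂)

/-- The `L²` Fourier transform of an integrable function is given by the Fourier integral. -/
lemma lp_fourier_ae_eq (f : Lp ℂ 2 (volume : Measure ℝ)) (hf : Integrable f) :
    ∀ᵐ x, (𝓕 f : Lp ℂ 2 (volume : Measure ℝ)) x = 𝓕 (f : ℝ → ℂ) x := by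
  refine lp_ae_eq_of_integral_schwartz (continuous_fourier_of_integrable hf) fun φ => ?_
  rw [← Lp.fourier_toTemperedDistribution_eq, TemperedDistribution.fourier_apply,
    Lp.toTemperedDistribution_apply, SchwartzMap.fourier_coe]
  exact integral_fourier_smul_eq_of_integrable φ.integrable hf

/-- The inverse `L²` Fourier transform of an integrable function is given by the Fourier
integral. -/
lemma lp_fourierInv_ae_eq (f : Lp ℂ 2 (volume : Measure ℝ)) (hf : Integrable f) :
    ∀ᵐ x, (𝓕⁻ f : Lp ℂ 2 (volume : Measure ℝ)) x = 𝓕⁻ (f : ℝ → ℂ) x := by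
  refine lp_ae_eq_of_integral_schwartz (continuous_fourierInv_of_integrable hf) fun φ => ?_
  rw [← Lp.fourierInv_toTemperedDistribution_eq, TemperedDistribution.fourierInv_apply,
    Lp.toTemperedDistribution_apply, SchwartzMap.fourierInv_coe]
  exact integral_fourierInv_smul_eq_of_integrable φ.integrable hf

lemma norm_fourierInv_le {f : ℝ → ℂ} (x : ℝ) : ‖𝓕⁻ f x‖ ≤ ∫ ξ, ‖f ξ‖ := by
  rw [Real.fourierInv_eq]
  refine (norm_integral_le_integral_norm _).trans (le_of_eq ?_)
  simp

lemma fourierInv_hasDerivAt {f : ℝ → ℂ} (hf : Integrable f) (hf' : Integrable fun ξ : ℝ => ξ • f ξ)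
    (x : ℝ) :
    HasDerivAt (𝓕⁻ f) (𝓕⁻ (fun ξ : ℝ => (2 * Real.pi * Complex.I * ξ) * f ξ) x) x := by
  rw [Real.fourierInv_eq_fourier_comp_neg, Real.fourierInv_eq_fourier_comp_neg]
  have h2 : Integrable fun ξ : ℝ => ξ • f (-ξ) := by
    have := hf'.comp_neg.neg
    refine this.congr (ae_of_all _ fun ξ => ?_)
    simp
  convert! Real.hasDerivAt_fourier hf.comp_neg h2 x using 3
  simp

lemma fourierInv_contDiff {f : ℝ → ℂ} (hf : ∀ n : ℕ, Integrable fun ξ : ℝ => ξ ^ n • f ξ) :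
    ContDiff ℝ (⊤ : ℕ∞) (𝓕⁻ f) := by
  rw [Real.fourierInv_eq_fourier_comp_neg]
  refine Real.contDiff_fourier fun n _ => ?_
  have := (hf n).norm.comp_neg
  simpa [norm_smul] using this

lemma iteratedDeriv_fourierInv {f : ℝ → ℂ} (hf : ∀ n : ℕ, Integrable fun ξ : ℝ => ξ ^ n • f ξ)
    (n : ℕ) : iteratedDeriv n (𝓕⁻ f) =
      𝓕⁻ (fun ξ : ℝ => (2 * Real.pi * Complex.I * ξ) ^ n * f ξ) := by
  rw [Real.fourierInv_eq_fourier_comp_neg, Real.fourierInv_eq_fourier_comp_neg,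
    Real.iteratedDeriv_fourier (N := ⊤) ?_ le_top]
  · simp
  · intro n _
    have := ((hf n).comp_neg).smul ((-1 : ℝ) ^ n)
    refine this.congr (ae_of_all _ fun ξ => ?_)
    simp only [smul_smul, Pi.smul_apply, ← mul_pow, neg_mul, one_mul, neg_neg]

lemma iteratedDeriv_re {n : ℕ} : ∀ {f : ℝ → ℂ}, ContDiff ℝ (⊤ : ℕ∞) f →
    iteratedDeriv n (fun x => (f x).re) = fun x => (iteratedDeriv n f x).re := by
  induction n with
  | zero => intro f _; simp
  | succ n ih =>
    intro f hf
    have hf' : ContDiff ℝ (⊤ : ℕ∞) (deriv f) := by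
      rw [contDiff_infty_iff_deriv] at hf; exact hf.2
    rw [iteratedDeriv_succ', iteratedDeriv_succ', ← ih hf']
    congr 1
    funext x
    have h := (hf.differentiable (by simp) x).hasDerivAt
    exact (Complex.reCLM.hasFDerivAt.comp_hasDerivAt x h).deriv

end Fourier

end RFM

/-! ### Spectra of Sobolev functions -/

namespace RFM

open FourierTransform

lemma lp_eq_of_toTemperedDistribution_eq {f g : Lp ℂ 2 (volume : Measure ℝ)}
    (h : (f : 𝓢'(ℝ, ℂ)) = g) : f = g := by
  have := Lp.ker_toTemperedDistributionCLM_eq_bot (F := ℂ) (μ := (volume : Measure ℝ)) (p := 2)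
  rw [LinearMap.ker_eq_bot] at this
  exact this h

/-- The Fourier transform of a function of the Sobolev class of order `s`. -/
lemma exists_spectrum {s : ℝ} (hs : 0 ≤ s) {U : Lp ℂ 2 (volume : Measure ℝ)}
    (hU : TemperedDistribution.MemSobolev s 2 (U : 𝓢'(ℝ, ℂ))) :
    ∃ f' : Lp ℂ 2 (volume : Measure ℝ), ∀ᵐ ξ : ℝ, (𝓕 U : Lp ℂ 2 (volume : Measure ℝ)) ξ =
      ((1 + ‖ξ‖ ^ 2) ^ (-s / 2) : ℝ) * f' ξ := by
  obtain ⟨f', hf'⟩ := TemperedDistribution.memSobolev_iff_exists_smulLeftCLM_fourier.1 hU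
  have hg : MemLp (fun ξ : ℝ => (((1 + ‖ξ‖ ^ 2) ^ (-s / 2) : ℝ) : ℂ)) ∞ volume := by
    refine memLp_top_of_bound (Continuous.aestronglyMeasurable ?_) 1 (ae_of_all _ fun ξ => ?_)
    · refine Complex.continuous_ofReal.comp (Continuous.rpow_const (by fun_prop) fun ξ => Or.inl ?_)
      positivity
    · rw [Complex.norm_real, Real.norm_of_nonneg (by positivity)]
      exact Real.rpow_le_one_of_one_le_of_nonpos (by nlinarith [sq_nonneg ‖ξ‖]) (by linarith)
  refine ⟨f', ?_⟩
  -- The Sobolev condition says that the weighted transform is `f'`; multiplying by the reciprocal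
  -- weight, a bounded function, recovers the transform as an element of `L²`.
  have key : 𝓕 U = hg.toLp _ • f' := by
    refine lp_eq_of_toTemperedDistribution_eq ?_
    rw [Lp.toTemperedDistribution_smul_eq (by fun_prop), ← hf',
      TemperedDistribution.smulLeftCLM_smulLeftCLM_apply (by fun_prop) (by fun_prop),
      ← Lp.fourier_toTemperedDistribution_eq]
    convert! (TemperedDistribution.smulLeftCLM_const 1 (𝓕 (U : 𝓢'(ℝ, ℂ)))).symm using 1
    · simp
    · congr
      ext x
      rw [Pi.mul_apply]
      norm_cast
      rw [← Real.rpow_add (by positivity)]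
      ring_nf
      simp
  rw [key]
  filter_upwards [Lp.coeFn_lpSMul (r := 2) (hg.toLp _) f', hg.coeFn_toLp] with ξ h1 h2
  rw [h1, Pi.smul_apply', h2, smul_eq_mul]

/-- Beyond frequency `W`, the smoothness in excess of order `2` is traded for the factor `W ^ (2 -
s)`. -/
lemma weight_tail_le {s W ξ : ℝ} (hs : 2 ≤ s) (hW : 0 < W) (h : W < |ξ|) :
    (1 + ‖ξ‖ ^ 2) ^ ((2 - s) / 2) ≤ W ^ (2 - s) := by
  have h1 : W ^ 2 ≤ 1 + ‖ξ‖ ^ 2 := by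
    rw [Real.norm_eq_abs]
    nlinarith
  calc (1 + ‖ξ‖ ^ 2) ^ ((2 - s) / 2) ≤ (W ^ 2) ^ ((2 - s) / 2) :=
        Real.rpow_le_rpow_of_nonpos (by positivity) h1 (by linarith)
    _ = W ^ (2 - s) := by
        rw [← Real.rpow_natCast_mul hW.le]
        congr 1
        push_cast
        ring

/-- Weighted bounds for the Fourier transform of a function of the Sobolev class of order `s`,
including the decay of its high frequency part. -/
lemma exists_spectral_bounds {s : ℝ} (hs : 2 ≤ s) {U : Lp ℂ 2 (volume : Measure ℝ)}
    (hU : TemperedDistribution.MemSobolev s 2 (U : 𝓢'(ℝ, ℂ))) :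
    ∃ g h : ℝ → ℝ, Integrable g ∧ MemLp h 2 volume ∧ (∀ ξ, 0 ≤ g ξ) ∧
      (∀ᵐ ξ : ℝ, (1 + |ξ|) * ‖(𝓕 U : Lp ℂ 2 (volume : Measure ℝ)) ξ‖ ≤ g ξ ∧
        ξ ^ 2 * ‖(𝓕 U : Lp ℂ 2 (volume : Measure ℝ)) ξ‖ ≤ h ξ ∧ ∀ W, 0 < W → W < |ξ| →
          (1 + |ξ|) * ‖(𝓕 U : Lp ℂ 2 (volume : Measure ℝ)) ξ‖ ≤ W ^ (2 - s) * g ξ ∧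
          ξ ^ 2 * ‖(𝓕 U : Lp ℂ 2 (volume : Measure ℝ)) ξ‖ ≤ W ^ (2 - s) * h ξ) := by
  obtain ⟨f', hf'⟩ := exists_spectrum (by linarith) hU
  have hf2 : MemLp (fun ξ => ‖f' ξ‖) 2 volume := (Lp.memLp f').norm
  have hw : MemLp (fun ξ : ℝ => (1 + ‖ξ‖ ^ 2) ^ (-1 / 2 : ℝ)) 2 volume := by
    have hc : Continuous fun ξ : ℝ => (1 + ‖ξ‖ ^ 2) ^ (-1 / 2 : ℝ) :=
      Continuous.rpow_const (by fun_prop) fun ξ => Or.inl (by positivity)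
    rw [memLp_two_iff_integrable_sq hc.aestronglyMeasurable]
    have := integrable_rpow_neg_one_add_norm_sq (E := ℝ) (μ := volume) (r := 2) (by simp)
    refine this.congr (ae_of_all _ fun ξ => ?_)
    simp only
    rw [← Real.rpow_mul_natCast (by positivity)]
    norm_num
  -- The majorant `g` is integrable as a product of two `L²` functions, since `(1 + ξ²)^(-1/2)` is
  -- square integrable in dimension one. The factor `2` comes from `1 + |ξ| ≤ 2 √(1 + ξ²)`.
  refine ⟨fun ξ => 2 * ((1 + ‖ξ‖ ^ 2) ^ (-1 / 2 : ℝ) * ‖f' ξ‖), fun ξ => ‖f' ξ‖,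
    (hw.integrable_mul hf2).const_mul 2, hf2, fun ξ => by positivity, ?_⟩
  filter_upwards [hf'] with ξ hξ
  set A : ℝ := 1 + ‖ξ‖ ^ 2 with hA
  have hA1 : 1 ≤ A := by nlinarith [sq_nonneg ‖ξ‖]
  have hA0 : 0 < A := by linarith
  have hn : ‖(𝓕 U : Lp ℂ 2 (volume : Measure ℝ)) ξ‖ = A ^ (-s / 2) * ‖f' ξ‖ := by
    rw [hξ, norm_mul, Complex.norm_real, Real.norm_of_nonneg (by positivity)]
  have h1 : 1 + |ξ| ≤ 2 * A ^ (1 / 2 : ℝ) := by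
    rw [← Real.sqrt_eq_rpow]
    have e1 : 1 ≤ √A := Real.one_le_sqrt.2 hA1
    have e2 : |ξ| ≤ √A := Real.le_sqrt_of_sq_le (by rw [hA, Real.norm_eq_abs]; linarith)
    linarith
  have h2 : ξ ^ 2 ≤ A := by rw [hA, Real.norm_eq_abs, sq_abs]; linarith
  have p1 : A ^ (1 / 2 : ℝ) * A ^ (-s / 2) = A ^ ((2 - s) / 2) * A ^ (-1 / 2 : ℝ) := by
    rw [← Real.rpow_add hA0, ← Real.rpow_add hA0]
    congr 1; ring
  have p2 : A * A ^ (-s / 2) = A ^ ((2 - s) / 2) := by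
    nth_rewrite 1 [← Real.rpow_one A]
    rw [← Real.rpow_add hA0]
    congr 1; ring
  have b1 : (1 + |ξ|) * ‖(𝓕 U : Lp ℂ 2 (volume : Measure ℝ)) ξ‖ ≤
      A ^ ((2 - s) / 2) * (2 * (A ^ (-1 / 2 : ℝ) * ‖f' ξ‖)) := by
    rw [hn]
    calc (1 + |ξ|) * (A ^ (-s / 2) * ‖f' ξ‖)
        ≤ (2 * A ^ (1 / 2 : ℝ)) * (A ^ (-s / 2) * ‖f' ξ‖) := by gcongr
      _ = 2 * (A ^ (1 / 2 : ℝ) * A ^ (-s / 2)) * ‖f' ξ‖ := by ring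
      _ = _ := by rw [p1]; ring
  have b2 : ξ ^ 2 * ‖(𝓕 U : Lp ℂ 2 (volume : Measure ℝ)) ξ‖ ≤ A ^ ((2 - s) / 2) * ‖f' ξ‖ := by
    rw [hn]
    calc ξ ^ 2 * (A ^ (-s / 2) * ‖f' ξ‖) ≤ A * (A ^ (-s / 2) * ‖f' ξ‖) := by gcongr
      _ = _ := by rw [← mul_assoc, p2]
  have hle : A ^ ((2 - s) / 2) ≤ 1 := Real.rpow_le_one_of_one_le_of_nonpos hA1 (by linarith)
  refine ⟨b1.trans (mul_le_of_le_one_left (by positivity) hle),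
    b2.trans (mul_le_of_le_one_left (by positivity) hle), fun W hW hWξ => ?_⟩
  have ht := weight_tail_le hs hW hWξ
  exact ⟨b1.trans (by gcongr), b2.trans (by gcongr)⟩

/-- Integrating an inverse `L²` Fourier transform over an interval. -/
lemma intervalIntegral_fourierInv {m : Lp ℂ 2 (volume : Measure ℝ)} {v : ℝ → ℂ}
    (hm : ∀ᵐ ξ : ℝ, m ξ = (2 * Real.pi * Complex.I * ξ) * v ξ) (hv : Integrable v) {a b : ℝ}
    (hab : a ≤ b) :
    ∫ x in a..b, (𝓕⁻ m : Lp ℂ 2 (volume : Measure ℝ)) x = 𝓕⁻ v b - 𝓕⁻ v a := by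
  have hI : MeasurableSet (Ioc a b) := measurableSet_Ioc
  have hIμ : volume (Ioc a b) ≠ ∞ := by simp
  set χ : Lp ℂ 2 (volume : Measure ℝ) := indicatorConstLp 2 hI hIμ 1 with hχ
  have hχae : ∀ᵐ x, χ x = (Ioc a b).indicator (fun _ => (1 : ℂ)) x := indicatorConstLp_coeFn
  have hχint : Integrable χ := by
    refine Integrable.congr ?_ (hχae.mono fun x hx => hx.symm)
    exact (integrable_indicator_iff hI).2 (integrableOn_const hIμ)
  -- Since `m` is only in `L²`, pointwise inversion is unavailable. The integral is instead paired
  -- with the indicator of the interval and moved to the frequency side by Plancherel, where the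
  -- factor `2πiξ` cancels against the transform of the indicator.
  rw [intervalIntegral.integral_of_le hab,
    ← L2.inner_indicatorConstLp_one (𝕜 := ℂ) hI hIμ (𝓕⁻ m), ← Lp.inner_fourier_eq,
    fourier_fourierInv_eq, L2.inner_def, Real.fourierInv_eq', Real.fourierInv_eq']
  have hexp : ∀ y : ℝ, Integrable fun ξ : ℝ =>
      Complex.exp (↑(2 * Real.pi * inner ℝ ξ y) * Complex.I) • v ξ := by
    intro y
    refine hv.bdd_mul (c := 1) (Continuous.aestronglyMeasurable (by fun_prop))
      (ae_of_all _ fun ξ => ?_)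
    rw [Complex.norm_exp_ofReal_mul_I]
  rw [← integral_sub (hexp b) (hexp a)]
  refine integral_congr_ae ?_
  filter_upwards [lp_fourier_ae_eq χ hχint, hm] with ξ h1 h2
  rw [← hχ, h1, h2, Real.fourier_real_eq_integral_exp_smul,
    integral_congr_ae (hχae.mono fun x hx => by rw [hx]),
    show (fun x : ℝ => Complex.exp (↑(-2 * Real.pi * x * ξ) * Complex.I) •
      (Ioc a b).indicator (fun _ => (1 : ℂ)) x) = (Ioc a b).indicator
        (fun x : ℝ => Complex.exp (↑(-2 * Real.pi * x * ξ) * Complex.I)) from by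
      funext x; by_cases hx : x ∈ Ioc a b <;> simp [hx],
    integral_indicator hI, RCLike.inner_apply, ← integral_conj]
  have hconj : ∀ x : ℝ, (starRingEnd ℂ) (Complex.exp (↑(-2 * Real.pi * x * ξ) * Complex.I)) =
      Complex.exp (2 * Real.pi * Complex.I * ξ * x) := by
    intro x
    rw [← Complex.exp_conj, map_mul, Complex.conj_I, Complex.conj_ofReal]
    congr 1
    push_cast
    ring
  simp only [hconj]
  rw [← intervalIntegral.integral_of_le hab]
  have hFTC : ∫ x in a..b, 2 * Real.pi * Complex.I * ξ * Complex.exp (2 * Real.pi * Complex.I * ξ * x) =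
      Complex.exp (2 * Real.pi * Complex.I * ξ * b) - Complex.exp (2 * Real.pi * Complex.I * ξ * a) := by
    refine intervalIntegral.integral_eq_sub_of_hasDerivAt (f := fun x : ℝ =>
      Complex.exp (2 * Real.pi * Complex.I * ξ * x)) (fun x _ => ?_)
      (Continuous.intervalIntegrable (by fun_prop) _ _)
    have h0 : HasDerivAt (fun x : ℝ => 2 * Real.pi * Complex.I * ξ * (x : ℂ))
        (2 * Real.pi * Complex.I * ξ) x := by
      simpa using (HasDerivAt.ofReal_comp (hasDerivAt_id x)).const_mul (2 * Real.pi * Complex.I * ξ : ℂ)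
    exact h0.cexp.congr_deriv (by ring)
  rw [intervalIntegral.integral_const_mul] at hFTC
  have e : ∀ y : ℝ, Complex.exp (↑(2 * Real.pi * inner ℝ ξ y) * Complex.I) =
      Complex.exp (2 * Real.pi * Complex.I * ξ * y) := by
    intro y
    congr 1
    simp only [RCLike.inner_apply, conj_trivial]
    push_cast
    ring
  rw [e, e, smul_eq_mul, smul_eq_mul, ← sub_mul, ← hFTC]
  ring

end RFM

/-! ### Band-limited approximation -/

namespace RFM

open FourierTransform

lemma lp_norm_sq_eq_integral (f : Lp ℂ 2 (volume : Measure ℝ)) : ‖f‖ ^ 2 = ∫ x, ‖f x‖ ^ 2 := by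
  rw [← real_inner_self_eq_norm_sq, L2.inner_def]
  simp only [real_inner_self_eq_norm_sq]

lemma lp_norm_fourierInv (f : Lp ℂ 2 (volume : Measure ℝ)) : ‖𝓕⁻ f‖ = ‖f‖ := by
  rw [← Lp.norm_fourier_eq (𝓕⁻ f), fourier_fourierInv_eq]

lemma norm_fourierInv_sub_le {f g : ℝ → ℂ} (hf : Integrable f) (hg : Integrable g) (x : ℝ) :
    ‖𝓕⁻ f x - 𝓕⁻ g x‖ ≤ ∫ ξ, ‖f ξ - g ξ‖ := by
  have hexp : ∀ {f : ℝ → ℂ}, Integrable f → Integrable fun ξ : ℝ =>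
      Complex.exp (↑(2 * Real.pi * inner ℝ ξ x) * Complex.I) • f ξ := by
    intro f hf
    refine hf.bdd_mul (c := 1) (Continuous.aestronglyMeasurable (by fun_prop))
      (ae_of_all _ fun ξ => ?_)
    rw [Complex.norm_exp_ofReal_mul_I]
  have : 𝓕⁻ f x - 𝓕⁻ g x = 𝓕⁻ (fun ξ => f ξ - g ξ) x := by
    rw [Real.fourierInv_eq', Real.fourierInv_eq', Real.fourierInv_eq',
      ← integral_sub (hexp hf) (hexp hg)]
    simp only [smul_sub]
  rw [this]
  exact norm_fourierInv_le x

lemma fourierInv_congr_ae {f g : ℝ → ℂ} (h : f =ᵐ[volume] g) : 𝓕⁻ f = 𝓕⁻ g := by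
  funext x
  rw [Real.fourierInv_eq, Real.fourierInv_eq]
  refine integral_congr_ae ?_
  filter_upwards [h] with ξ hξ
  rw [hξ]

/-- Multiplication by the symbol `(2πiξ)ⁿ` of the `n`-th derivative. -/
def symbolMul (n : ℕ) (f : ℝ → ℂ) (ξ : ℝ) : ℂ := (2 * Real.pi * Complex.I * ξ) ^ n * f ξ

lemma norm_symbolMul (n : ℕ) (f : ℝ → ℂ) (ξ : ℝ) :
    ‖symbolMul n f ξ‖ = (2 * Real.pi) ^ n * (|ξ| ^ n * ‖f ξ‖) := by
  have : ‖(2 * Real.pi * Complex.I * ξ : ℂ)‖ = 2 * Real.pi * |ξ| := by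
    simp [abs_of_pos Real.pi_pos]
  rw [symbolMul, norm_mul, norm_pow, this, mul_pow, mul_assoc]

lemma aestronglyMeasurable_symbolMul (n : ℕ) {f : ℝ → ℂ} (hf : AEStronglyMeasurable f volume) :
    AEStronglyMeasurable (symbolMul n f) volume := by
  unfold symbolMul
  exact (Continuous.aestronglyMeasurable (by fun_prop)).mul hf

lemma symbolMul_zero (f : ℝ → ℂ) : symbolMul 0 f = f := by
  funext ξ
  simp [symbolMul]

/-- The restriction of a spectrum to the frequencies of modulus at most `W`. -/
def lowFreq (W : ℝ) (v : ℝ → ℂ) : ℝ → ℂ := {ξ : ℝ | |ξ| ≤ W}.indicator v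

section LowFreq

variable {W : ℝ} {v : ℝ → ℂ}

lemma norm_lowFreq_le (W : ℝ) (v : ℝ → ℂ) (ξ : ℝ) : ‖lowFreq W v ξ‖ ≤ ‖v ξ‖ :=
  norm_indicator_le_norm_self _ _

lemma aestronglyMeasurable_lowFreq (hv : AEStronglyMeasurable v volume) :
    AEStronglyMeasurable (lowFreq W v) volume :=
  hv.indicator (isClosed_le continuous_abs continuous_const).measurableSet

lemma pow_mul_norm_lowFreq_le (hW : 0 ≤ W) (n : ℕ) (ξ : ℝ) :
    |ξ| ^ n * ‖lowFreq W v ξ‖ ≤ W ^ n * ‖v ξ‖ := by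
  by_cases hξ : |ξ| ≤ W
  · have := norm_lowFreq_le W v ξ
    gcongr
  · rw [lowFreq, indicator_of_notMem (by exact hξ), norm_zero, mul_zero]
    positivity

lemma integrable_pow_smul_lowFreq (hW : 0 ≤ W) (hv : Integrable v) (n : ℕ) :
    Integrable fun ξ : ℝ => ξ ^ n • lowFreq W v ξ := by
  refine (hv.norm.const_mul (W ^ n)).mono' ((continuous_pow n).aestronglyMeasurable.smul
    (aestronglyMeasurable_lowFreq hv.1)) (ae_of_all _ fun ξ => ?_)
  rw [norm_smul, norm_pow, Real.norm_eq_abs]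
  exact pow_mul_norm_lowFreq_le hW n ξ

lemma integrable_symbolMul_lowFreq (hW : 0 ≤ W) (hv : Integrable v) (n : ℕ) :
    Integrable (symbolMul n (lowFreq W v)) := by
  refine (hv.norm.const_mul ((2 * Real.pi) ^ n * W ^ n)).mono' (aestronglyMeasurable_symbolMul n
    (aestronglyMeasurable_lowFreq hv.1)) (ae_of_all _ fun ξ => ?_)
  rw [norm_symbolMul, mul_assoc]
  have := pow_mul_norm_lowFreq_le (v := v) hW n ξ
  gcongr

/-- The real part of the function with spectrum `v` cut off at frequency `W`. -/
def bandLimit (W : ℝ) (v : ℝ → ℂ) (x : ℝ) : ℝ := (𝓕⁻ (lowFreq W v) x).re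

lemma contDiff_bandLimit (hW : 0 ≤ W) (hv : Integrable v) :
    ContDiff ℝ (⊤ : ℕ∞) (bandLimit W v) :=
  Complex.reCLM.contDiff.comp (fourierInv_contDiff (integrable_pow_smul_lowFreq hW hv))

lemma iteratedDeriv_bandLimit (hW : 0 ≤ W) (hv : Integrable v) (n : ℕ) :
    iteratedDeriv n (bandLimit W v) = fun x => (𝓕⁻ (symbolMul n (lowFreq W v)) x).re := by
  unfold bandLimit
  rw [iteratedDeriv_re (fourierInv_contDiff (integrable_pow_smul_lowFreq hW hv)),
    iteratedDeriv_fourierInv (integrable_pow_smul_lowFreq hW hv)]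
  rfl

lemma deriv_bandLimit (hW : 0 ≤ W) (hv : Integrable v) :
    deriv (bandLimit W v) = fun x => (𝓕⁻ (symbolMul 1 (lowFreq W v)) x).re := by
  rw [← iteratedDeriv_bandLimit hW hv, iteratedDeriv_one]

lemma deriv_deriv_bandLimit (hW : 0 ≤ W) (hv : Integrable v) :
    deriv (deriv (bandLimit W v)) = fun x => (𝓕⁻ (symbolMul 2 (lowFreq W v)) x).re := by
  rw [← iteratedDeriv_bandLimit hW hv, iteratedDeriv_succ, iteratedDeriv_one]

lemma abs_iteratedDeriv_bandLimit_le (hW : 0 ≤ W) (hv : Integrable v) (n : ℕ) (x : ℝ) :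
    |iteratedDeriv n (bandLimit W v) x| ≤ (∫ ξ, ‖v ξ‖) * (2 * Real.pi * W) ^ n := by
  rw [iteratedDeriv_bandLimit hW hv]
  calc _ ≤ ‖𝓕⁻ (symbolMul n (lowFreq W v)) x‖ := Complex.abs_re_le_norm _
    _ ≤ ∫ ξ : ℝ, ‖symbolMul n (lowFreq W v) ξ‖ := norm_fourierInv_le x
    _ ≤ ∫ ξ, (2 * Real.pi * W) ^ n * ‖v ξ‖ := by
        refine integral_mono (integrable_symbolMul_lowFreq hW hv n).norm (hv.norm.const_mul _) ?_
        intro ξ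
        have := pow_mul_norm_lowFreq_le (v := v) hW n ξ
        simp only
        rw [norm_symbolMul, mul_pow (2 * Real.pi) W, mul_assoc]
        gcongr
    _ = _ := by rw [integral_const_mul, mul_comm]

lemma symbolMul_lowFreq_sub (n : ℕ) (ξ : ℝ) : ‖symbolMul n (lowFreq W v) ξ - symbolMul n v ξ‖ =
    if |ξ| ≤ W then 0 else (2 * Real.pi) ^ n * (|ξ| ^ n * ‖v ξ‖) := by
  split_ifs with h
  · rw [symbolMul, symbolMul, lowFreq, indicator_of_mem (by exact h), sub_self, norm_zero]
  · rw [symbolMul, lowFreq, indicator_of_notMem (by exact h), mul_zero, zero_sub, norm_neg,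
      norm_symbolMul]

end LowFreq

lemma integral_re_sq_le {μ : Measure ℝ} {f : ℝ → ℂ} (hf : Integrable (fun x => ‖f x‖ ^ 2) μ) :
    ∫ x, (f x).re ^ 2 ∂μ ≤ ∫ x, ‖f x‖ ^ 2 ∂μ := by
  refine integral_mono_of_nonneg (ae_of_all _ fun x => sq_nonneg _) hf (ae_of_all _ fun x => ?_)
  simp only
  rw [← sq_abs]
  gcongr
  exact Complex.abs_re_le_norm _

/-- Weighted bounds on a spectrum, with decay of order `2 - s` at high frequencies. -/
structure SpectralBound (s : ℝ) (v : ℝ → ℂ) (g h : ℝ → ℝ) : Prop where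
  measurable : AEStronglyMeasurable v volume
  integrable : Integrable g
  memLp : MemLp h 2 volume
  nonneg : ∀ ξ, 0 ≤ g ξ
  bound : ∀ᵐ ξ : ℝ, (1 + |ξ|) * ‖v ξ‖ ≤ g ξ ∧ ξ ^ 2 * ‖v ξ‖ ≤ h ξ ∧ ∀ W, 0 < W → W < |ξ| →
    (1 + |ξ|) * ‖v ξ‖ ≤ W ^ (2 - s) * g ξ ∧ ξ ^ 2 * ‖v ξ‖ ≤ W ^ (2 - s) * h ξ

namespace SpectralBound

variable {s : ℝ} {v : ℝ → ℂ} {g h : ℝ → ℝ}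

lemma integrable_spectrum (H : SpectralBound s v g h) : Integrable v :=
  H.integrable.mono' H.measurable (H.bound.mono fun ξ hξ => by
    refine le_trans ?_ hξ.1
    nlinarith [norm_nonneg (v ξ), mul_nonneg (abs_nonneg ξ) (norm_nonneg (v ξ))])

lemma integrable_smul_spectrum (H : SpectralBound s v g h) : Integrable fun ξ : ℝ => ξ • v ξ := by
  refine H.integrable.mono' (continuous_id.aestronglyMeasurable.smul H.measurable)
    (H.bound.mono fun ξ hξ => ?_)
  rw [norm_smul, Real.norm_eq_abs]
  refine le_trans ?_ hξ.1
  nlinarith [norm_nonneg (v ξ)]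

lemma integrable_symbolMul_one (H : SpectralBound s v g h) : Integrable (symbolMul 1 v) := by
  refine (H.integrable_smul_spectrum.const_mul (2 * Real.pi * Complex.I)).congr
    (ae_of_all _ fun ξ => ?_)
  simp only [symbolMul, Complex.real_smul]
  ring

lemma memLp_symbolMul_two (H : SpectralBound s v g h) : MemLp (symbolMul 2 v) 2 volume := by
  refine H.memLp.of_le_mul (aestronglyMeasurable_symbolMul 2 H.measurable) (c := (2 * Real.pi) ^ 2)
    (H.bound.mono fun ξ hξ => ?_)
  rw [norm_symbolMul, sq_abs]
  gcongr
  exact hξ.2.1.trans (le_abs_self _)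

/-- The cutoff changes nothing below frequency `W`; above it the whole spectrum is the error and the
high-frequency decay applies. The last bound is squared because it is used in `L²`, the first two in
`L¹`. -/
lemma tail (H : SpectralBound s v g h) {W : ℝ} (hW : 0 < W) :
    ∀ᵐ ξ : ℝ, ‖lowFreq W v ξ - v ξ‖ ≤ W ^ (2 - s) * g ξ ∧
      ‖symbolMul 1 (lowFreq W v) ξ - symbolMul 1 v ξ‖ ≤ W ^ (2 - s) * (2 * Real.pi) * g ξ ∧
      ‖symbolMul 2 (lowFreq W v) ξ - symbolMul 2 v ξ‖ ^ 2 ≤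
        ((2 * Real.pi) ^ 2) ^ 2 * (W ^ (2 - s)) ^ 2 * h ξ ^ 2 := by
  filter_upwards [H.bound] with ξ hξ
  have e0 := symbolMul_lowFreq_sub (W := W) (v := v) 0 ξ
  rw [symbolMul_zero, symbolMul_zero] at e0
  rw [e0, symbolMul_lowFreq_sub, symbolMul_lowFreq_sub]
  have hgξ := H.nonneg ξ
  split_ifs with hle
  · exact ⟨by positivity, by positivity, (zero_pow two_ne_zero).le.trans (by positivity)⟩
  · obtain ⟨t1, t2⟩ := hξ.2.2 W hW (not_le.1 hle)
    have hn := norm_nonneg (v ξ)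
    have ha := mul_nonneg (abs_nonneg ξ) hn
    refine ⟨?_, ?_, ?_⟩
    · simp only [pow_zero, one_mul]
      linarith
    · rw [pow_one, pow_one]
      calc 2 * Real.pi * (|ξ| * ‖v ξ‖) ≤ 2 * Real.pi * (W ^ (2 - s) * g ξ) :=
            mul_le_mul_of_nonneg_left (by linarith) (by positivity)
        _ = _ := by ring
    · rw [sq_abs]
      calc _ ≤ ((2 * Real.pi) ^ 2 * (W ^ (2 - s) * h ξ)) ^ 2 := by gcongr
        _ = _ := by ring

end SpectralBound

/-- A function of class `H²` on `(-R, R)` whose spectrum is bounded as in `SpectralBound` is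
obtained, together with its derivatives, by Fourier inversion. -/
lemma fourier_representation {s R : ℝ} (hR : 0 < R) {u u₁ u₂ : ℝ → ℝ}
    (hu₂ : MemLp u₂ 2 (volume.restrict (Ioo (-R) R)))
    (hu : ∀ x ∈ Icc (-R) R, u x = u (-R) + ∫ y in (-R)..x, u₁ y)
    (hu₁ : ∀ x ∈ Icc (-R) R, u₁ x = u₁ (-R) + ∫ y in (-R)..x, u₂ y)
    {v : ℝ → ℂ} {g h : ℝ → ℝ} (H : SpectralBound s v g h)
    (huv : ∀ᵐ x ∂(volume.restrict (Ioo (-R) R)), 𝓕⁻ v x = (u x : ℂ)) :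
    (∀ x ∈ Icc (-R) R, (𝓕⁻ v x).re = u x ∧ (𝓕⁻ (symbolMul 1 v) x).re = u₁ x) ∧
      ∀ᵐ x ∂(volume.restrict (Ioo (-R) R)),
        ((𝓕⁻ (H.memLp_symbolMul_two.toLp _) : Lp ℂ 2 (volume : Measure ℝ)) x).re = u₂ x := by
  set V : Lp ℂ 2 (volume : Measure ℝ) := 𝓕⁻ (H.memLp_symbolMul_two.toLp _) with hV
  have hGd : ∀ x, HasDerivAt (𝓕⁻ v) (𝓕⁻ (symbolMul 1 v) x) x := fun x => by
    have := fourierInv_hasDerivAt H.integrable_spectrum H.integrable_smul_spectrum x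
    have e : symbolMul 1 v = fun ξ : ℝ => (2 * Real.pi * Complex.I * ξ) * v ξ := by
      funext ξ; rw [symbolMul, pow_one]
    rwa [e]
  have hG₁c : Continuous (𝓕⁻ (symbolMul 1 v)) :=
    continuous_fourierInv_of_integrable H.integrable_symbolMul_one
  have hVloc : LocallyIntegrable V volume := (Lp.memLp V).locallyIntegrable one_le_two
  have hVint : ∀ a b, IntervalIntegrable V volume a b := fun a b => by
    rw [intervalIntegrable_iff]
    exact (hVloc.integrableOn_isCompact isCompact_uIcc).mono_set uIoc_subset_uIcc
  -- The inverse transforms of `v`, `2πiξ v` and `(2πiξ)² v` form a second chain of primitives for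
  -- the same function, so their real parts must be `u`, `u₁` and `u₂`.
  refine derivatives_unique hR (v := fun x => (𝓕⁻ v x).re)
    (v₁ := fun x => (𝓕⁻ (symbolMul 1 v) x).re) (v₂ := fun x => (V x).re)
    (hu₂.integrable one_le_two)
    ((hVloc.integrableOn_isCompact (isCompact_Icc (a := -R) (b := R))).mono_set
      Ioo_subset_Icc_self).re hu hu₁ ?_ ?_ ?_
  · intro x _
    have := intervalIntegral.integral_eq_sub_of_hasDerivAt (a := -R) (b := x)
      (fun y _ => Complex.reCLM.hasFDerivAt.comp_hasDerivAt y (hGd y))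
      ((Complex.continuous_re.comp hG₁c).intervalIntegrable _ _)
    simp only [Complex.reCLM_apply, Function.comp_def] at this
    linarith
  · intro x hx
    have hm : ∀ᵐ ξ : ℝ, H.memLp_symbolMul_two.toLp _ ξ =
        (2 * Real.pi * Complex.I * ξ) * symbolMul 1 v ξ := by
      filter_upwards [H.memLp_symbolMul_two.coeFn_toLp] with ξ hξ
      rw [hξ, symbolMul, symbolMul]
      ring
    have h1 := intervalIntegral_fourierInv hm H.integrable_symbolMul_one hx.1
    have h2 := Complex.reCLM.intervalIntegral_comp_comm (hVint (-R) x)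
    simp only [Complex.reCLM_apply] at h2
    rw [h2, hV, h1, Complex.sub_re]
    ring
  · filter_upwards [huv] with x h1
    rw [h1, Complex.ofReal_re]

/-- The second derivative is only controlled in `L²`, so its error is measured by Plancherel. The
truncated spectrum is also integrable, which identifies its `L²` inverse transform with the
classical second derivative. -/
lemma integral_deriv_deriv_bandLimit_sub_le {s R : ℝ} {v : ℝ → ℂ} {g h : ℝ → ℝ}
    (H : SpectralBound s v g h) {W : ℝ} (hW : 0 < W) {u₂ : ℝ → ℝ}
    (hu₂ : ∀ᵐ x ∂(volume.restrict (Ioo (-R) R)),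
        ((𝓕⁻ (H.memLp_symbolMul_two.toLp _) : Lp ℂ 2 (volume : Measure ℝ)) x).re = u₂ x) :
    (∫ x in Ioo (-R) R, (deriv (deriv (bandLimit W v)) x - u₂ x) ^ 2) ≤
      ((2 * Real.pi) ^ 2) ^ 2 * (∫ ξ, h ξ ^ 2) * (W ^ (2 - s)) ^ 2 := by
  set V : Lp ℂ 2 (volume : Measure ℝ) := 𝓕⁻ (H.memLp_symbolMul_two.toLp _) with hV
  have hmi := integrable_symbolMul_lowFreq hW.le H.integrable_spectrum 2
  have hmWL : MemLp (symbolMul 2 (lowFreq W v)) 2 volume := by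
    refine H.memLp_symbolMul_two.of_le hmi.1 (ae_of_all _ fun ξ => ?_)
    have := norm_lowFreq_le W v ξ
    rw [norm_symbolMul, norm_symbolMul]
    gcongr
  set VW : Lp ℂ 2 (volume : Measure ℝ) := 𝓕⁻ (hmWL.toLp _) with hVW
  have hVWae : ∀ᵐ x, VW x = 𝓕⁻ (symbolMul 2 (lowFreq W v)) x := by
    have hi : Integrable (hmWL.toLp _) := hmi.congr hmWL.coeFn_toLp.symm
    have := lp_fourierInv_ae_eq _ hi
    rwa [fourierInv_congr_ae hmWL.coeFn_toLp] at this
  have hdiff : ∀ᵐ x ∂(volume.restrict (Ioo (-R) R)),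
      (deriv (deriv (bandLimit W v)) x - u₂ x) ^ 2 = ((VW - V : Lp ℂ 2 volume) x).re ^ 2 := by
    filter_upwards [hu₂, ae_restrict_of_ae hVWae, ae_restrict_of_ae (Lp.coeFn_sub VW V)]
      with x h1 h2 h3
    rw [h3, Pi.sub_apply, h2, Complex.sub_re, h1, deriv_deriv_bandLimit hW.le H.integrable_spectrum]
  have hnI : Integrable (fun x => ‖(VW - V : Lp ℂ 2 volume) x‖ ^ 2) :=
    (memLp_two_iff_integrable_sq_norm (Lp.aestronglyMeasurable _)).1 (Lp.memLp _)
  have hfin : ‖VW - V‖ ^ 2 ≤ ((2 * Real.pi) ^ 2) ^ 2 * (W ^ (2 - s)) ^ 2 * ∫ ξ, h ξ ^ 2 := by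
    have e1 : VW - V = 𝓕⁻ ((hmWL.sub H.memLp_symbolMul_two).toLp _) := by
      rw [hVW, hV, MemLp.toLp_sub hmWL H.memLp_symbolMul_two, sub_eq_add_neg, sub_eq_add_neg,
        fourierInv_add]
      congr 1
      simp
    rw [e1, lp_norm_fourierInv, lp_norm_sq_eq_integral, ← integral_const_mul]
    refine integral_mono_of_nonneg (ae_of_all _ fun ξ => by positivity)
      (H.memLp.integrable_sq.const_mul _) ?_
    filter_upwards [H.tail hW, (hmWL.sub H.memLp_symbolMul_two).coeFn_toLp] with ξ h1 h2
    rw [h2]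
    exact h1.2.2
  calc _ = ∫ x in Ioo (-R) R, ((VW - V : Lp ℂ 2 volume) x).re ^ 2 := integral_congr_ae hdiff
    _ ≤ ∫ x in Ioo (-R) R, ‖(VW - V : Lp ℂ 2 volume) x‖ ^ 2 := integral_re_sq_le hnI.integrableOn
    _ ≤ ∫ x, ‖(VW - V : Lp ℂ 2 volume) x‖ ^ 2 :=
        setIntegral_le_integral hnI (ae_of_all _ fun x => by positivity)
    _ = ‖VW - V‖ ^ 2 := (lp_norm_sq_eq_integral _).symm
    _ ≤ _ := hfin
    _ = _ := by ring

/-- Approximation of functions in `H^s` by band-limited functions. -/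
theorem exists_bandlimited_approx {s R : ℝ} (hR : 0 < R) (hs : 2 ≤ s) {u u₁ u₂ : ℝ → ℝ}
    (hu₂ : MemLp u₂ 2 (volume.restrict (Ioo (-R) R)))
    (hu : ∀ x ∈ Icc (-R) R, u x = u (-R) + ∫ y in (-R)..x, u₁ y)
    (hu₁ : ∀ x ∈ Icc (-R) R, u₁ x = u₁ (-R) + ∫ y in (-R)..x, u₂ y) (hmem : MemHs s R u) :
    ∃ C, 0 ≤ C ∧ ∀ W : ℝ, 0 < W → ∃ q : ℝ → ℝ, ContDiff ℝ (⊤ : ℕ∞) q ∧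
      (∀ j x, |iteratedDeriv j q x| ≤ C * (2 * Real.pi * W) ^ j) ∧
      (∀ x ∈ Icc (-R) R, (q x - u x) ^ 2 ≤ C * (W ^ (2 - s)) ^ 2 ∧
        (deriv q x - u₁ x) ^ 2 ≤ C * (W ^ (2 - s)) ^ 2) ∧
      (∫ x in Ioo (-R) R, (deriv (deriv q) x - u₂ x) ^ 2) ≤ C * (W ^ (2 - s)) ^ 2 := by
  obtain ⟨U, hU, hUu⟩ := hmem
  obtain ⟨g, h, hg, hh, hg0, hb⟩ := exists_spectral_bounds hs hU
  set v : Lp ℂ 2 (volume : Measure ℝ) := 𝓕 U with hvdef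
  have H : SpectralBound s v g h := ⟨Lp.aestronglyMeasurable v, hg, hh, hg0, hb⟩
  have hv := H.integrable_spectrum
  have hUG : ∀ᵐ x, U x = 𝓕⁻ (v : ℝ → ℂ) x := by
    have := lp_fourierInv_ae_eq v hv
    rwa [hvdef, fourierInv_fourier_eq] at this
  obtain ⟨hrep, hrep2⟩ := fourier_representation hR hu₂ hu hu₁ H (by
    filter_upwards [hUu, ae_restrict_of_ae hUG] with x h1 h2
    rw [← h2, h1])
  set I₀ := ∫ ξ, ‖v ξ‖
  set I₁ := ∫ ξ, g ξ
  set I₂ := ∫ ξ, h ξ ^ 2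
  have hI₀0 : 0 ≤ I₀ := integral_nonneg fun ξ => norm_nonneg _
  have hI₂0 : 0 ≤ I₂ := integral_nonneg fun ξ => sq_nonneg _
  have c0 : 0 ≤ I₁ ^ 2 := sq_nonneg _
  have c1 : 0 ≤ (2 * Real.pi * I₁) ^ 2 := sq_nonneg _
  have c2 : 0 ≤ ((2 * Real.pi) ^ 2) ^ 2 * I₂ := by positivity
  refine ⟨I₀ + I₁ ^ 2 + (2 * Real.pi * I₁) ^ 2 + ((2 * Real.pi) ^ 2) ^ 2 * I₂, by positivity,
    fun W hW => ⟨bandLimit W v, contDiff_bandLimit hW.le hv, fun j x => ?_, fun x hx => ?_, ?_⟩⟩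
  · refine (abs_iteratedDeriv_bandLimit_le hW.le hv j x).trans ?_
    gcongr
    linarith
  · obtain ⟨x0, x1⟩ := hrep x hx
    have hvW : Integrable (lowFreq W v) := by
      have := integrable_symbolMul_lowFreq hW.le hv 0
      rwa [symbolMul_zero] at this
    have hvW1 := integrable_symbolMul_lowFreq hW.le hv 1
    have b0 : |bandLimit W v x - u x| ≤ W ^ (2 - s) * I₁ := by
      rw [← x0, bandLimit, ← Complex.sub_re]
      refine (Complex.abs_re_le_norm _).trans ((norm_fourierInv_sub_le hvW hv x).trans ?_)
      rw [← integral_const_mul]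
      exact integral_mono_ae (hvW.sub hv).norm (hg.const_mul _)
        ((H.tail hW).mono fun ξ hξ => hξ.1)
    have b1 : |deriv (bandLimit W v) x - u₁ x| ≤ W ^ (2 - s) * (2 * Real.pi) * I₁ := by
      rw [deriv_bandLimit hW.le hv, ← x1, ← Complex.sub_re]
      refine (Complex.abs_re_le_norm _).trans
        ((norm_fourierInv_sub_le hvW1 H.integrable_symbolMul_one x).trans ?_)
      rw [← integral_const_mul]
      exact integral_mono_ae (hvW1.sub H.integrable_symbolMul_one).norm (hg.const_mul _)
        ((H.tail hW).mono fun ξ hξ => hξ.2.1)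
    constructor
    · rw [← sq_abs]
      calc _ ≤ (W ^ (2 - s) * I₁) ^ 2 := by gcongr
        _ = I₁ ^ 2 * (W ^ (2 - s)) ^ 2 := by ring
        _ ≤ _ := by gcongr; linarith
    · rw [← sq_abs]
      calc _ ≤ (W ^ (2 - s) * (2 * Real.pi) * I₁) ^ 2 := by gcongr
        _ = (2 * Real.pi * I₁) ^ 2 * (W ^ (2 - s)) ^ 2 := by ring
        _ ≤ _ := by gcongr; linarith
  · refine (integral_deriv_deriv_bandLimit_sub_le H hW hrep2).trans ?_
    gcongr
    linarith

end RFM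

/-! ### Smooth extensions and convergence rates -/

namespace RFM

section SmoothExtension

/-- A function which is smooth in a neighbourhood of `[-R, R]` agrees there with a smooth function
whose derivatives are all bounded. -/
lemma exists_bounded_smooth_extension {R ρ : ℝ} (hR : 0 < R) (hρ : 0 < ρ) {v : ℝ → ℝ}
    (hv : ContDiffOn ℝ (⊤ : ℕ∞) v (Ioo (-R - ρ) (R + ρ))) :
    ∃ q : ℝ → ℝ, ContDiff ℝ (⊤ : ℕ∞) q ∧ (∀ x ∈ Icc (-R) R, q x = v x) ∧
      ∀ j, ∃ B, ∀ x, |iteratedDeriv j q x| ≤ B := by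
  -- The cutoff is `1` on `[-R, R]` and vanishes for `|x| ≥ R + ρ/2`, strictly inside the domain of
  -- smoothness.
  set f : ContDiffBump (0 : ℝ) := ⟨R, R + ρ / 2, hR, by linarith⟩ with hf
  have hsmooth : ContDiff ℝ (⊤ : ℕ∞) fun x => f x * v x := by
    refine contDiff_iff_contDiffAt.2 fun x => ?_
    by_cases hx : x ∈ Ioo (-R - ρ) (R + ρ)
    · exact f.contDiff.contDiffAt.mul (hv.contDiffAt (isOpen_Ioo.mem_nhds hx))
    · have hlt : R + ρ / 2 < |x| := by
        by_contra hle
        rw [not_lt, abs_le] at hle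
        exact hx ⟨by linarith [hle.1], by linarith [hle.2]⟩
      refine (contDiffAt_const (c := (0 : ℝ))).congr_of_eventuallyEq ?_
      filter_upwards [(isOpen_lt continuous_const continuous_abs).mem_nhds hlt] with y hy
      have : f y = 0 := f.zero_of_le_dist (by simpa using le_of_lt hy)
      rw [this, zero_mul]
  refine ⟨fun x => f x * v x, hsmooth, fun x hx => ?_, fun j => ?_⟩
  · have : f x = 1 := f.one_of_mem_closedBall (by
      rw [mem_closedBall_zero_iff, Real.norm_eq_abs]; exact abs_le.2 hx)
    simp only [this, one_mul]
  · have hc : HasCompactSupport (iteratedFDeriv ℝ j fun x => f x * v x) :=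
      (f.hasCompactSupport.mul_right).iteratedFDeriv j
    obtain ⟨B, hB⟩ := (hsmooth.continuous_iteratedFDeriv (m := j)
      (by exact_mod_cast le_top)).bounded_above_of_compact_support hc
    refine ⟨B, fun x => ?_⟩
    rw [← Real.norm_eq_abs, ← norm_iteratedFDeriv_eq_norm_iteratedDeriv]
    exact hB x

lemma contDiff_of_hasStripExtension {ρ : ℝ} (hρ : 0 < ρ) {F : ℂ → ℂ}
    (hF : AnalyticOnNhd ℂ F {z : ℂ | |z.im| < ρ}) :
    ContDiff ℝ (⊤ : ℕ∞) fun x : ℝ => (F x).re := by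
  refine contDiff_iff_contDiffAt.2 fun x => ?_
  have h1 : ContDiffAt ℝ (⊤ : ℕ∞) F (x : ℂ) :=
    ((hF x (by simpa using hρ)).restrictScalars (𝕜 := ℝ)).contDiffAt
  exact Complex.reCLM.contDiff.contDiffAt.comp x
    (h1.comp x Complex.ofRealCLM.contDiff.contDiffAt)

end SmoothExtension

section Rates

lemma rpow_le_rpow_of_exponent_ge_of_le {r R a b : ℝ} (hr : 0 < r) (hrR : r ≤ R) (hab : a ≤ b) :
    r ^ b ≤ R ^ (b - a) * r ^ a := by
  calc r ^ b = r ^ (b - a) * r ^ a := by rw [← Real.rpow_add hr]; congr 1; ring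
    _ ≤ _ := by
        have : r ^ (b - a) ≤ R ^ (b - a) := Real.rpow_le_rpow hr.le hrR (by linarith)
        gcongr

/-- The left side is exactly `r ^ (4tn - 4)`, and `4tn ≥ 4t(n - 1)/3`. As `r ≤ R`, lowering the
exponent costs only a fixed power of `R`. -/
lemma rpow_pow_div_le {r R t : ℝ} {n : ℕ} (hr : 0 < r) (hrR : r ≤ R) (ht : 0 ≤ t) :
    (r ^ t) ^ (4 * n) / r ^ 4 ≤ R ^ (4 * t * n - 4 * t * ((n : ℝ) - 1) / 3) *
      r ^ (4 * t * ((n : ℝ) - 1) / 3 - 4) := by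
  have e : (r ^ t) ^ (4 * n) / r ^ 4 = r ^ (4 * t * n - 4) := by
    rw [Real.rpow_sub hr, ← Real.rpow_mul_natCast hr.le]
    congr 1
    · congr 1; push_cast; ring
    · norm_cast
  rw [e]
  have hn : (0 : ℝ) ≤ n := Nat.cast_nonneg n
  refine (rpow_le_rpow_of_exponent_ge_of_le (a := 4 * t * ((n : ℝ) - 1) / 3 - 4) hr hrR ?_).trans
    (le_of_eq ?_)
  · nlinarith [mul_nonneg ht hn]
  · congr 2; ring

/-- `exp (-κ r^{-β})` vanishes faster than any power of `r` as `r → 0⁺`. -/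
lemma exp_neg_rpow_isLittleO {κ β : ℝ} (hκ : 0 < κ) (hβ : β < 0) (a : ℝ) :
    (fun r : ℝ => Real.exp (-κ * r ^ β)) =o[𝓝[>] 0] (fun r : ℝ => r ^ a) := by
  have h1 := (isLittleO_exp_neg_mul_rpow_atTop hκ (a / β)).comp_tendsto
    (tendsto_rpow_neg_nhdsGT_zero hβ)
  refine h1.congr' (by rfl) ?_
  filter_upwards [self_mem_nhdsWithin] with r hr
  have hr : 0 < r := hr
  simp only [Function.comp]
  rw [← Real.rpow_mul hr.le, mul_div_cancel₀ _ hβ.ne]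

end Rates

/-- The convergence rate for a solution which is smooth up to the boundary. -/
theorem expMinLoss_le_of_smooth (D : EllipticBVP) {γ : ℝ} (hγ : 0 ≤ γ) {u : ℝ → ℝ}
    (hu : D.IsSolution u) {Np : ℕ} (hNp : 0 < Np) {ρ : ℝ} (hρ : 0 < ρ) {v : ℝ → ℝ}
    (hv : ContDiffOn ℝ (⊤ : ℕ∞) v (Ioo (-D.R - ρ) (D.R + ρ)))
    (huv : ∀ x ∈ Ioo (-D.R) D.R, v x = u x) {t : ℝ} (ht : t ∈ Ioo (0 : ℝ) 1) :
    ∃ C, 0 ≤ C ∧ ∀ P : ℕ, 1 ≤ P → expMinLoss D γ P Np (patchSize D.R P ^ t) ≤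
      C * patchSize D.R P ^ (4 * t * ((Np : ℝ) - 1) / 3 - 4) := by
  obtain ⟨u₁, u₂, hu₂, hu0, hu1, heq, hbc⟩ := hu
  have hR := D.R_pos
  obtain ⟨q, hq, hqv, hqb⟩ := exists_bounded_smooth_extension hR hρ hv
  choose B hB using hqb
  have hq1 : ContDiff ℝ (⊤ : ℕ∞) (deriv q) := by
    rw [contDiff_infty_iff_deriv] at hq; exact hq.2
  have hq2 : ContDiff ℝ (⊤ : ℕ∞) (deriv (deriv q)) := by
    rw [contDiff_infty_iff_deriv] at hq1; exact hq1.2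
  have hFTC : ∀ {f : ℝ → ℝ}, ContDiff ℝ (⊤ : ℕ∞) f → Continuous (deriv f) →
      ∀ x ∈ Icc (-D.R) D.R, f x = f (-D.R) + ∫ y in (-D.R)..x, deriv f y := by
    intro f hf hf' x _
    rw [intervalIntegral.integral_deriv_eq_sub (fun y _ => hf.differentiable (by simp) y)
      (hf'.intervalIntegrable _ _)]
    ring
  obtain ⟨hA, hA2⟩ := derivatives_unique hR (hu₂.integrable one_le_two)
    ((hq2.continuous.integrableOn_Icc (a := -D.R) (b := D.R)).mono_set Ioo_subset_Icc_self)
    hu0 hu1 (hFTC hq hq1.continuous) (hFTC hq1 hq2.continuous) (by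
      filter_upwards [ae_restrict_mem measurableSet_Ioo] with x hx
      rw [hqv x (Ioo_subset_Icc_self hx), huv x hx])
  obtain ⟨C, hC, hmain⟩ := expMinLoss_le_of_approx D hγ hu₂ heq hbc hNp (D.R ^ t)
  -- As `t < 1`, `L` is a lower bound for `S / r = r ^ (t - 1)` over all `r ≤ R`. Dividing the
  -- derivative bounds by powers of `L` makes `M` independent of `r`.
  set L := D.R ^ (t - 1) with hL
  have hL0 : 0 < L := Real.rpow_pos_of_pos hR _
  set M := ∑ j ∈ Finset.range (2 * Np + 1), |B j| / L ^ j with hM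
  refine ⟨C * (M ^ 2 * D.R ^ (4 * t * Np - 4 * t * ((Np : ℝ) - 1) / 3)), by positivity, ?_⟩
  intro P hP
  have hr := patchSize_pos hR hP
  have hrR := patchSize_le hR hP
  set r := patchSize D.R P with hrdef
  have hSr : r ^ t / r = r ^ (t - 1) := by rw [Real.rpow_sub_one hr.ne']
  have hLr : L ≤ r ^ t / r := by
    rw [hSr]
    exact Real.rpow_le_rpow_of_nonpos hr hrR (by linarith [ht.2])
  -- Here `δ = 0`, because `q` coincides with the solution on the interval, derivatives included.
  have := hmain P hP (r ^ t) M 0 q (by positivity) (Real.rpow_le_rpow hr.le hrR ht.1.le) hq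
    (fun j hj x => by
      calc |iteratedDeriv j q x| ≤ |B j| := (hB j x).trans (le_abs_self _)
        _ = |B j| / L ^ j * L ^ j := by field_simp
        _ ≤ M * (r ^ t / r) ^ j := by
            gcongr
            exact Finset.single_le_sum (f := fun j => |B j| / L ^ j)
              (fun j _ => by positivity) (Finset.mem_range.2 (by omega)))
    (fun x hx => by simp [(hA x hx).1, (hA x hx).2])
    (by
      refine le_of_eq ?_
      rw [integral_congr_ae (g := fun _ => (0 : ℝ)) (by
        filter_upwards [hA2] with x hx
        simp [hx])]
      simp)
  refine this.trans ?_
  rw [add_zero, mul_assoc, mul_assoc]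
  have := rpow_pow_div_le (n := Np) hr hrR ht.1.le
  gcongr

/-- The convergence rate for a solution of class `H^s`. -/
theorem expMinLoss_le_of_memHs (D : EllipticBVP) {γ : ℝ} (hγ : 0 ≤ γ) {u : ℝ → ℝ}
    (hu : D.IsSolution u) {Np : ℕ} (hNp : 0 < Np) {s : ℝ} (hs : 2 ≤ s) (hmem : MemHs s D.R u)
    {t : ℝ} (ht : t ∈ Ioo (0 : ℝ) 1) :
    ∃ C : ℝ, ∀ P : ℕ, 1 ≤ P → expMinLoss D γ P Np (patchSize D.R P ^ t) ≤
      C * (patchSize D.R P ^ (4 * t * ((Np : ℝ) - 1) / 3 - 4)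
        + patchSize D.R P ^ (2 * (1 - t) * (s - 2))) := by
  obtain ⟨u₁, u₂, hu₂, hu0, hu1, heq, hbc⟩ := hu
  have hR := D.R_pos
  obtain ⟨M, hM, happ⟩ := exists_bandlimited_approx hR hs hu₂ hu0 hu1 hmem
  obtain ⟨C, hC, hmain⟩ := expMinLoss_le_of_approx D hγ hu₂ heq hbc hNp (D.R ^ t)
  set K₁ := D.R ^ (4 * t * Np - 4 * t * ((Np : ℝ) - 1) / 3) with hK₁
  set K₂ := (((2 * Real.pi)⁻¹ : ℝ) ^ (2 - s)) ^ 2 with hK₂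
  have hK₁0 : 0 ≤ K₁ := by positivity
  refine ⟨C * (M ^ 2 * K₁ + M * K₂), ?_⟩
  intro P hP
  have hr := patchSize_pos hR hP
  have hrR := patchSize_le hR hP
  set r := patchSize D.R P with hrdef
  have hSr : r ^ t / r = r ^ (t - 1) := by rw [Real.rpow_sub_one hr.ne']
  -- The cutoff is chosen so that `2πW = S / r`: the derivatives of the band-limited function grow
  -- at exactly the rate which the local approximation tolerates.
  set W := (2 * Real.pi)⁻¹ * r ^ (t - 1) with hW
  have hW0 : 0 < W := by positivity
  have hWS : 2 * Real.pi * W = r ^ t / r := by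
    rw [hSr, hW]
    field_simp
  have hWs : (W ^ (2 - s)) ^ 2 = K₂ * r ^ (2 * (1 - t) * (s - 2)) := by
    rw [hW, Real.mul_rpow (by positivity) (by positivity), mul_pow, ← Real.rpow_mul hr.le,
      ← Real.rpow_mul_natCast hr.le]
    congr 2
    push_cast
    ring
  obtain ⟨q, hq, hqb, hqu, hqu2⟩ := happ W hW0
  rw [hWS] at hqb
  have := hmain P hP (r ^ t) M _ q (by positivity) (Real.rpow_le_rpow hr.le hrR ht.1.le) hq
    (fun j _ x => hqb j x) hqu hqu2
  refine this.trans ?_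
  have h1 := rpow_pow_div_le (n := Np) hr hrR ht.1.le
  rw [hWs]
  set X := r ^ (4 * t * ((Np : ℝ) - 1) / 3 - 4)
  set Y := r ^ (2 * (1 - t) * (s - 2))
  have hX : 0 ≤ X := by positivity
  have hY : 0 ≤ Y := by positivity
  have hK₂0 : 0 ≤ K₂ := by positivity
  calc C * (M ^ 2 * ((r ^ t) ^ (4 * Np) / r ^ 4) + M * (K₂ * Y))
      ≤ C * (M ^ 2 * (K₁ * X) + M * (K₂ * Y)) := by gcongr
    _ ≤ C * (M ^ 2 * K₁ + M * K₂) * (X + Y) := by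
        rw [mul_assoc]
        gcongr
        have a1 : 0 ≤ M ^ 2 * K₁ * Y := by positivity
        have a2 : 0 ≤ M * K₂ * X := by positivity
        linarith

end RFM

end

/-! ### Assembly of the rates -/

theorem corollary2p11 (D : RFM.EllipticBVP) (γ : ℝ) (hγ : 0 ≤ γ) (u : ℝ → ℝ)
    (hu : D.IsSolution u) (Np : ℕ) (hNp : 4 < Np) :
    -- the minimum over the coefficients is attained, and the minimal loss is integrable
    (∀ P : ℕ, 1 ≤ P →
      (∀ k, IsLeast (range (RFM.loss D γ P Np k)) (RFM.minLoss D γ P Np k)) ∧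
      ∀ S : ℝ, 0 < S → IsProbabilityMeasure (RFM.weightLaw P Np S) ∧
        Integrable (RFM.minLoss D γ P Np) (RFM.weightLaw P Np S)) ∧
    -- (i), analytic class (`s = 1`)
    (∀ ρ : ℝ, 0 < ρ → RFM.HasStripExtension D.R ρ u →
      ∀ t ∈ Ioo (0 : ℝ) 1, ∃ κ > 0,
        (∃ C : ℝ, ∀ P : ℕ, 1 ≤ P →
          RFM.expMinLoss D γ P Np (RFM.patchSize D.R P ^ t) ≤
            C * (RFM.patchSize D.R P ^ (4 * t * ((Np : ℝ) - 1) / 3 - 4)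
              + Real.exp (-κ * RFM.patchSize D.R P ^ (t - 1)))) ∧
        (fun r : ℝ => Real.exp (-κ * r ^ (t - 1)))
          =o[𝓝[>] 0] (fun r : ℝ => r ^ (4 * t * ((Np : ℝ) - 1) / 3 - 4))) ∧
    -- (i), Gevrey class of index `s > 1`
    (∀ s : ℝ, 1 < s → ∀ ρ : ℝ, 0 < ρ → RFM.HasGevreyExtension s D.R ρ u →
      ∀ t ∈ Ioo (0 : ℝ) 1, ∃ κ > 0,
        (∃ C : ℝ, ∀ P : ℕ, 1 ≤ P →
          RFM.expMinLoss D γ P Np (RFM.patchSize D.R P ^ t) ≤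
            C * (RFM.patchSize D.R P ^ (4 * t * ((Np : ℝ) - 1) / 3 - 4)
              + Real.exp (-κ * RFM.patchSize D.R P ^ ((t - 1) / s)))) ∧
        (fun r : ℝ => Real.exp (-κ * r ^ ((t - 1) / s)))
          =o[𝓝[>] 0] (fun r : ℝ => r ^ (4 * t * ((Np : ℝ) - 1) / 3 - 4))) ∧
    -- (ii), Sobolev space
    (∀ s : ℝ, 2 ≤ s → RFM.MemHs s D.R u →
      (∀ t ∈ Ioo (0 : ℝ) 1, ∃ C : ℝ, ∀ P : ℕ, 1 ≤ P →
        RFM.expMinLoss D γ P Np (RFM.patchSize D.R P ^ t) ≤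
          C * (RFM.patchSize D.R P ^ (4 * t * ((Np : ℝ) - 1) / 3 - 4)
            + RFM.patchSize D.R P ^ (2 * (1 - t) * (s - 2)))) ∧
      3 * s / (2 * (Np : ℝ) + 3 * s - 8) ∈ Ioo (0 : ℝ) 1 ∧
      ∃ C : ℝ, ∀ P : ℕ, 1 ≤ P →
        RFM.expMinLoss D γ P Np (RFM.patchSize D.R P ^ (3 * s / (2 * (Np : ℝ) + 3 * s - 8))) ≤
          C * RFM.patchSize D.R P ^
            (4 * ((Np : ℝ) - 4) * (s - 2) / (2 * (Np : ℝ) + 3 * s - 8))) := by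
  have hNp0 : 0 < Np := by omega
  have hNpR : (5 : ℝ) ≤ Np := by exact_mod_cast hNp
  -- Both classes in (i) provide a function smooth in a neighbourhood of `[-R, R]`, and they differ
  -- only in the index `s` of the exponential; the analytic class is `s = 1`.
  have smooth : ∀ s : ℝ, 1 ≤ s → ∀ ρ : ℝ, 0 < ρ → ∀ v : ℝ → ℝ,
      ContDiffOn ℝ (⊤ : ℕ∞) v (Ioo (-D.R - ρ) (D.R + ρ)) → (∀ x ∈ Ioo (-D.R) D.R, v x = u x) →
      ∀ t ∈ Ioo (0 : ℝ) 1, ∃ κ > 0,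
        (∃ C : ℝ, ∀ P : ℕ, 1 ≤ P →
          RFM.expMinLoss D γ P Np (RFM.patchSize D.R P ^ t) ≤
            C * (RFM.patchSize D.R P ^ (4 * t * ((Np : ℝ) - 1) / 3 - 4)
              + Real.exp (-κ * RFM.patchSize D.R P ^ ((t - 1) / s)))) ∧
        (fun r : ℝ => Real.exp (-κ * r ^ ((t - 1) / s)))
          =o[𝓝[>] 0] (fun r : ℝ => r ^ (4 * t * ((Np : ℝ) - 1) / 3 - 4)) := by
    intro s hs ρ hρ v hv huv t ht
    obtain ⟨C, hC, h⟩ := RFM.expMinLoss_le_of_smooth D hγ hu hNp0 hρ hv huv ht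
    -- The algebraic term alone bounds the loss, so the nonnegative exponential may be added with
    -- any `κ > 0`; `κ = 1` is taken.
    refine ⟨1, one_pos, ⟨C, fun P hP => (h P hP).trans ?_⟩, RFM.exp_neg_rpow_isLittleO one_pos
      (div_neg_of_neg_of_pos (by linarith [ht.2]) (by linarith)) _⟩
    gcongr
    linarith [Real.exp_pos (-1 * RFM.patchSize D.R P ^ ((t - 1) / s))]
  refine ⟨fun P hP => ⟨RFM.isLeast_minLoss D hγ hP, fun S hS => ?_⟩, ?_, ?_, ?_⟩
  · have := RFM.isProbabilityMeasure_weightLaw P Np hS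
    exact ⟨this, RFM.integrable_minLoss D hγ hP _⟩
  · rintro ρ hρ ⟨F, hF, -, hFu⟩ t ht
    have := smooth 1 le_rfl ρ hρ (fun x => (F x).re)
      (RFM.contDiff_of_hasStripExtension hρ hF).contDiffOn
      (fun x hx => by simp only [hFu x hx, Complex.ofReal_re]) t ht
    simpa only [div_one] using this
  · rintro s hs ρ hρ ⟨v, hv, hvu⟩ t ht
    exact smooth s hs.le ρ hρ v hv.1 hvu t ht
  · intro s hs hmem
    have hden : 0 < 2 * (Np : ℝ) + 3 * s - 8 := by linarith
    have ht : 3 * s / (2 * (Np : ℝ) + 3 * s - 8) ∈ Ioo (0 : ℝ) 1 :=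
      ⟨div_pos (by linarith) hden, (div_lt_one hden).2 (by linarith)⟩
    refine ⟨fun t ht => RFM.expMinLoss_le_of_memHs D hγ hu hNp0 hs hmem ht, ht, ?_⟩
    obtain ⟨C, h⟩ := RFM.expMinLoss_le_of_memHs D hγ hu hNp0 hs hmem ht
    -- At `t_*` the two exponents coincide, so the two powers of `r` add up to twice a single one.
    refine ⟨2 * C, fun P hP => (h P hP).trans (le_of_eq ?_)⟩
    have e1 : 4 * (3 * s / (2 * (Np : ℝ) + 3 * s - 8)) * ((Np : ℝ) - 1) / 3 - 4 =
        4 * ((Np : ℝ) - 4) * (s - 2) / (2 * (Np : ℝ) + 3 * s - 8) := by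
      field_simp
      ring
    have e2 : 2 * (1 - 3 * s / (2 * (Np : ℝ) + 3 * s - 8)) * (s - 2) =
        4 * ((Np : ℝ) - 4) * (s - 2) / (2 * (Np : ℝ) + 3 * s - 8) := by
      field_simp
      ring
    rw [e1, e2]
    ring
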